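/- Let $T>0$ and let $W$ be a standard $N$-dimensional Brownian motion on a probability space $(\Omega,\mathcal F,\mathbb P)$, with filtration $\mathcal F_s=\sigma(W_v:0\le v\le s)$. Consider a log-normal market with constant drift $\mu\in\mathbb R^N$, invertible volatility matrix $\sigma\in\mathbb R^{N\times N}$ (the $i$-th column being the volatility vector of the $i$-th stock), constant interest rate $\rho>0$, and market price of risk $\lambda=(\sigma^{T})^{-1}(\mu-\rho\mathbf 1)$. For $t\in[0,T]$ and $x\ge0$, the (discounted) wealth $X^\pi$ of an investment process $\pi$ solves $dX^\pi_s=\sigma\pi_s\cdot(\lambda\,ds+dW_s)$ on $[t,T]$ with $X^\pi_t=x$; $\pi$ is admissible if it is measurable and adapted to $(\mathcal F_s)$, $E\int_t^T|\pi_s|^2ds<\infty$, and $X^\pi_s\ge0$ for $s\in[t,T]$. Let $U:(0,\infty)\to\mathbb R$ be $C^\infty$, strictly increasing and strictly concave, with $U'(0+)=\infty$ and $U'(\infty)=0$ (and set $U(0):=U(0+)\in[-\infty,\infty)$). Assume that its inverse marginal $I=(U')^{(-1)}:(0,\infty)\to(0,\infty)$ satisfies, for all $y>0$, $$I(y)\le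 C(1+y^{-\delta}),\qquad c_1I(y)\le|yI'(y)|\le C_1I(y),$$ $$c_2|I'(y)|\le yI''(y)\le C_2|I'(y)|,\qquad |yI'''(y)|\le C_3I''(y),$$ for some positive constants $C,\delta,c_1,C_1,c_2,C_2,C_3$ with $c_2>1$. Let $$u(x,t)=\sup_{\pi\ \mathrm{admissible}}E\big[U(X^\pi_T)\mid X^\pi_t=x\big],\qquad R(x)=-\frac{U'(x)}{U''(x)},\qquad r(x,t)=-\frac{u_x(x,t)}{u_{xx}(x,t)}\qquad(x>0),$$ and $R(0)=0$, $r(0,t)=0$. Assume that $R(x)\to0$ as $x\downarrow0$ and that $R$ is strictly increasing on $[0,\infty)$. Then for each $t\in[0,T]$ the function $r(\cdot,t)$ is well defined: $u(\cdot,t)$ is finite and twice continuously differentiable on $(0,\infty)$ with $u_{xx}(\cdot,t)<0$, and $r(x,t)\to0$ as $x\downarrow0$. Moreover, if $R$ is concave (resp. convex) on $[0,\infty)$, then (i) for each $x\ge0$, the function $r(x,\cdot)$ is nondecreasing (resp. nonincreasing) on $[0,T]$; (ii) for each $t\in[0,T)$, the function $r(\cdot,t)$ is concave (resp. convex) on $[0,\infty)$.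 -/

import Mathlib

open MeasureTheory ProbabilityTheory Set Filter Topology
open scoped NNReal ENNReal Matrix

namespace Merton

/-! ### Brownian motion and the Ito integral of square integrable integrands -/

/-- `W` is a standard `N`-dimensional Brownian motion: its coordinates are independent real
Brownian motions. -/
structure IsStandardBrownian {N : ℕ} {Ω : Type*} [MeasurableSpace Ω]
    (W : ℝ≥0 → Ω → Fin N → ℝ) (P : Measure Ω) : Prop where
  measurable : ∀ t, Measurable (W t)
  isBrownian : ∀ j, IsBrownianReal (fun t ω => W t ω j) P
  indep : iIndepFun (fun (j : Fin N) (ω : Ω) (t : ℝ≥0) => W t ω j) P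

/-- The filtration of `W`: the sigma-algebra generated by `W r`, `0 ≤ r ≤ s`. -/
abbrev pastSigma {N : ℕ} {Ω : Type*} (W : ℝ≥0 → Ω → Fin N → ℝ) (s : ℝ≥0) : MeasurableSpace Ω :=
  ⨆ r ≤ s, MeasurableSpace.comap (W r) inferInstance

/-- The squared Euclidean norm. -/
def normSq {N : ℕ} (v : Fin N → ℝ) : ℝ := v ⬝ᵥ v

/-- A simple (elementary) integrand `∑ k < n, ξ k • 1_(time k, time (k+1)]`, with square
integrable `ξ k` that is measurable with respect to the past of `time k`. -/
structure SimpleIntegrand {N : ℕ} {Ω : Type*} [MeasurableSpace Ω]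
    (W : ℝ≥0 → Ω → Fin N → ℝ) (P : Measure Ω) where
  n : ℕ
  time : ℕ → ℝ≥0
  time_mono : Monotone time
  ξ : ℕ → Ω → Fin N → ℝ
  adapted : ∀ k, Measurable[pastSigma W (time k)] (ξ k)
  memLp : ∀ k, MemLp (ξ k) 2 P

/-- The process described by a simple integrand. -/
noncomputable def SimpleIntegrand.eval {N : ℕ} {Ω : Type*} [MeasurableSpace Ω]
    {W : ℝ≥0 → Ω → Fin N → ℝ} {P : Measure Ω} (φ : SimpleIntegrand W P)
    (s : ℝ) (ω : Ω) : Fin N → ℝ :=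
  ∑ k ∈ Finset.range φ.n,
    (Ioc (φ.time k : ℝ) (φ.time (k + 1) : ℝ)).indicator (fun _ => φ.ξ k ω) s

/-- The elementary stochastic integral `∫_a^b φ ⬝ dW` of a simple integrand, for `a ≤ b`. -/
noncomputable def SimpleIntegrand.integral {N : ℕ} {Ω : Type*} [MeasurableSpace Ω]
    {W : ℝ≥0 → Ω → Fin N → ℝ} {P : Measure Ω} (φ : SimpleIntegrand W P)
    (a b : ℝ≥0) (ω : Ω) : ℝ :=
  ∑ k ∈ Finset.range φ.n,
    φ.ξ k ω ⬝ᵥ (W (max a (min (φ.time (k + 1)) b)) ω - W (max a (min (φ.time k) b)) ω)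

/-- `M s = ∫_t^s φ ⬝ dW` almost surely, for each `s ∈ [t, T]`: there are simple integrands that
converge to `φ` in `L²([t, T] × Ω)` and whose elementary integrals over `[t, s]` converge in
`L²(Ω)` to `M s`. -/
def IsItoIntegral {N : ℕ} {Ω : Type*} [MeasurableSpace Ω]
    (W : ℝ≥0 → Ω → Fin N → ℝ) (P : Measure Ω) (t T : ℝ)
    (φ : ℝ → Ω → Fin N → ℝ) (M : ℝ → Ω → ℝ) : Prop :=
  (∀ s ∈ Icc t T, AEMeasurable (M s) P) ∧
  ∃ Φ : ℕ → SimpleIntegrand W P,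
    Tendsto (fun n => ∫⁻ ω, (∫⁻ s in Icc t T,
      ENNReal.ofReal (normSq ((Φ n).eval s ω - φ s ω))) ∂P) atTop (𝓝 0) ∧
    ∀ s ∈ Icc t T,
      Tendsto (fun n => ∫⁻ ω,
        ENNReal.ofReal ((M s ω - (Φ n).integral t.toNNReal s.toNNReal ω) ^ 2) ∂P) atTop (𝓝 0)

/-! ### The market -/

/-- The coefficients of a log-normal market with `N` stocks,
`dS^i = S^i (μ i dt + ∑ j, σ j i dW^j)` (so the `i`-th column of `σ` is the volatility of the
`i`-th stock), and a riskless asset of constant interest rate. -/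
structure Market (N : ℕ) where
  μ : Fin N → ℝ
  σ : Matrix (Fin N) (Fin N) ℝ
  rate : ℝ
  rate_pos : 0 < rate
  isUnit_σ : IsUnit σ

/-- The market price of risk `λ = (σᵀ)⁻¹ (μ - rate 𝟏)`. -/
noncomputable def Market.priceOfRisk {N : ℕ} (m : Market N) : Fin N → ℝ :=
  (m.σᵀ)⁻¹ *ᵥ (m.μ - fun _ => m.rate)

/-- `X` solves `dX_s = σ π_s ⬝ (λ ds + dW_s)` on `[t, T]` with `X_t = x`. -/
def IsWealth {N : ℕ} {Ω : Type*} [MeasurableSpace Ω]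
    (W : ℝ≥0 → Ω → Fin N → ℝ) (P : Measure Ω) (m : Market N) (T x t : ℝ)
    (π : ℝ → Ω → Fin N → ℝ) (X : ℝ → Ω → ℝ) : Prop :=
  (∀ᵐ ω ∂P, ContinuousOn (fun s => X s ω) (Icc t T)) ∧
  ∃ M : ℝ → Ω → ℝ, IsItoIntegral W P t T (fun s ω => m.σ *ᵥ π s ω) M ∧
    ∀ s ∈ Icc t T, ∀ᵐ ω ∂P,
      X s ω = x + (∫ v in t..s, (m.σ *ᵥ π v ω) ⬝ᵥ m.priceOfRisk) + M s ω

/-- `π` is an admissible investment process on `[t, T]` (measurable, adapted to the filtration of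
`W`, with `E ∫ |π|² < ∞`), and `X` is its wealth process from `X_t = x`, which stays
nonnegative. -/
structure IsAdmissible {N : ℕ} {Ω : Type*} [MeasurableSpace Ω]
    (W : ℝ≥0 → Ω → Fin N → ℝ) (P : Measure Ω) (m : Market N) (T x t : ℝ)
    (π : ℝ → Ω → Fin N → ℝ) (X : ℝ → Ω → ℝ) : Prop where
  measurable : Measurable (Function.uncurry π)
  adapted : ∀ s ∈ Icc t T, Measurable[pastSigma W s.toNNReal] (π s)
  sq_integrable : ∫⁻ ω, (∫⁻ s in Icc t T, ENNReal.ofReal (normSq (π s ω))) ∂P < ⊤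
  wealth : IsWealth W P m T x t π X
  nonneg : ∀ᵐ ω ∂P, ∀ s ∈ Icc t T, 0 ≤ X s ω

/-! ### Utility and value function -/

/-- `U` is a utility function on `(0, ∞)`: smooth, strictly increasing, strictly concave, and
satisfying the Inada conditions. Values of `U` outside `(0, ∞)` play no role. -/
structure IsUtility (U : ℝ → ℝ) : Prop where
  strictConcave : StrictConcaveOn ℝ (Ioi 0) U
  strictMono : StrictMonoOn U (Ioi 0)
  smooth : ContDiffOn ℝ ((⊤ : ℕ∞) : WithTop ℕ∞) U (Ioi 0)
  inada_zero : Tendsto (deriv U) (𝓝[>] 0) atTop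
  inada_top : Tendsto (deriv U) atTop (𝓝 0)

/-- The inverse `I` of the marginal utility `U' : (0, ∞) → (0, ∞)`. -/
noncomputable def inverseMarginal (U : ℝ → ℝ) : ℝ → ℝ := Function.invFunOn (deriv U) (Ioi 0)

/-- The growth conditions on a function `I` and its first three derivatives on `(0, ∞)`. -/
def InverseMarginalBounds (I : ℝ → ℝ) : Prop :=
  (∃ C > (0 : ℝ), ∃ δ > (0 : ℝ), ∀ y > (0 : ℝ), I y ≤ C * (1 + y ^ (-δ))) ∧
  (∃ c₁ > (0 : ℝ), ∃ C₁ > (0 : ℝ), ∀ y > (0 : ℝ), c₁ * I y ≤ |y * deriv I y| ∧ |y * deriv I y| ≤ C₁ * I y) ∧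
  (∃ c₂ > (1 : ℝ), ∃ C₂ > (0 : ℝ), ∀ y > (0 : ℝ), c₂ * |deriv I y| ≤ y * iteratedDeriv 2 I y ∧
    y * iteratedDeriv 2 I y ≤ C₂ * |deriv I y|) ∧
  (∃ C₃ > (0 : ℝ), ∀ y > (0 : ℝ), |y * iteratedDeriv 3 I y| ≤ C₃ * iteratedDeriv 2 I y)

/-- `U` extended to nonpositive wealth by its (possibly infinite) limit
`U(0+) = inf_{y > 0} U(y)`. -/
noncomputable def extendedUtility (U : ℝ → ℝ) (x : ℝ) : EReal :=
  if 0 < x then (U x : EReal) else ⨅ y : Ioi (0 : ℝ), (U y : EReal)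

/-- The expectation `E f⁺ - E f⁻` of an extended real random variable (`⊥` if both parts are
infinite). -/
noncomputable def expectation {Ω : Type*} [MeasurableSpace Ω] (P : Measure Ω)
    (f : Ω → EReal) : EReal :=
  ((∫⁻ ω, (f ω).toENNReal ∂P : ℝ≥0∞) : EReal) - ((∫⁻ ω, (-f ω).toENNReal ∂P : ℝ≥0∞) : EReal)

/-- The value function `u(x, t)`: the maximal expected utility of terminal wealth. -/
noncomputable def valueFunction {N : ℕ} {Ω : Type*} [MeasurableSpace Ω]
    (W : ℝ≥0 → Ω → Fin N → ℝ) (P : Measure Ω) (m : Market N) (T : ℝ) (U : ℝ → ℝ)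
    (x t : ℝ) : EReal :=
  sSup {v | ∃ π X, IsAdmissible W P m T x t π X ∧
    v = expectation P (fun ω => extendedUtility U (X T ω))}

/-- The risk tolerance coefficient `R(x) = - U'(x) / U''(x)` for `x > 0`, with `R(0) = 0`. -/
noncomputable def riskToleranceCoeff (U : ℝ → ℝ) (x : ℝ) : ℝ :=
  if 0 < x then -(deriv U x / iteratedDeriv 2 U x) else 0

/-- The risk tolerance function `r(x, t) = - u_x(x, t) / u_xx(x, t)` for `x > 0`, with
`r(0, t) = 0`. -/
noncomputable def riskTolerance {N : ℕ} {Ω : Type*} [MeasurableSpace Ω]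
    (W : ℝ≥0 → Ω → Fin N → ℝ) (P : Measure Ω) (m : Market N) (T : ℝ) (U : ℝ → ℝ)
    (x t : ℝ) : ℝ :=
  riskToleranceCoeff (fun y => (valueFunction W P m T U y t).toReal) x

end Merton

/-! Let `h` be the marginal-utility parametrisation of wealth, `U' (h z) = exp z`, that is `h z = I
(exp z)`, and put `p = -h'`, `q = p'`. Differentiating `U' (h z) = exp z` gives `R (h z) = p z`, so
the graph of `R` is the curve `(h, p)`. The growth conditions on `I` make these functions at most
exponential, so that Gaussian averages and derivatives under the integral are harmless.

The solution of the investment problem says that, with `θ = |λ|² (T - t)` and `gconv θ` the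
convolution with the centered Gaussian law of variance `θ`, the value function is the curve `u
(gconv θ h ζ, t) = gconv θ (U ∘ h) (ζ - θ)` (`DualProfile.valueFunction_eq`). Two differentiations
give `r (gconv θ h ζ, t) = gconv θ p ζ`. Regularity of `u` follows, and both qualitative claims
become statements about Gaussian convolution.

Shape in `x`: the slope of `R` at `h z` is `-q / p` and `h` decreases, so `R` is concave exactly
when `q / p` decreases, i.e. when `p` is log-concave; it is convex exactly when `p` is log-convex.
Gaussian convolution preserves both properties, by total positivity of the kernel (`gconv_cross`).
Monotonicity in `t`: for concave `R`, Jensen gives `E[R (h (z + w))] ≤ R (E[h (z + w)])`, so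
smoothing lowers the risk tolerance (`Profile.risk_gconv_le`); since the smoothed risk tolerance is
again concave, the semigroup law compares any two times.

The dual formula has two halves. Upper bound (`DualProfile.expectation_le`): the tangent inequality
for `U` is averaged against the budget identity `E[Z X_T] = x` (`IsAdmissible.budget`), where `Z` is
the Girsanov density; the identity holds for simple integrands by independence of increments and
passes to `L²` limits. Lower bound (`DualProfile.le_valueFunction_of_lt`): the optimal terminal
wealth `h (ζ - θ - λ ⬝ ΔW)` is truncated to a smooth payoff, which is replicated by delta hedging
(`SmoothBdd.exists_isAdmissible`). The Ito formula needed for this is proved by a Taylor expansion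
on a regular grid, with an error of order `1 / n` in mean square. -/

namespace Merton

/-! ### Gaussian convolution of functions of exponential growth -/

/-- Functions of at most exponential growth. -/
def ExpBdd (F : ℝ → ℝ) : Prop := ∃ A c : ℝ, 0 ≤ A ∧ 0 ≤ c ∧ ∀ z, |F z| ≤ A * Real.exp (c * |z|)

theorem ExpBdd.mono {F G : ℝ → ℝ} (hF : ExpBdd F) {K : ℝ} (hK : 0 ≤ K)
    (h : ∀ z, |G z| ≤ K * |F z|) : ExpBdd G := by
  obtain ⟨A, c, hA, hc, hF⟩ := hF
  refine ⟨K * A, c, by positivity, hc, fun z => (h z).trans ?_⟩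
  rw [mul_assoc]
  exact mul_le_mul_of_nonneg_left (hF z) hK

theorem ExpBdd.add {F G : ℝ → ℝ} (hF : ExpBdd F) (hG : ExpBdd G) :
    ExpBdd (fun z => F z + G z) := by
  obtain ⟨A, c, hA, hc, hF⟩ := hF
  obtain ⟨B, d, hB, hd, hG⟩ := hG
  refine ⟨A + B, c + d, by positivity, by positivity, fun z => (abs_add_le _ _).trans ?_⟩
  have h1 : Real.exp (c * |z|) ≤ Real.exp ((c + d) * |z|) :=
    Real.exp_le_exp.2 (by nlinarith [abs_nonneg z])
  have h2 : Real.exp (d * |z|) ≤ Real.exp ((c + d) * |z|) :=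
    Real.exp_le_exp.2 (by nlinarith [abs_nonneg z])
  nlinarith [hF z, hG z, mul_le_mul_of_nonneg_left h1 hA, mul_le_mul_of_nonneg_left h2 hB]

theorem ExpBdd.mul {F G : ℝ → ℝ} (hF : ExpBdd F) (hG : ExpBdd G) :
    ExpBdd (fun z => F z * G z) := by
  obtain ⟨A, c, hA, hc, hF⟩ := hF
  obtain ⟨B, d, hB, hd, hG⟩ := hG
  refine ⟨A * B, c + d, by positivity, by positivity, fun z => ?_⟩
  rw [abs_mul, add_mul, Real.exp_add]
  calc |F z| * |G z| ≤ (A * Real.exp (c * |z|)) * (B * Real.exp (d * |z|)) :=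
        mul_le_mul (hF z) (hG z) (abs_nonneg _) (by positivity)
    _ = _ := by ring

theorem ExpBdd.neg {F : ℝ → ℝ} (hF : ExpBdd F) : ExpBdd (fun z => -F z) :=
  hF.mono zero_le_one (fun z => by simp)

theorem ExpBdd.const_mul {F : ℝ → ℝ} (hF : ExpBdd F) (K : ℝ) : ExpBdd (fun z => K * F z) :=
  hF.mono (abs_nonneg K) (fun z => by simp [abs_mul])

theorem ExpBdd.of_bounded {F : ℝ → ℝ} {K : ℝ} (h : ∀ z, |F z| ≤ K) : ExpBdd F :=
  ⟨K, 0, (abs_nonneg _).trans (h 0), le_rfl, fun z => by simpa using h z⟩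

theorem expBdd_exp (c : ℝ) : ExpBdd (fun z => Real.exp (c * z)) :=
  ⟨1, |c|, zero_le_one, abs_nonneg c, fun z => by
    rw [Real.abs_exp, one_mul, ← abs_mul]
    exact Real.exp_le_exp.2 (le_abs_self _)⟩

theorem ExpBdd.comp_add {F : ℝ → ℝ} (hF : ExpBdd F) (b : ℝ) : ExpBdd (fun z => F (z + b)) := by
  obtain ⟨A, c, hA, hc, hF⟩ := hF
  refine ⟨A * Real.exp (c * |b|), c, by positivity, hc, fun z => (hF _).trans ?_⟩
  rw [mul_assoc, ← Real.exp_add]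
  refine mul_le_mul_of_nonneg_left (Real.exp_le_exp.2 ?_) hA
  nlinarith [abs_add_le z b]

theorem integrable_exp_abs_gaussianReal (μ : ℝ) (θ : ℝ≥0) (c : ℝ) :
    Integrable (fun w => Real.exp (c * |w|)) (gaussianReal μ θ) :=
  integrable_exp_mul_abs (X := fun w => w) (integrable_exp_mul_gaussianReal c)
    (integrable_exp_mul_gaussianReal (-c))

theorem ExpBdd.integrable {F : ℝ → ℝ} (hF : ExpBdd F) (hm : Measurable F) (μ : ℝ) (θ : ℝ≥0) :
    Integrable F (gaussianReal μ θ) := by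
  obtain ⟨A, c, hA, hc, hF⟩ := hF
  exact ((integrable_exp_abs_gaussianReal μ θ c).const_mul A).mono' hm.aestronglyMeasurable
    (ae_of_all _ fun w => by simpa using hF w)

theorem ExpBdd.integrable_add {F : ℝ → ℝ} (hF : ExpBdd F) (hm : Measurable F) (z μ : ℝ) (θ : ℝ≥0) :
    Integrable (fun w => F (z + w)) (gaussianReal μ θ) := by
  have := (hF.comp_add z).integrable (hm.comp (measurable_id.add_const z)) μ θ
  simpa [add_comm] using this

/-- The convolution of `F` with the centered Gaussian law of variance `θ`. -/
noncomputable def gconv (θ : ℝ≥0) (F : ℝ → ℝ) (z : ℝ) : ℝ := ∫ w, F (z + w) ∂gaussianReal 0 θ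

theorem gconv_zero (F : ℝ → ℝ) : gconv 0 F = F := by
  ext z; simp [gconv, gaussianReal_zero_var]

theorem ExpBdd.abs_gconv_le {F : ℝ → ℝ} {A c : ℝ} (hA : 0 ≤ A) (hc : 0 ≤ c)
    (hF : ∀ z, |F z| ≤ A * Real.exp (c * |z|)) (θ : ℝ≥0) (z : ℝ) :
    |gconv θ F z| ≤ A * (∫ w, Real.exp (c * |w|) ∂gaussianReal 0 θ) * Real.exp (c * |z|) := by
  have h1 : ∀ w, ‖F (z + w)‖ ≤ A * Real.exp (c * |z|) * Real.exp (c * |w|) := fun w => by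
    refine (hF _).trans ?_
    rw [mul_assoc, ← Real.exp_add]
    refine mul_le_mul_of_nonneg_left (Real.exp_le_exp.2 ?_) hA
    nlinarith [abs_add_le z w]
  have := norm_integral_le_of_norm_le
    ((integrable_exp_abs_gaussianReal 0 θ c).const_mul (A * Real.exp (c * |z|))) (ae_of_all _ h1)
  rw [integral_const_mul] at this
  rw [gconv, ← Real.norm_eq_abs]
  linarith

theorem ExpBdd.gconv {F : ℝ → ℝ} (hF : ExpBdd F) (θ : ℝ≥0) : ExpBdd (gconv θ F) := by
  obtain ⟨A, c, hA, hc, hF⟩ := hF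
  exact ⟨_, c, mul_nonneg hA (integral_nonneg fun _ => (Real.exp_pos _).le), hc,
    ExpBdd.abs_gconv_le hA hc hF θ⟩

/-- A single integrable majorant valid for all `z` within distance one of `z₀`, as needed for
continuity and differentiation under the integral. -/
theorem ExpBdd.local_bound {F : ℝ → ℝ} {A c : ℝ} (hA : 0 ≤ A) (hc : 0 ≤ c)
    (hF : ∀ z, |F z| ≤ A * Real.exp (c * |z|)) {z₀ z : ℝ} (hz : |z - z₀| ≤ 1) (w : ℝ) :
    ‖F (z + w)‖ ≤ A * Real.exp (c * (|z₀| + 1)) * Real.exp (c * |w|) := by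
  refine (hF _).trans ?_
  rw [mul_assoc, ← Real.exp_add]
  refine mul_le_mul_of_nonneg_left (Real.exp_le_exp.2 ?_) hA
  have : |z| ≤ |z - z₀| + |z₀| := by simpa using abs_add_le (z - z₀) z₀
  nlinarith [abs_add_le z w]

theorem continuous_gconv {F : ℝ → ℝ} (hF : ExpBdd F) (hcont : Continuous F) (θ : ℝ≥0) :
    Continuous (gconv θ F) := by
  obtain ⟨A, c, hA, hc, hF⟩ := hF
  refine continuous_iff_continuousAt.2 fun z₀ => ?_
  refine continuousAt_of_dominated
    (bound := fun w => A * Real.exp (c * (|z₀| + 1)) * Real.exp (c * |w|)) ?_ ?_ ?_ ?_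
  · exact Eventually.of_forall fun z =>
      (hcont.comp (continuous_const.add continuous_id)).aestronglyMeasurable
  · filter_upwards [Metric.closedBall_mem_nhds z₀ one_pos] with z hz
    exact ae_of_all _ (ExpBdd.local_bound hA hc hF (by simpa [Real.dist_eq] using hz))
  · exact (integrable_exp_abs_gaussianReal 0 θ c).const_mul _
  · exact ae_of_all _ fun w => by fun_prop

theorem hasDerivAt_gconv {F F' : ℝ → ℝ} (hF : ExpBdd F) (hF' : ExpBdd F')
    (hd : ∀ z, HasDerivAt F (F' z) z) (hm : Measurable F') (θ : ℝ≥0) (z₀ : ℝ) :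
    HasDerivAt (gconv θ F) (gconv θ F' z₀) z₀ := by
  have hcont : Continuous F := continuous_iff_continuousAt.2 fun z => (hd z).continuousAt
  obtain ⟨A, c, hA, hc, hb⟩ := id hF'
  refine (hasDerivAt_integral_of_dominated_loc_of_deriv_le
    (F := fun z w => F (z + w)) (F' := fun z w => F' (z + w))
    (bound := fun w => A * Real.exp (c * (|z₀| + 1)) * Real.exp (c * |w|))
    (Metric.closedBall_mem_nhds z₀ one_pos) ?_ ?_ ?_ ?_ ?_ ?_).2
  · exact Eventually.of_forall fun z =>
      (hcont.comp (continuous_const.add continuous_id)).aestronglyMeasurable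
  · exact hF.integrable_add hcont.measurable z₀ 0 θ
  · exact (hm.comp (measurable_const.add measurable_id)).aestronglyMeasurable
  · exact ae_of_all _ fun w z hz =>
      ExpBdd.local_bound hA hc hb (by simpa [Real.dist_eq] using hz) w
  · exact (integrable_exp_abs_gaussianReal 0 θ c).const_mul _
  · exact ae_of_all _ fun w z _ => by
      simpa using (hd (z + w)).comp_add_const z w

theorem integral_gaussianReal_eq_add {E : Type*} [NormedAddCommGroup E] [NormedSpace ℝ E]
    (F : ℝ → E) (μ : ℝ) (θ : ℝ≥0) :
    ∫ w, F w ∂gaussianReal μ θ = ∫ w, F (μ + w) ∂gaussianReal 0 θ := by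
  have := gaussianReal_map_const_add (μ := 0) (v := θ) μ
  rw [zero_add] at this
  rw [← this, (measurableEmbedding_addLeft μ).integral_map]

theorem gconv_eq_integral (F : ℝ → ℝ) (θ : ℝ≥0) (z : ℝ) :
    gconv θ F z = ∫ w, F w ∂gaussianReal z θ := (integral_gaussianReal_eq_add F z θ).symm

/-- The heat semigroup law. It lets two maturities be compared by smoothing the shorter one further,
and it identifies the value of a payoff at one time with an average of its values at a later time.
-/
theorem gconv_gconv {F : ℝ → ℝ} (hF : ExpBdd F) (hm : Measurable F) (θ₁ θ₂ : ℝ≥0) (z : ℝ) :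
    gconv θ₁ (gconv θ₂ F) z = gconv (θ₁ + θ₂) F z := by
  have h : gaussianReal 0 θ₁ ∗ gaussianReal 0 θ₂ = gaussianReal 0 (θ₁ + θ₂) := by
    simpa using gaussianReal_conv_gaussianReal (m₁ := 0) (m₂ := 0) (v₁ := θ₁) (v₂ := θ₂)
  have hi := hF.integrable_add hm z 0 (θ₁ + θ₂)
  rw [gconv, gconv, ← h, integral_conv (by rwa [h])]
  simp [gconv, add_assoc]

/-- The Cameron–Martin formula for a real Gaussian law. -/
theorem integral_exp_mul_gaussianReal (F : ℝ → ℝ) (c : ℝ) (θ : ℝ≥0) :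
    ∫ w, Real.exp (c * w - c ^ 2 * θ / 2) * F w ∂gaussianReal 0 θ
      = ∫ w, F (w + c * θ) ∂gaussianReal 0 θ := by
  by_cases hθ : θ = 0
  · simp [hθ, gaussianReal_zero_var]
  have h1 : ∫ w, F (w + c * θ) ∂gaussianReal 0 θ = ∫ w, F w ∂gaussianReal (c * θ) θ := by
    rw [integral_gaussianReal_eq_add F]
    simp only [add_comm]
  rw [h1, integral_gaussianReal_eq_integral_smul hθ, integral_gaussianReal_eq_integral_smul hθ]
  congr 1
  ext w
  have hθ' : (θ : ℝ) ≠ 0 := by exact_mod_cast hθ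
  rw [smul_eq_mul, smul_eq_mul, ← mul_assoc]
  congr 1
  -- Completing the square: the tilt turns the centered density into the one with mean `c θ`.
  rw [gaussianPDFReal, gaussianPDFReal, mul_assoc, ← Real.exp_add]
  congr 2
  field_simp
  ring

theorem gconv_mono {F G : ℝ → ℝ} (hF : ExpBdd F) (hFm : Measurable F) (hG : ExpBdd G)
    (hGm : Measurable G) (h : ∀ z, F z ≤ G z) (θ : ℝ≥0) (z : ℝ) : gconv θ F z ≤ gconv θ G z :=
  integral_mono (hF.integrable_add hFm z 0 θ) (hG.integrable_add hGm z 0 θ) fun w => h (z + w)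

theorem gconv_pos {F : ℝ → ℝ} (hF : ExpBdd F) (hFm : Measurable F) (h : ∀ z, 0 < F z)
    (θ : ℝ≥0) (z : ℝ) : 0 < gconv θ F z :=
  (integral_pos_iff_support_of_nonneg (fun w => (h (z + w)).le)
    (hF.integrable_add hFm z 0 θ)).2 (by
      have : Function.support (fun w => F (z + w)) = univ := by
        ext w; simpa using (h (z + w)).ne'
      rw [this]; simp)

theorem gconv_const_mul (F : ℝ → ℝ) (K : ℝ) (θ : ℝ≥0) (z : ℝ) :
    gconv θ (fun z => K * F z) z = K * gconv θ F z := integral_const_mul _ _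

theorem gconv_neg (F : ℝ → ℝ) (θ : ℝ≥0) (z : ℝ) :
    gconv θ (fun z => -F z) z = -gconv θ F z := integral_neg _

end Merton

namespace Merton

/-! ### Profiles: positive decreasing functions and their risk tolerance -/

/-- A positive decreasing function `h` from `ℝ` onto `(0, ∞)` with `h' = -p`, `p' = q`, such that
`p = O(h)` and `q = O(p)`. -/
structure Profile (h p q : ℝ → ℝ) : Prop where
  hasDerivAt_h : ∀ z, HasDerivAt h (-p z) z
  hasDerivAt_p : ∀ z, HasDerivAt p (q z) z
  continuous_q : Continuous q
  h_pos : ∀ z, 0 < h z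
  p_pos : ∀ z, 0 < p z
  expBdd_h : ExpBdd h
  p_le : ∃ K : ℝ, 0 ≤ K ∧ ∀ z, p z ≤ K * h z
  q_le : ∃ K : ℝ, 0 ≤ K ∧ ∀ z, |q z| ≤ K * p z
  tendsto_top : Tendsto h atTop (𝓝 0)
  tendsto_bot : Tendsto h atBot atTop

namespace Profile

variable {h p q : ℝ → ℝ}

theorem continuous_h (H : Profile h p q) : Continuous h :=
  continuous_iff_continuousAt.2 fun z => (H.hasDerivAt_h z).continuousAt

theorem continuous_p (H : Profile h p q) : Continuous p :=
  continuous_iff_continuousAt.2 fun z => (H.hasDerivAt_p z).continuousAt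

theorem expBdd_p (H : Profile h p q) : ExpBdd p := by
  obtain ⟨K, hK, hp⟩ := H.p_le
  exact H.expBdd_h.mono hK fun z => by
    rw [abs_of_pos (H.p_pos z), abs_of_pos (H.h_pos z)]; exact hp z

theorem expBdd_q (H : Profile h p q) : ExpBdd q := by
  obtain ⟨K, hK, hp⟩ := H.q_le
  exact H.expBdd_p.mono hK fun z => by
    rw [abs_of_pos (H.p_pos z)]; exact hp z

theorem strictAnti (H : Profile h p q) : StrictAnti h :=
  strictAnti_of_hasDerivAt_neg (fun z => H.hasDerivAt_h z) fun z => by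
    simpa using H.p_pos z

theorem exists_eq (H : Profile h p q) {x : ℝ} (hx : 0 < x) : ∃ z, h z = x := by
  obtain ⟨a, ha⟩ := (H.tendsto_top.eventually (gt_mem_nhds hx)).exists
  obtain ⟨b, hb⟩ := (H.tendsto_bot.eventually (eventually_ge_atTop x)).exists
  obtain ⟨z, hz⟩ := mem_range_of_exists_le_of_exists_ge H.continuous_h ⟨a, ha.le⟩ ⟨b, hb⟩
  exact ⟨z, hz⟩

/-- The inverse of `h`. -/
noncomputable def inv (_ : Profile h p q) : ℝ → ℝ := Function.invFun h

theorem inv_h (H : Profile h p q) (z : ℝ) : H.inv (h z) = z :=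
  Function.leftInverse_invFun H.strictAnti.injective z

theorem h_inv (H : Profile h p q) {x : ℝ} (hx : 0 < x) : h (H.inv x) = x :=
  Function.invFun_eq (H.exists_eq hx)

theorem continuousAt_inv (H : Profile h p q) {x : ℝ} (hx : 0 < x) : ContinuousAt H.inv x := by
  -- The sign makes the inverse increasing. A monotone function whose image is all of `ℝ` has no
  -- jumps.
  have hm : StrictMonoOn (fun x => -H.inv x) (Ioi 0) := by
    intro a ha b hb hab
    refine neg_lt_neg (H.strictAnti.lt_iff_gt.1 ?_)
    rwa [H.h_inv ha, H.h_inv hb]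
  have him : (fun x => -H.inv x) '' Ioi 0 = univ := by
    refine eq_univ_of_forall fun z => ⟨h (-z), H.h_pos _, ?_⟩
    simp [H.inv_h]
  have h1 := (hm.continuousAt_of_image_mem_nhds (Ioi_mem_nhds hx) (by rw [him]; simp)).neg
  have h2 : (-fun x => -H.inv x) = H.inv := by ext; simp
  rwa [h2] at h1

theorem hasDerivAt_inv (H : Profile h p q) {x : ℝ} (hx : 0 < x) :
    HasDerivAt H.inv (-p (H.inv x))⁻¹ x :=
  HasDerivAt.of_local_left_inverse (H.continuousAt_inv hx) (H.hasDerivAt_h _)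
    (neg_ne_zero.2 (H.p_pos _).ne') (by
      filter_upwards [Ioi_mem_nhds hx] with y hy using H.h_inv hy)

protected theorem gconv (H : Profile h p q) (θ : ℝ≥0) :
    Profile (gconv θ h) (gconv θ p) (gconv θ q) where
  hasDerivAt_h z := by
    rw [← gconv_neg]
    exact hasDerivAt_gconv H.expBdd_h H.expBdd_p.neg H.hasDerivAt_h
      H.continuous_p.neg.measurable θ z
  hasDerivAt_p := hasDerivAt_gconv H.expBdd_p H.expBdd_q H.hasDerivAt_p
      H.continuous_q.measurable θ
  continuous_q := continuous_gconv H.expBdd_q H.continuous_q θ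
  h_pos := gconv_pos H.expBdd_h H.continuous_h.measurable H.h_pos θ
  p_pos := gconv_pos H.expBdd_p H.continuous_p.measurable H.p_pos θ
  expBdd_h := H.expBdd_h.gconv θ
  p_le := by
    obtain ⟨K, hK, hp⟩ := H.p_le
    refine ⟨K, hK, fun z => ?_⟩
    rw [← gconv_const_mul]
    exact gconv_mono H.expBdd_p H.continuous_p.measurable (H.expBdd_h.const_mul K)
      (H.continuous_h.measurable.const_mul K) hp θ z
  q_le := by
    obtain ⟨K, hK, hq⟩ := H.q_le
    refine ⟨K, hK, fun z => ?_⟩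
    rw [← gconv_const_mul, gconv, ← Real.norm_eq_abs]
    exact norm_integral_le_of_norm_le
      ((H.expBdd_p.const_mul K).integrable_add (H.continuous_p.measurable.const_mul K) z 0 θ)
      (ae_of_all _ fun w => hq _)
  tendsto_top := by
    have : Tendsto (fun z => ∫ w, h (z + w) ∂gaussianReal 0 θ) atTop
        (𝓝 (∫ _, (0 : ℝ) ∂gaussianReal 0 θ)) := by
      refine tendsto_integral_filter_of_dominated_convergence h ?_ ?_ ?_ ?_
      · exact Eventually.of_forall fun z =>
          (H.continuous_h.comp (continuous_const.add continuous_id)).aestronglyMeasurable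
      · filter_upwards [eventually_ge_atTop 0] with z hz
        refine ae_of_all _ fun w => ?_
        rw [Real.norm_of_nonneg (H.h_pos _).le]
        exact H.strictAnti.antitone (by linarith)
      · exact H.expBdd_h.integrable H.continuous_h.measurable 0 θ
      · exact ae_of_all _ fun w => H.tendsto_top.comp (tendsto_atTop_add_const_right _ _ tendsto_id)
    rw [integral_zero] at this
    exact this
  tendsto_bot := by
    -- By symmetry of the Gaussian law, twice the convolution is the mean of `h (z + w) + h (z -
    -- w)`. One of the two arguments is at most `z`, so this sum is at least `h z`.
    refine tendsto_atTop_mono (f := fun z => h z / 2) (fun z => ?_)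
      (H.tendsto_bot.atTop_div_const two_pos)
    have hi := H.expBdd_h.integrable_add H.continuous_h.measurable z 0 θ
    have hmap : (gaussianReal 0 θ).map (fun w => -w) = gaussianReal 0 θ := by
      simpa using gaussianReal_map_neg (μ := 0) (v := θ)
    have hi' : Integrable (fun w => h (z + -w)) (gaussianReal 0 θ) := by
      have h1 := hi
      rw [← hmap] at h1
      exact h1.comp_measurable measurable_neg
    have e : ∫ w, h (z + -w) ∂gaussianReal 0 θ = gconv θ h z := by
      conv_rhs => rw [gconv, ← hmap]
      rw [integral_map measurable_neg.aemeasurable]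
      exact (H.continuous_h.comp (continuous_const.add continuous_id)).aestronglyMeasurable
    have h2 : h z ≤ ∫ w, (h (z + w) + h (z + -w)) ∂gaussianReal 0 θ := by
      have : ∫ _, h z ∂gaussianReal 0 θ = h z := by simp
      rw [← this]
      refine integral_mono (integrable_const _) (hi.add hi') fun w => ?_
      rcases le_total w 0 with hw | hw
      · have := H.strictAnti.antitone (show z + w ≤ z by linarith)
        have := H.h_pos (z + -w)
        dsimp only; linarith
      · have := H.strictAnti.antitone (show z + -w ≤ z by linarith)
        have := H.h_pos (z + w)
        dsimp only; linarith
    rw [integral_add hi hi', e] at h2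
    change h z ≤ gconv θ h z + gconv θ h z at h2
    linarith

/-- The risk tolerance of a profile is differentiable, with derivative `-q / p` in the
parametrisation by `h`. -/
theorem hasDerivAt_risk (H : Profile h p q) {r : ℝ → ℝ} (hr : ∀ z, r (h z) = p z) {x : ℝ}
    (hx : 0 < x) : HasDerivAt r (-(q (H.inv x) / p (H.inv x))) x := by
  have h1 := (H.hasDerivAt_p (H.inv x)).comp x (H.hasDerivAt_inv hx)
  have h2 : q (H.inv x) * (-p (H.inv x))⁻¹ = -(q (H.inv x) / p (H.inv x)) := by
    rw [inv_neg, mul_neg, div_eq_mul_inv]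
  rw [h2] at h1
  refine h1.congr_of_eventuallyEq ?_
  filter_upwards [Ioi_mem_nhds hx] with y hy
  rw [Function.comp, ← hr, H.h_inv hy]

/-- The bound `p ≤ K h` says that `0 ≤ r x ≤ K x`. -/
theorem tendsto_risk (H : Profile h p q) {r : ℝ → ℝ} (hr : ∀ z, r (h z) = p z) :
    Tendsto r (𝓝[>] 0) (𝓝 0) := by
  obtain ⟨K, hK, hp⟩ := H.p_le
  have h1 : Tendsto (fun x : ℝ => K * x) (𝓝[>] 0) (𝓝 0) := by
    have : Tendsto (fun x : ℝ => K * x) (𝓝 0) (𝓝 (K * 0)) :=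
      (continuous_const.mul continuous_id).tendsto 0
    rw [mul_zero] at this
    exact this.mono_left nhdsWithin_le_nhds
  refine tendsto_of_tendsto_of_tendsto_of_le_of_le' tendsto_const_nhds h1 ?_ ?_
  · filter_upwards [self_mem_nhdsWithin] with x hx
    rw [← H.h_inv hx, hr]; exact (H.p_pos _).le
  · filter_upwards [self_mem_nhdsWithin] with x hx
    rw [← H.h_inv hx, hr]; exact hp _

theorem continuousOn_risk (H : Profile h p q) {r : ℝ → ℝ} (hr : ∀ z, r (h z) = p z)
    (hr0 : r 0 = 0) : ContinuousOn r (Ici 0) := by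
  intro x hx
  rcases (mem_Ici.1 hx).eq_or_lt with rfl | hx
  · rw [← continuousWithinAt_Ioi_iff_Ici, ContinuousWithinAt, hr0]
    exact H.tendsto_risk hr
  · exact (H.hasDerivAt_risk hr hx).continuousAt.continuousWithinAt

/-- The slope of `r` at `h z` is `-q z / p z`, and `h` reverses the order: concavity of the risk
tolerance is log-concavity of `p`. -/
theorem antitoneOn_ratio_of_concaveOn (H : Profile h p q) {r : ℝ → ℝ} (hr : ∀ z, r (h z) = p z)
    (hc : ConcaveOn ℝ (Ici 0) r) : Antitone (fun z => q z / p z) := by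
  have h1 : AntitoneOn (deriv r) (Ioi 0) := by
    have h2 : ConvexOn ℝ (Ioi 0) (-r) := (hc.subset Ioi_subset_Ici_self (convex_Ioi 0)).neg
    have h3 := h2.monotoneOn_derivWithin
      (fun x hx => (H.hasDerivAt_risk hr hx).neg.differentiableAt.differentiableWithinAt)
    intro a ha b hb hab
    have := h3 ha hb hab
    rw [derivWithin_of_isOpen isOpen_Ioi ha, derivWithin_of_isOpen isOpen_Ioi hb,
      (H.hasDerivAt_risk hr ha).neg.deriv, (H.hasDerivAt_risk hr hb).neg.deriv] at this
    rw [(H.hasDerivAt_risk hr ha).deriv, (H.hasDerivAt_risk hr hb).deriv]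
    linarith
  intro a b hab
  have := h1 (H.h_pos b) (H.h_pos a) (H.strictAnti.antitone hab)
  rw [(H.hasDerivAt_risk hr (H.h_pos a)).deriv, (H.hasDerivAt_risk hr (H.h_pos b)).deriv,
    H.inv_h, H.inv_h] at this
  simpa using this

theorem concaveOn_of_antitone_ratio (H : Profile h p q) {r : ℝ → ℝ} (hr : ∀ z, r (h z) = p z)
    (hr0 : r 0 = 0) (hc : Antitone (fun z => q z / p z)) : ConcaveOn ℝ (Ici 0) r := by
  refine AntitoneOn.concaveOn_of_deriv (convex_Ici 0) (H.continuousOn_risk hr hr0) ?_ ?_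
  · rw [interior_Ici]
    exact fun x hx => (H.hasDerivAt_risk hr hx).differentiableAt.differentiableWithinAt
  · rw [interior_Ici]
    intro a ha b hb hab
    rw [(H.hasDerivAt_risk hr ha).deriv, (H.hasDerivAt_risk hr hb).deriv]
    refine neg_le_neg (hc (H.strictAnti.le_iff_ge.1 ?_))
    rwa [H.h_inv ha, H.h_inv hb]

theorem monotone_ratio_of_convexOn (H : Profile h p q) {r : ℝ → ℝ} (hr : ∀ z, r (h z) = p z)
    (hc : ConvexOn ℝ (Ici 0) r) : Monotone (fun z => q z / p z) := by
  have h1 : MonotoneOn (deriv r) (Ioi 0) := by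
    have h2 : ConvexOn ℝ (Ioi 0) r := hc.subset Ioi_subset_Ici_self (convex_Ioi 0)
    have h3 := h2.monotoneOn_derivWithin
      (fun x hx => (H.hasDerivAt_risk hr hx).differentiableAt.differentiableWithinAt)
    intro a ha b hb hab
    have := h3 ha hb hab
    rwa [derivWithin_of_isOpen isOpen_Ioi ha, derivWithin_of_isOpen isOpen_Ioi hb] at this
  intro a b hab
  have := h1 (H.h_pos b) (H.h_pos a) (H.strictAnti.antitone hab)
  rw [(H.hasDerivAt_risk hr (H.h_pos a)).deriv, (H.hasDerivAt_risk hr (H.h_pos b)).deriv,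
    H.inv_h, H.inv_h] at this
  simpa using this

theorem convexOn_of_monotone_ratio (H : Profile h p q) {r : ℝ → ℝ} (hr : ∀ z, r (h z) = p z)
    (hr0 : r 0 = 0) (hc : Monotone (fun z => q z / p z)) : ConvexOn ℝ (Ici 0) r := by
  refine MonotoneOn.convexOn_of_deriv (convex_Ici 0) (H.continuousOn_risk hr hr0) ?_ ?_
  · rw [interior_Ici]
    exact fun x hx => (H.hasDerivAt_risk hr hx).differentiableAt.differentiableWithinAt
  · rw [interior_Ici]
    intro a ha b hb hab
    rw [(H.hasDerivAt_risk hr ha).deriv, (H.hasDerivAt_risk hr hb).deriv]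
    refine neg_le_neg (hc (H.strictAnti.le_iff_ge.1 ?_))
    rwa [H.h_inv ha, H.h_inv hb]

end Profile

/-! ### Total positivity and Gaussian convolution -/

theorem hasDerivAt_log_ratio {p q : ℝ → ℝ} (hp : ∀ z, 0 < p z) (hd : ∀ z, HasDerivAt p (q z) z)
    (a d : ℝ) : HasDerivAt (fun d => Real.log (p (a + d))) (q (a + d) / p (a + d)) d :=
  ((hd (a + d)).comp_const_add a d).log (hp _).ne'

/-- Since `q / p` is the logarithmic derivative of `p`, the function `log p (a + d) - log p (b + d)`
increases in `d`. This derivative-free, bilinear form of log-concavity is the one that can be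
integrated against Gaussian laws. -/
theorem ratio_cross_nonneg {p q : ℝ → ℝ} (hp : ∀ z, 0 < p z) (hd : ∀ z, HasDerivAt p (q z) z)
    (hq : Antitone (fun z => q z / p z)) {a b d : ℝ} (hab : a ≤ b) (hd0 : 0 ≤ d) :
    0 ≤ p (a + d) * p b - p a * p (b + d) := by
  have hm : Monotone (fun d => Real.log (p (a + d)) - Real.log (p (b + d))) :=
    monotone_of_hasDerivAt_nonneg
      (fun d => (hasDerivAt_log_ratio hp hd a d).sub (hasDerivAt_log_ratio hp hd b d))
      (fun d => sub_nonneg.2 (hq (by linarith)))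
  have h1 := hm hd0
  simp only [add_zero] at h1
  have h2 : Real.log (p a * p (b + d)) ≤ Real.log (p (a + d) * p b) := by
    rw [Real.log_mul (hp _).ne' (hp _).ne', Real.log_mul (hp _).ne' (hp _).ne']
    linarith
  have := (Real.log_le_log_iff (mul_pos (hp _) (hp _)) (mul_pos (hp _) (hp _))).1 h2
  linarith

theorem ratio_cross_nonpos {p q : ℝ → ℝ} (hp : ∀ z, 0 < p z) (hd : ∀ z, HasDerivAt p (q z) z)
    (hq : Monotone (fun z => q z / p z)) {a b d : ℝ} (hab : a ≤ b) (hd0 : 0 ≤ d) :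
    p (a + d) * p b - p a * p (b + d) ≤ 0 := by
  have hm : Monotone (fun d => Real.log (p (b + d)) - Real.log (p (a + d))) :=
    monotone_of_hasDerivAt_nonneg
      (fun d => (hasDerivAt_log_ratio hp hd b d).sub (hasDerivAt_log_ratio hp hd a d))
      (fun d => sub_nonneg.2 (hq (by linarith)))
  have h1 := hm hd0
  simp only [add_zero] at h1
  have h2 : Real.log (p (a + d) * p b) ≤ Real.log (p a * p (b + d)) := by
    rw [Real.log_mul (hp _).ne' (hp _).ne', Real.log_mul (hp _).ne' (hp _).ne']
    linarith
  have := (Real.log_le_log_iff (mul_pos (hp _) (hp _)) (mul_pos (hp _) (hp _))).1 h2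
  linarith

/-- The way back from the bilinear form: the expression vanishes at `d = 0` and is nonnegative for
`d ≥ 0`, so its derivative at `0` is nonnegative. The factor `σ` is `1` in the concave and `-1` in
the convex case. -/
theorem derivative_cross_nonneg {p q : ℝ → ℝ} (hd : ∀ z, HasDerivAt p (q z) z) {σ a b : ℝ}
    (hc : ∀ d, 0 ≤ d → 0 ≤ σ * (p (a + d) * p b - p a * p (b + d))) :
    0 ≤ σ * (q a * p b - p a * q b) := by
  have h1 : HasDerivAt (fun d => σ * (p (a + d) * p b - p a * p (b + d)))
      (σ * (q a * p b - p a * q b)) 0 := by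
    have ha : HasDerivAt (fun d => p (a + d)) (q a) 0 := by
      simpa using (hd (a + 0)).comp_const_add a 0
    have hb : HasDerivAt (fun d => p (b + d)) (q b) 0 := by
      simpa using (hd (b + 0)).comp_const_add b 0
    exact ((ha.mul_const (p b)).sub (hb.const_mul (p a))).const_mul σ
  have h2 := (hasDerivAt_iff_tendsto_slope.1 h1).mono_left
    (nhdsWithin_mono (0 : ℝ) (fun x (hx : x ∈ Ioi (0 : ℝ)) => (mem_Ioi.1 hx).ne'))
  refine ge_of_tendsto h2 ?_
  filter_upwards [self_mem_nhdsWithin] with d hd'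
  have hd' : 0 < d := hd'
  rw [slope_def_field]
  refine div_nonneg ?_ (by linarith)
  have := hc d hd'.le
  simp only [add_zero]
  linarith

/-- A total positivity argument. Up to a positive factor depending on `z`, the convolution at `z`
integrates against the kernel `exp (z w / θ)`. The difference of products is then a double integral;
symmetrising it in the two variables leaves the product of the cross difference of `p` with a two by
two determinant of exponentials. Both factors change sign when the variables are exchanged, and for
ordered variables the determinant is nonnegative while the hypothesis gives the sign of the first
factor. -/
theorem gconv_cross {p : ℝ → ℝ} (hp : ExpBdd p) (hc : Continuous p) {σ d : ℝ}
    (hcr : ∀ a b, a ≤ b → 0 ≤ σ * (p (a + d) * p b - p a * p (b + d))) (θ : ℝ≥0) {z z' : ℝ}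
    (hz : z ≤ z') :
    0 ≤ σ * (gconv θ p (z + d) * gconv θ p z' - gconv θ p z * gconv θ p (z' + d)) := by
  by_cases hθ : θ = 0
  · simp only [hθ, gconv_zero]; exact hcr z z' hz
  have hθ' : (0 : ℝ) < θ := by exact_mod_cast pos_iff_ne_zero.2 hθ
  set ν := gaussianReal 0 θ
  -- Cameron–Martin with tilt `z / θ`, which translates by exactly `z`.
  have key : ∀ (F : ℝ → ℝ) (z : ℝ), gconv θ F z
      = Real.exp (-(z / θ) ^ 2 * θ / 2) * ∫ w, F w * Real.exp (z / θ * w) ∂ν := by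
    intro F z
    have := integral_exp_mul_gaussianReal F (z / θ) θ
    rw [div_mul_cancel₀ _ hθ'.ne'] at this
    simp only [gconv, add_comm z]
    rw [← this, ← integral_const_mul]
    refine integral_congr_ae (ae_of_all _ fun w => ?_)
    dsimp only
    rw [mul_comm (F w), ← mul_assoc, ← Real.exp_add]
    congr 2; ring
  have shift : ∀ z, gconv θ p (z + d) = gconv θ (fun w => p (w + d)) z := fun z => by
    simp only [gconv]; congr 1; ext w; congr 1; ring
  have hi : ∀ (F : ℝ → ℝ), ExpBdd F → Continuous F → ∀ c,
      Integrable (fun w => F w * Real.exp (c * w)) ν := fun F hF hFc c =>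
    (hF.mul (expBdd_exp c)).integrable (by fun_prop) 0 θ
  have hpd : ExpBdd (fun w => p (w + d)) := hp.comp_add d
  have hcd : Continuous (fun w => p (w + d)) := by fun_prop
  rw [shift, shift, key, key p, key p, key (fun w => p (w + d)) z']
  set e := fun w => Real.exp (z / θ * w) with he
  set e' := fun w => Real.exp (z' / θ * w) with he'
  set f : ℝ × ℝ → ℝ := fun y => (p (y.1 + d) * e y.1) * (p y.2 * e' y.2)
    - (p y.1 * e y.1) * (p (y.2 + d) * e' y.2) with hf
  have i1 := (hi _ hpd hcd (z / θ)).mul_prod (hi _ hp hc (z' / θ))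
  have i2 := (hi _ hp hc (z / θ)).mul_prod (hi _ hpd hcd (z' / θ))
  have hfi : Integrable f (ν.prod ν) := i1.sub i2
  have e1 : ∫ y, f y ∂ν.prod ν = (∫ w, p (w + d) * e w ∂ν) * (∫ w, p w * e' w ∂ν)
      - (∫ w, p w * e w ∂ν) * (∫ w, p (w + d) * e' w ∂ν) := by
    rw [← integral_prod_mul, ← integral_prod_mul]
    exact integral_sub i1 i2
  have e2 : 0 ≤ σ * (2 * ∫ y, f y ∂ν.prod ν) := by
    -- The product measure is invariant under the swap, so `f` may be replaced by its
    -- symmetrisation, which has a pointwise sign.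
    have : 2 * ∫ y, f y ∂ν.prod ν = ∫ y, (f y + f y.swap) ∂ν.prod ν := by
      rw [integral_add hfi (by exact hfi.swap), integral_prod_swap f, two_mul]
    rw [this, ← integral_const_mul]
    refine integral_nonneg fun y => ?_
    have h3 : f y + f y.swap = (p (y.1 + d) * p y.2 - p y.1 * p (y.2 + d))
        * (e y.1 * e' y.2 - e y.2 * e' y.1) := by
      simp only [hf, Prod.fst_swap, Prod.snd_swap]; ring
    have h4 : ∀ a b, a ≤ b → e b * e' a ≤ e a * e' b := by
      intro a b hab
      simp only [he, he', ← Real.exp_add]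
      refine Real.exp_le_exp.2 ?_
      have : 0 ≤ (z' / θ - z / θ) * (b - a) :=
        mul_nonneg (sub_nonneg.2 ((div_le_div_iff_of_pos_right hθ').2 hz)) (by linarith)
      nlinarith
    dsimp only [Pi.zero_apply]
    rw [h3, ← mul_assoc]
    rcases le_total y.1 y.2 with hy | hy
    · exact mul_nonneg (hcr _ _ hy) (sub_nonneg.2 (h4 _ _ hy))
    · have h5 := hcr _ _ hy
      have h6 := h4 _ _ hy
      refine mul_nonneg_of_nonpos_of_nonpos ?_ (by linarith)
      linarith
  rw [e1] at e2
  have h7 : 0 ≤ Real.exp (-(z / θ) ^ 2 * θ / 2) * Real.exp (-(z' / θ) ^ 2 * θ / 2) := by positivity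
  have h8 : 0 ≤ σ * ((∫ w, p (w + d) * e w ∂ν) * (∫ w, p w * e' w ∂ν)
      - (∫ w, p w * e w ∂ν) * (∫ w, p (w + d) * e' w ∂ν)) := by linarith
  refine (mul_nonneg h7 h8).trans_eq ?_
  ring

namespace Profile

variable {h p q : ℝ → ℝ}

theorem antitone_ratio_gconv (H : Profile h p q) (hq : Antitone (fun z => q z / p z)) (θ : ℝ≥0) :
    Antitone (fun z => gconv θ q z / gconv θ p z) := by
  intro a b hab
  have h1 := derivative_cross_nonneg (H.gconv θ).hasDerivAt_p (σ := 1) (a := a) (b := b)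
    fun d hd => gconv_cross H.expBdd_p H.continuous_p (fun x y hxy => by
      rw [one_mul]; exact ratio_cross_nonneg H.p_pos H.hasDerivAt_p hq hxy hd) θ hab
  dsimp only
  rw [div_le_div_iff₀ ((H.gconv θ).p_pos b) ((H.gconv θ).p_pos a)]
  linarith

theorem monotone_ratio_gconv (H : Profile h p q) (hq : Monotone (fun z => q z / p z)) (θ : ℝ≥0) :
    Monotone (fun z => gconv θ q z / gconv θ p z) := by
  intro a b hab
  have h1 := derivative_cross_nonneg (H.gconv θ).hasDerivAt_p (σ := -1) (a := a) (b := b)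
    fun d hd => gconv_cross H.expBdd_p H.continuous_p (fun x y hxy => by
      have := ratio_cross_nonpos H.p_pos H.hasDerivAt_p hq hxy hd
      linarith) θ hab
  dsimp only
  rw [div_le_div_iff₀ ((H.gconv θ).p_pos a) ((H.gconv θ).p_pos b)]
  linarith

theorem concaveOn_risk_gconv (H : Profile h p q) {r r' : ℝ → ℝ} (hr : ∀ z, r (h z) = p z)
    (hc : ConcaveOn ℝ (Ici 0) r) {θ : ℝ≥0} (hr' : ∀ z, r' (gconv θ h z) = gconv θ p z)
    (hr'0 : r' 0 = 0) : ConcaveOn ℝ (Ici 0) r' :=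
  (H.gconv θ).concaveOn_of_antitone_ratio hr' hr'0
    (H.antitone_ratio_gconv (H.antitoneOn_ratio_of_concaveOn hr hc) θ)

theorem convexOn_risk_gconv (H : Profile h p q) {r r' : ℝ → ℝ} (hr : ∀ z, r (h z) = p z)
    (hc : ConvexOn ℝ (Ici 0) r) {θ : ℝ≥0} (hr' : ∀ z, r' (gconv θ h z) = gconv θ p z)
    (hr'0 : r' 0 = 0) : ConvexOn ℝ (Ici 0) r' :=
  (H.gconv θ).convexOn_of_monotone_ratio hr' hr'0
    (H.monotone_ratio_gconv (H.monotone_ratio_of_convexOn hr hc) θ)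

/-- Jensen's inequality for `r` and the random wealth `h (z + w)` with `w` Gaussian: its mean is
`x`, and the mean of `r (h (z + w)) = p (z + w)` is `r' x`. -/
theorem risk_gconv_le (H : Profile h p q) {r r' : ℝ → ℝ} (hr : ∀ z, r (h z) = p z)
    (hr0 : r 0 = 0) (hc : ConcaveOn ℝ (Ici 0) r) {θ : ℝ≥0}
    (hr' : ∀ z, r' (gconv θ h z) = gconv θ p z) {x : ℝ} (hx : 0 < x) : r' x ≤ r x := by
  obtain ⟨z, rfl⟩ := (H.gconv θ).exists_eq hx
  rw [hr']
  have hp : (fun w => r (h (z + w))) = fun w => p (z + w) := funext fun w => hr _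
  have := hc.le_map_integral (μ := gaussianReal 0 θ) (f := fun w => h (z + w))
    (H.continuousOn_risk hr hr0) isClosed_Ici (ae_of_all _ fun w => (H.h_pos _).le)
    (H.expBdd_h.integrable_add H.continuous_h.measurable z 0 θ) (by
      change Integrable (fun w => r (h (z + w))) _
      rw [hp]
      exact H.expBdd_p.integrable_add H.continuous_p.measurable z 0 θ)
  rwa [hp] at this

theorem le_risk_gconv (H : Profile h p q) {r r' : ℝ → ℝ} (hr : ∀ z, r (h z) = p z)
    (hr0 : r 0 = 0) (hc : ConvexOn ℝ (Ici 0) r) {θ : ℝ≥0}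
    (hr' : ∀ z, r' (gconv θ h z) = gconv θ p z) {x : ℝ} (hx : 0 < x) : r x ≤ r' x := by
  obtain ⟨z, rfl⟩ := (H.gconv θ).exists_eq hx
  rw [hr']
  have hp : (fun w => r (h (z + w))) = fun w => p (z + w) := funext fun w => hr _
  have := hc.map_integral_le (μ := gaussianReal 0 θ) (f := fun w => h (z + w))
    (H.continuousOn_risk hr hr0) isClosed_Ici (ae_of_all _ fun w => (H.h_pos _).le)
    (H.expBdd_h.integrable_add H.continuous_h.measurable z 0 θ) (by
      change Integrable (fun w => r (h (z + w))) _
      rw [hp]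
      exact H.expBdd_p.integrable_add H.continuous_p.measurable z 0 θ)
  rwa [hp] at this

/-- If the risk tolerances `r θ` of the Gaussian convolutions of a profile start from a concave
function, they decrease in `θ`. -/
theorem antitone_risk (H : Profile h p q) {r : ℝ≥0 → ℝ → ℝ}
    (hr : ∀ θ z, r θ (gconv θ h z) = gconv θ p z) (hr0 : ∀ θ, r θ 0 = 0)
    {R : ℝ → ℝ} (hR : ∀ z, R (h z) = p z) (hc : ConcaveOn ℝ (Ici 0) R) {x : ℝ} (hx : 0 ≤ x) :
    Antitone (fun θ => r θ x) := by
  intro θ₁ θ₂ hle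
  rcases hx.eq_or_lt with rfl | hx
  · simp [hr0]
  -- Jensen is applied to the profile already smoothed by `θ₁`, with extra variance `θ₂ - θ₁`. This
  -- needs concavity of `r θ₁`, not only of `R`.
  refine (H.gconv θ₁).risk_gconv_le (hr θ₁) (hr0 θ₁)
    (H.concaveOn_risk_gconv hR hc (hr θ₁) (hr0 θ₁)) (θ := θ₂ - θ₁) (fun z => ?_) hx
  rw [gconv_gconv H.expBdd_h H.continuous_h.measurable,
    gconv_gconv H.expBdd_p H.continuous_p.measurable, tsub_add_cancel_of_le hle, hr]

theorem monotone_risk (H : Profile h p q) {r : ℝ≥0 → ℝ → ℝ}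
    (hr : ∀ θ z, r θ (gconv θ h z) = gconv θ p z) (hr0 : ∀ θ, r θ 0 = 0)
    {R : ℝ → ℝ} (hR : ∀ z, R (h z) = p z) (hc : ConvexOn ℝ (Ici 0) R) {x : ℝ} (hx : 0 ≤ x) :
    Monotone (fun θ => r θ x) := by
  intro θ₁ θ₂ hle
  rcases hx.eq_or_lt with rfl | hx
  · simp [hr0]
  refine (H.gconv θ₁).le_risk_gconv (hr θ₁) (hr0 θ₁)
    (H.convexOn_risk_gconv hR hc (hr θ₁) (hr0 θ₁)) (θ := θ₂ - θ₁) (fun z => ?_) hx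
  rw [gconv_gconv H.expBdd_h H.continuous_h.measurable,
    gconv_gconv H.expBdd_p H.continuous_p.measurable, tsub_add_cancel_of_le hle, hr]

end Profile

end Merton

namespace Merton

/-! ### The profile of a utility function -/

/-- The mean value inequality costs a factor `|z|`, which is absorbed by raising the exponential
rate by one. -/
theorem ExpBdd.of_hasDerivAt {F F' : ℝ → ℝ} (hd : ∀ z, HasDerivAt F (F' z) z) (hF' : ExpBdd F') :
    ExpBdd F := by
  obtain ⟨A, c, hA, hc, hb⟩ := hF'
  refine ⟨|F 0| + A, c + 1, by positivity, by positivity, fun z => ?_⟩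
  have h1 := (convex_closedBall (0 : ℝ) |z|).norm_image_sub_le_of_norm_hasDerivWithin_le
    (f := F) (f' := F') (C := A * Real.exp (c * |z|)) (fun x _ => (hd x).hasDerivWithinAt)
    (fun x hx => (hb x).trans (mul_le_mul_of_nonneg_left (Real.exp_le_exp.2
      (mul_le_mul_of_nonneg_left (by simpa using hx) hc)) hA))
    (x := 0) (y := z) (by simp) (by simp)
  simp only [Real.norm_eq_abs, sub_zero] at h1
  have h2 : |z| ≤ Real.exp |z| := by linarith [Real.add_one_le_exp |z|]
  have h3 : 1 ≤ Real.exp ((c + 1) * |z|) := Real.one_le_exp (by positivity)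
  have h4 : A * Real.exp (c * |z|) * |z| ≤ A * Real.exp ((c + 1) * |z|) := by
    rw [add_mul, one_mul, Real.exp_add, ← mul_assoc]
    exact mul_le_mul_of_nonneg_left h2 (by positivity)
  have h5 : |F z| ≤ |F z - F 0| + |F 0| := by simpa using abs_add_le (F z - F 0) (F 0)
  nlinarith [abs_nonneg (F 0)]

/-- The profile `h` of a utility function `U`, given by `U' (h z) = exp z`. -/
structure DualProfile (U h p q : ℝ → ℝ) : Prop extends Profile h p q where
  contDiff_h : ContDiff ℝ 3 h
  hasDerivAt_U : ∀ z, HasDerivAt U (Real.exp z) (h z)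
  risk : ∀ z, riskToleranceCoeff U (h z) = p z
  le_tangent : ∀ z x, 0 < x → U x ≤ U (h z) + Real.exp z * (x - h z)
  strictMono : StrictMonoOn U (Ioi 0)

namespace DualProfile

variable {U h p q : ℝ → ℝ}

theorem hasDerivAt_U_h (D : DualProfile U h p q) (z : ℝ) :
    HasDerivAt (fun z => U (h z)) (Real.exp z * -p z) z :=
  (D.hasDerivAt_U z).comp z (D.hasDerivAt_h z)

theorem expBdd_deriv_U_h (D : DualProfile U h p q) : ExpBdd (fun z => Real.exp z * -p z) := by
  have h1 := expBdd_exp 1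
  simp only [one_mul] at h1
  exact h1.mul D.expBdd_p.neg

theorem expBdd_U_h (D : DualProfile U h p q) : ExpBdd (fun z => U (h z)) :=
  ExpBdd.of_hasDerivAt D.hasDerivAt_U_h D.expBdd_deriv_U_h

theorem continuous_U_h (D : DualProfile U h p q) : Continuous (fun z => U (h z)) :=
  continuous_iff_continuousAt.2 fun z => (D.hasDerivAt_U_h z).continuousAt

end DualProfile

section Utility

variable {U : ℝ → ℝ}

theorem IsUtility.contDiffOn_deriv (hU : IsUtility U) :
    ContDiffOn ℝ ((⊤ : ℕ∞) : WithTop ℕ∞) (deriv U) (Ioi 0) :=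
  ((contDiffOn_infty_iff_deriv_of_isOpen isOpen_Ioi).1 hU.smooth).2

theorem IsUtility.differentiableAt (hU : IsUtility U) {x : ℝ} (hx : 0 < x) :
    DifferentiableAt ℝ U x :=
  (((contDiffOn_infty_iff_deriv_of_isOpen isOpen_Ioi).1 hU.smooth).1 x hx).differentiableAt
    (Ioi_mem_nhds hx)

theorem IsUtility.differentiableAt_deriv (hU : IsUtility U) {x : ℝ} (hx : 0 < x) :
    DifferentiableAt ℝ (deriv U) x :=
  (((contDiffOn_infty_iff_deriv_of_isOpen isOpen_Ioi).1 hU.contDiffOn_deriv).1 x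
    hx).differentiableAt (Ioi_mem_nhds hx)

theorem IsUtility.strictAntiOn_deriv (hU : IsUtility U) : StrictAntiOn (deriv U) (Ioi 0) :=
  hU.strictConcave.strictAntiOn_deriv fun _ hx => hU.differentiableAt hx

theorem IsUtility.deriv_pos (hU : IsUtility U) {x : ℝ} (hx : 0 < x) : 0 < deriv U x := by
  have h2 : 0 ≤ deriv U (x + 1) := by
    have := (hU.strictMono.monotoneOn).derivWithin_nonneg (x := x + 1)
    rwa [derivWithin_of_isOpen isOpen_Ioi (mem_Ioi.2 (by linarith))] at this
  exact h2.trans_lt (hU.strictAntiOn_deriv hx (mem_Ioi.2 (by linarith)) (by linarith))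

theorem IsUtility.exists_deriv_eq (hU : IsUtility U) {y : ℝ} (hy : 0 < y) :
    ∃ x ∈ Ioi (0 : ℝ), deriv U x = y := by
  obtain ⟨a, ha, ha0⟩ := ((hU.inada_zero.eventually (eventually_ge_atTop y)).and
    self_mem_nhdsWithin).exists
  obtain ⟨b, hb, hb0⟩ := ((hU.inada_top.eventually (gt_mem_nhds hy)).and
    (eventually_gt_atTop a)).exists
  have ha0 : 0 < a := ha0
  have hc : ContinuousOn (deriv U) (Icc a b) := fun x hx =>
    (hU.differentiableAt_deriv (ha0.trans_le hx.1)).continuousAt.continuousWithinAt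
  obtain ⟨x, hx, hxy⟩ := intermediate_value_Icc' hb0.le hc ⟨hb.le, ha⟩
  exact ⟨x, ha0.trans_le hx.1, hxy⟩

theorem IsUtility.inverseMarginal_pos (hU : IsUtility U) {y : ℝ} (hy : 0 < y) :
    0 < inverseMarginal U y := Function.invFunOn_mem (hU.exists_deriv_eq hy)

theorem IsUtility.deriv_inverseMarginal (hU : IsUtility U) {y : ℝ} (hy : 0 < y) :
    deriv U (inverseMarginal U y) = y := Function.invFunOn_eq (hU.exists_deriv_eq hy)

theorem IsUtility.inverseMarginal_lt_iff (hU : IsUtility U) {x y : ℝ} (hx : 0 < x) (hy : 0 < y) :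
    inverseMarginal U y < x ↔ deriv U x < y := by
  conv_rhs => rw [← hU.deriv_inverseMarginal hy]
  exact (hU.strictAntiOn_deriv.lt_iff_gt hx (hU.inverseMarginal_pos hy)).symm

/-- The derivative of a function is `0` by convention where it does not exist, so the bound `c₁ I ≤
|y I'|` with `I > 0` also forces differentiability. Differentiating `U' (I y) = y` then gives `U''
(I y) * I' y = 1`, which excludes the zeros of `U''` that strict concavity alone would allow. -/
theorem IsUtility.hasDerivAt_inverseMarginal (hU : IsUtility U)
    (hI : InverseMarginalBounds (inverseMarginal U)) {y : ℝ} (hy : 0 < y) :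
    iteratedDeriv 2 U (inverseMarginal U y) < 0 ∧
      HasDerivAt (inverseMarginal U) (iteratedDeriv 2 U (inverseMarginal U y))⁻¹ y := by
  obtain ⟨-, ⟨c, hc, C, -, hb⟩, -⟩ := hI
  have h1 : deriv (inverseMarginal U) y ≠ 0 := by
    intro h0
    have := (hb y hy).1
    rw [h0, mul_zero, abs_zero] at this
    exact absurd this (not_le.2 (mul_pos hc (hU.inverseMarginal_pos hy)))
  have h2 := (differentiableAt_of_deriv_ne_zero h1).hasDerivAt
  have hp := hU.inverseMarginal_pos hy
  have h3 : HasDerivAt (deriv U) (iteratedDeriv 2 U (inverseMarginal U y))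
      (inverseMarginal U y) := by
    rw [iteratedDeriv_succ, iteratedDeriv_one]
    exact (hU.differentiableAt_deriv hp).hasDerivAt
  have h4 : iteratedDeriv 2 U (inverseMarginal U y) * deriv (inverseMarginal U) y = 1 := by
    refine (h3.comp y h2).unique ((hasDerivAt_id y).congr_of_eventuallyEq ?_)
    filter_upwards [Ioi_mem_nhds hy] with w hw using hU.deriv_inverseMarginal hw
  have h5 : iteratedDeriv 2 U (inverseMarginal U y) ≠ 0 := left_ne_zero_of_mul_eq_one h4
  have h6 : iteratedDeriv 2 U (inverseMarginal U y) ≤ 0 := by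
    rw [← h3.deriv]
    have := (hU.strictAntiOn_deriv.antitoneOn).derivWithin_nonpos (x := inverseMarginal U y)
    rwa [derivWithin_of_isOpen isOpen_Ioi hp] at this
  refine ⟨lt_of_le_of_ne h6 h5, ?_⟩
  rwa [← eq_inv_of_mul_eq_one_right h4]

/-- Bootstrap with `I' = 1 / U'' (I)`: each degree of smoothness of `I` yields the next one. -/
theorem IsUtility.contDiffOn_inverseMarginal (hU : IsUtility U)
    (hI : InverseMarginalBounds (inverseMarginal U)) (n : ℕ) :
    ContDiffOn ℝ n (inverseMarginal U) (Ioi 0) := by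
  have hdiff : DifferentiableOn ℝ (inverseMarginal U) (Ioi 0) := fun y hy =>
    (hU.hasDerivAt_inverseMarginal hI hy).2.differentiableAt.differentiableWithinAt
  have h2 : ContDiffOn ℝ ((⊤ : ℕ∞) : WithTop ℕ∞) (iteratedDeriv 2 U) (Ioi 0) := by
    rw [iteratedDeriv_succ, iteratedDeriv_one]
    exact ((contDiffOn_infty_iff_deriv_of_isOpen isOpen_Ioi).1 hU.contDiffOn_deriv).2
  induction n with
  | zero => exact contDiffOn_zero.2 hdiff.continuousOn
  | succ n ih =>
    have : ((n + 1 : ℕ) : WithTop ℕ∞) = (n : WithTop ℕ∞) + 1 := by push_cast; rfl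
    rw [this, contDiffOn_succ_iff_deriv_of_isOpen isOpen_Ioi]
    refine ⟨hdiff, fun h => absurd h (by simp), ?_⟩
    have h3 : ContDiffOn ℝ n (fun y => (iteratedDeriv 2 U (inverseMarginal U y))⁻¹) (Ioi 0) := by
      refine ContDiffOn.inv ?_ fun y hy => (hU.hasDerivAt_inverseMarginal hI hy).1.ne
      exact (h2.of_le (by exact_mod_cast le_top)).comp ih fun y hy => hU.inverseMarginal_pos hy
    exact h3.congr fun y hy => (hU.hasDerivAt_inverseMarginal hI hy).2.deriv

theorem IsUtility.exists_dualProfile (hU : IsUtility U)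
    (hI : InverseMarginalBounds (inverseMarginal U)) : ∃ h p q, DualProfile U h p q := by
  set I := inverseMarginal U with hIdef
  have hd : ∀ y, 0 < y → HasDerivAt I (deriv I y) y := fun y hy =>
    (hU.hasDerivAt_inverseMarginal hI hy).2.differentiableAt.hasDerivAt
  have hneg : ∀ y, 0 < y → deriv I y < 0 := fun y hy => by
    rw [(hU.hasDerivAt_inverseMarginal hI hy).2.deriv]
    exact inv_lt_zero.2 (hU.hasDerivAt_inverseMarginal hI hy).1
  have hcd : ContDiffOn ℝ 2 (deriv I) (Ioi 0) := by
    have := hU.contDiffOn_inverseMarginal hI 3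
    have h3 : ((3 : ℕ) : WithTop ℕ∞) = 2 + 1 := by norm_num
    rw [h3, contDiffOn_succ_iff_deriv_of_isOpen isOpen_Ioi] at this
    exact this.2.2
  have hcd2 : ContDiffOn ℝ 1 (iteratedDeriv 2 I) (Ioi 0) := by
    have h3 : (2 : WithTop ℕ∞) = 1 + 1 := by norm_num
    rw [h3, contDiffOn_succ_iff_deriv_of_isOpen isOpen_Ioi] at hcd
    rw [iteratedDeriv_succ, iteratedDeriv_one]
    exact hcd.2.2
  have hd2 : ∀ y, 0 < y → HasDerivAt (deriv I) (iteratedDeriv 2 I y) y := fun y hy => by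
    rw [iteratedDeriv_succ, iteratedDeriv_one]
    exact ((hcd.differentiableOn (by norm_num) y hy).differentiableAt
      (Ioi_mem_nhds hy)).hasDerivAt
  have hmaps : MapsTo Real.exp univ (Ioi 0) := fun z _ => Real.exp_pos z
  have hh : ∀ z, HasDerivAt (fun z => I (Real.exp z)) (-(-(Real.exp z * deriv I (Real.exp z)))) z :=
    fun z => by
      rw [neg_neg, mul_comm]
      exact (hd _ (Real.exp_pos z)).comp z (Real.hasDerivAt_exp z)
  obtain ⟨⟨C, hC, δ, hδ, hb0⟩, ⟨c₁, hc₁, C₁, hC₁, hb1⟩, ⟨c₂, hc₂, C₂, hC₂, hb2⟩, -⟩ := id hI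
  have hpabs : ∀ z, |Real.exp z * deriv I (Real.exp z)| = -(Real.exp z * deriv I (Real.exp z)) :=
    fun z => abs_of_neg (mul_neg_of_pos_of_neg (Real.exp_pos z) (hneg _ (Real.exp_pos z)))
  refine ⟨fun z => I (Real.exp z), fun z => -(Real.exp z * deriv I (Real.exp z)),
    fun z => -(Real.exp z * deriv I (Real.exp z) +
      Real.exp z * (iteratedDeriv 2 I (Real.exp z) * Real.exp z)), ?_⟩
  refine { hasDerivAt_h := hh, hasDerivAt_p := ?_, continuous_q := ?_, h_pos := ?_, p_pos := ?_,
           expBdd_h := ?_, p_le := ?_, q_le := ?_, tendsto_top := ?_, tendsto_bot := ?_,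
           contDiff_h := ?_, hasDerivAt_U := ?_, risk := ?_, le_tangent := ?_,
           strictMono := hU.strictMono }
  · exact fun z => ((Real.hasDerivAt_exp z).mul
      ((hd2 _ (Real.exp_pos z)).comp z (Real.hasDerivAt_exp z))).neg
  · have h1 : Continuous (fun z => deriv I (Real.exp z)) :=
      (hcd.continuousOn.comp_continuous Real.continuous_exp Real.exp_pos)
    have h2 : Continuous (fun z => iteratedDeriv 2 I (Real.exp z)) :=
      (hcd2.continuousOn.comp_continuous Real.continuous_exp Real.exp_pos)
    fun_prop
  · exact fun z => hU.inverseMarginal_pos (Real.exp_pos z)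
  · exact fun z => neg_pos.2 (mul_neg_of_pos_of_neg (Real.exp_pos z) (hneg _ (Real.exp_pos z)))
  -- In the variable `y = exp z`, the power bound `C (1 + y ^ (-δ))` is exponential growth in `z`.
  · refine (((ExpBdd.of_bounded (F := fun _ => (1 : ℝ)) (K := 1) (by simp)).add
      (expBdd_exp (-δ))).const_mul C).mono zero_le_one fun z => ?_
    have h1 := hb0 (Real.exp z) (Real.exp_pos z)
    rw [← Real.exp_mul] at h1
    have h2 : z * -δ = -δ * z := by ring
    rw [h2] at h1
    rw [abs_of_pos (hU.inverseMarginal_pos (Real.exp_pos z)), one_mul]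
    exact h1.trans (le_abs_self _)
  · refine ⟨C₁, hC₁.le, fun z => ?_⟩
    have := (hb1 _ (Real.exp_pos z)).2
    rwa [hpabs] at this
  -- With `y = exp z` one has `q = -(y I' + y² I'')`. The first term is `p` itself and the second is
  -- at most `C₂ p` in absolute value.
  · refine ⟨1 + C₂, by positivity, fun z => ?_⟩
    have h1 := hb2 _ (Real.exp_pos z)
    have h2 : 0 ≤ Real.exp z * iteratedDeriv 2 I (Real.exp z) :=
      (mul_nonneg (by linarith) (abs_nonneg _)).trans h1.1
    rw [abs_of_neg (hneg _ (Real.exp_pos z))] at h1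
    rw [abs_neg]
    refine (abs_add_le _ _).trans ?_
    rw [hpabs, abs_of_nonneg (mul_nonneg (Real.exp_pos z).le (by linarith))]
    have h3 := mul_le_mul_of_nonneg_left h1.2 (Real.exp_pos z).le
    nlinarith
  · rw [Metric.tendsto_atTop]
    intro ε hε
    -- `h z < ε` means `U' ε < exp z`; the added `1` makes the inequality strict.
    refine ⟨Real.log (deriv U ε) + 1, fun z hz => ?_⟩
    rw [dist_zero_right, Real.norm_of_nonneg (hU.inverseMarginal_pos (Real.exp_pos z)).le,
      hU.inverseMarginal_lt_iff hε (Real.exp_pos z), ← Real.log_lt_iff_lt_exp (hU.deriv_pos hε)]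
    linarith
  · rw [tendsto_atTop]
    intro M
    have hM : 0 < max M 1 := by positivity
    filter_upwards [eventually_le_atBot (Real.log (deriv U (max M 1)))] with z hz
    refine (le_max_left M 1).trans (not_lt.1 fun hlt => ?_)
    rw [hU.inverseMarginal_lt_iff hM (Real.exp_pos z),
      ← Real.log_lt_iff_lt_exp (hU.deriv_pos hM)] at hlt
    linarith
  · rw [← contDiffOn_univ]
    exact (hU.contDiffOn_inverseMarginal hI 3).comp
      (Real.contDiff_exp.of_le le_top).contDiffOn hmaps
  · intro z
    have := (hU.differentiableAt (hU.inverseMarginal_pos (Real.exp_pos z))).hasDerivAt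
    rwa [hU.deriv_inverseMarginal (Real.exp_pos z)] at this
  · intro z
    have hz := Real.exp_pos z
    rw [riskToleranceCoeff, if_pos (hU.inverseMarginal_pos hz), hU.deriv_inverseMarginal hz,
      (hU.hasDerivAt_inverseMarginal hI hz).2.deriv, div_eq_mul_inv]
  · intro z x hx
    have hp := hU.inverseMarginal_pos (Real.exp_pos z)
    have hdz := (hU.differentiableAt hp).hasDerivAt
    rw [hU.deriv_inverseMarginal (Real.exp_pos z)] at hdz
    rcases lt_trichotomy x (I (Real.exp z)) with hlt | heq | hgt
    · have := hU.strictConcave.concaveOn.le_slope_of_hasDerivAt hx hp hlt hdz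
      rw [slope_def_field, le_div_iff₀ (by linarith)] at this
      linarith
    · rw [← heq]; simp
    · have := hU.strictConcave.concaveOn.slope_le_of_hasDerivAt hp hx hgt hdz
      rw [slope_def_field, div_le_iff₀ (by linarith)] at this
      linarith

end Utility

end Merton

namespace Merton

/-! ### The dual description of the value function -/

namespace DualProfile

variable {U h p q : ℝ → ℝ}

/-- Differentiation produces the convolution of `-exp z * p z` at `ζ - θ`. Cameron–Martin with tilt
`1` translates by `θ`, which cancels the shift and leaves the factor `exp (ζ - θ / 2)`. -/
theorem hasDerivAt_dualValue (D : DualProfile U h p q) (θ : ℝ≥0) (ζ : ℝ) :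
    HasDerivAt (fun ζ => gconv θ (fun z => U (h z)) (ζ - θ))
      (Real.exp (ζ - θ / 2) * -gconv θ p ζ) ζ := by
  have h1 := hasDerivAt_gconv D.expBdd_U_h D.expBdd_deriv_U_h D.hasDerivAt_U_h
    (Real.continuous_exp.mul D.continuous_p.neg).measurable θ (ζ - θ)
  have h2 := h1.comp_sub_const ζ (θ : ℝ)
  have h3 : gconv θ (fun z => Real.exp z * -p z) (ζ - θ)
      = Real.exp (ζ - θ / 2) * -gconv θ p ζ := by
    have := integral_exp_mul_gaussianReal
      (fun w => Real.exp (ζ - θ / 2) * -p (ζ - θ + w)) 1 θ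
    rw [integral_const_mul, integral_neg] at this
    have e : ∀ w : ℝ, ζ - θ + (w + 1 * θ) = ζ + w := fun w => by ring
    simp only [e] at this
    rw [gconv, gconv, ← this]
    refine integral_congr_ae (ae_of_all _ fun w => ?_)
    dsimp only
    rw [← mul_assoc, ← Real.exp_add]
    congr 2; ring
  rwa [h3] at h2

variable {u : ℝ → ℝ} {θ : ℝ≥0}

/-- Both coordinates of the curve `(gconv θ h ζ, u)` have a derivative proportional to `gconv θ p
ζ`; in the quotient it cancels and the marginal value `exp (ζ - θ / 2)` remains. -/
theorem hasDerivAt_value (D : DualProfile U h p q)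
    (hu : ∀ ζ, u (gconv θ h ζ) = gconv θ (fun z => U (h z)) (ζ - θ)) {x : ℝ} (hx : 0 < x) :
    HasDerivAt u (Real.exp ((D.toProfile.gconv θ).inv x - θ / 2)) x := by
  set H := D.toProfile.gconv θ
  have h1 := (D.hasDerivAt_dualValue θ (H.inv x)).comp x (H.hasDerivAt_inv hx)
  rw [mul_assoc, mul_inv_cancel₀ (neg_ne_zero.2 (H.p_pos _).ne'), mul_one] at h1
  refine h1.congr_of_eventuallyEq ?_
  filter_upwards [Ioi_mem_nhds hx] with y hy
  rw [Function.comp, ← hu, H.h_inv hy]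

theorem hasDerivAt_deriv_value (D : DualProfile U h p q)
    (hu : ∀ ζ, u (gconv θ h ζ) = gconv θ (fun z => U (h z)) (ζ - θ)) {x : ℝ} (hx : 0 < x) :
    HasDerivAt (deriv u) (Real.exp ((D.toProfile.gconv θ).inv x - θ / 2) *
      (-gconv θ p ((D.toProfile.gconv θ).inv x))⁻¹) x := by
  refine (((D.toProfile.gconv θ).hasDerivAt_inv hx).sub_const _).exp.congr_of_eventuallyEq ?_
  filter_upwards [Ioi_mem_nhds hx] with y hy using (D.hasDerivAt_value hu hy).deriv

theorem iteratedDeriv_two_value (D : DualProfile U h p q)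
    (hu : ∀ ζ, u (gconv θ h ζ) = gconv θ (fun z => U (h z)) (ζ - θ)) {x : ℝ} (hx : 0 < x) :
    iteratedDeriv 2 u x = Real.exp ((D.toProfile.gconv θ).inv x - θ / 2) *
      (-gconv θ p ((D.toProfile.gconv θ).inv x))⁻¹ := by
  rw [iteratedDeriv_succ, iteratedDeriv_one, (D.hasDerivAt_deriv_value hu hx).deriv]

theorem iteratedDeriv_two_value_neg (D : DualProfile U h p q)
    (hu : ∀ ζ, u (gconv θ h ζ) = gconv θ (fun z => U (h z)) (ζ - θ)) {x : ℝ} (hx : 0 < x) :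
    iteratedDeriv 2 u x < 0 := by
  rw [D.iteratedDeriv_two_value hu hx]
  exact mul_neg_of_pos_of_neg (Real.exp_pos _)
    (inv_lt_zero.2 (neg_neg_of_pos ((D.toProfile.gconv θ).p_pos _)))

theorem contDiffOn_value (D : DualProfile U h p q)
    (hu : ∀ ζ, u (gconv θ h ζ) = gconv θ (fun z => U (h z)) (ζ - θ)) :
    ContDiffOn ℝ 2 u (Ioi 0) := by
  have h2 : (2 : WithTop ℕ∞) = 1 + 1 := by norm_num
  have h1 : (1 : WithTop ℕ∞) = 0 + 1 := by norm_num
  rw [h2, contDiffOn_succ_iff_deriv_of_isOpen isOpen_Ioi]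
  refine ⟨fun x hx => (D.hasDerivAt_value hu hx).differentiableAt.differentiableWithinAt,
    fun h => absurd h (by simp), ?_⟩
  rw [h1, contDiffOn_succ_iff_deriv_of_isOpen isOpen_Ioi]
  refine ⟨fun x hx => (D.hasDerivAt_deriv_value hu hx).differentiableAt.differentiableWithinAt,
    fun h => absurd h (by simp), ?_⟩
  rw [contDiffOn_zero]
  set H := D.toProfile.gconv θ
  refine ContinuousOn.congr (f := fun x => Real.exp (H.inv x - θ / 2) * (-gconv θ p (H.inv x))⁻¹)
    (fun x hx => ContinuousAt.continuousWithinAt ?_)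
    fun x hx => (D.hasDerivAt_deriv_value hu hx).deriv
  have hi := H.continuousAt_inv hx
  refine ((hi.sub continuousAt_const).rexp).mul (ContinuousAt.inv₀ ?_ ?_)
  · exact (ContinuousAt.comp (f := H.inv) H.continuous_p.continuousAt hi).neg
  · exact neg_ne_zero.2 (H.p_pos _).ne'

/-- The marginal value is an exponential of the inverse of `gconv θ h`, so `-u' / u''` is minus the
reciprocal of the derivative of that inverse. -/
theorem riskToleranceCoeff_value (D : DualProfile U h p q)
    (hu : ∀ ζ, u (gconv θ h ζ) = gconv θ (fun z => U (h z)) (ζ - θ)) (ζ : ℝ) :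
    riskToleranceCoeff u (gconv θ h ζ) = gconv θ p ζ := by
  have hx := (D.toProfile.gconv θ).h_pos ζ
  have hp := (D.toProfile.gconv θ).p_pos ζ
  rw [riskToleranceCoeff, if_pos hx, D.iteratedDeriv_two_value hu hx,
    (D.hasDerivAt_value hu hx).deriv, (D.toProfile.gconv θ).inv_h]
  field_simp

end DualProfile

end Merton

namespace Merton

/-! ### Increments of a standard Brownian motion -/

theorem ExpBdd.integrable_comp {Ω : Type*} [MeasurableSpace Ω] {P : Measure Ω} {Y : Ω → ℝ}
    {μ : ℝ} {v : ℝ≥0} (hY : HasLaw Y (gaussianReal μ v) P) {F : ℝ → ℝ} (hF : ExpBdd F)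
    (hm : Measurable F) : Integrable (fun ω => F (Y ω)) P := by
  have h1 := hF.integrable hm μ v
  rw [← hY.map_eq] at h1
  exact h1.comp_aemeasurable hY.aemeasurable

theorem ExpBdd.memLp_comp {Ω : Type*} [MeasurableSpace Ω] {P : Measure Ω} {Y : Ω → ℝ}
    {μ : ℝ} {v : ℝ≥0} (hY : HasLaw Y (gaussianReal μ v) P) {F : ℝ → ℝ} (hF : ExpBdd F)
    (hm : Measurable F) : MemLp (fun ω => F (Y ω)) 2 P := by
  rw [memLp_two_iff_integrable_sq (f := fun ω => F (Y ω))
    (hm.comp_aemeasurable hY.aemeasurable).aestronglyMeasurable]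
  have h1 : ExpBdd (fun z => F z ^ 2) := by simpa only [sq] using hF.mul hF
  exact h1.integrable_comp hY (hm.pow_const 2)

theorem expBdd_id : ExpBdd (fun z => z) :=
  ⟨1, 1, zero_le_one, zero_le_one, fun z => by
    rw [one_mul, one_mul]; linarith [Real.add_one_le_exp |z|]⟩

theorem iIndepFun_bool {Ω β : Type*} [MeasurableSpace Ω] [MeasurableSpace β] {P : Measure Ω}
    [IsProbabilityMeasure P] {X : Bool → Ω → β} (h : IndepFun (X false) (X true) P) :
    iIndepFun X P := by
  rw [iIndepFun_iff_measure_inter_preimage_eq_mul]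
  intro S sets hS
  have h2 := fun hf ht => h.measure_inter_preimage_eq_mul (sets false) (sets true) hf ht
  have hS4 : ∀ S : Finset Bool, S = ∅ ∨ S = {false} ∨ S = {true} ∨ S = {false, true} := by decide
  rcases hS4 S with rfl | rfl | rfl | rfl
  · simp
  · simp
  · simp
  · rw [Finset.set_biInter_insert, Finset.set_biInter_singleton, Finset.prod_pair (by simp)]
    exact h2 (hS false (by simp)) (hS true (by simp))

theorem pastSigma_mono {N : ℕ} {Ω : Type*} {W : ℝ≥0 → Ω → Fin N → ℝ} {a b : ℝ≥0} (hab : a ≤ b) :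
    pastSigma W a ≤ pastSigma W b :=
  iSup₂_le fun r hr => le_iSup₂_of_le r (hr.trans hab) le_rfl

theorem measurable_pastSigma {N : ℕ} {Ω : Type*} {W : ℝ≥0 → Ω → Fin N → ℝ} {r a : ℝ≥0}
    (h : r ≤ a) : Measurable[pastSigma W a] (W r) :=
  Measurable.of_comap_le (le_iSup₂_of_le r h le_rfl)

theorem normSq_nonneg {N : ℕ} (c : Fin N → ℝ) : 0 ≤ normSq c := by
  rw [normSq, dotProduct]
  exact Finset.sum_nonneg fun _ _ => mul_self_nonneg _

section Increments

variable {N : ℕ} {Ω : Type*} [mΩ : MeasurableSpace Ω] {P : Measure Ω}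
  {W : ℝ≥0 → Ω → Fin N → ℝ}

theorem pastSigma_le (hW : IsStandardBrownian W P) (a : ℝ≥0) : pastSigma W a ≤ mΩ :=
  iSup₂_le fun r _ => (hW.measurable r).comap_le

variable [IsProbabilityMeasure P]

/-- In each coordinate the path stopped at `a` is independent of the path of increments after `a`.
With the independence of the coordinates, all these `2 N` path-valued variables are jointly
independent; the past is read off one half of them and the increment off the other. -/
theorem indepFun_past_incr (hW : IsStandardBrownian W P) {a b : ℝ≥0} (hab : a ≤ b) :
    Indep (pastSigma W a) (MeasurableSpace.comap (fun ω => W b ω - W a ω) inferInstance) P := by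
  -- The index `true` labels the path stopped at `a`, the index `false` the increments after `a`.
  set X : Fin N → Bool → Ω → ℝ≥0 → ℝ := fun j i ω r =>
    if i then W (min r a) ω j else W (a + r) ω j - W a ω j with hX
  have hmj : ∀ j r, Measurable (fun ω => W r ω j) := fun j r =>
    (measurable_pi_apply j).comp (hW.measurable r)
  have mX : ∀ j i, Measurable (X j i) := by
    intro j i
    refine measurable_pi_lambda _ fun r => ?_
    cases i
    · exact (hmj j (a + r)).sub (hmj j a)
    · exact hmj j (min r a)
  have h2 : ∀ j, iIndepFun (X j) P := by
    intro j
    refine iIndepFun_bool ?_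
    have h := (hW.isBrownian j).toIsPreBrownianReal.indepFun_shift a
    exact h.comp (φ := fun x => x) (ψ := fun x r => x ⟨min r a, min_le_right r a⟩) measurable_id
      (measurable_pi_lambda _ fun r => measurable_pi_apply _)
  have h1 : iIndepFun (fun j ω => (X j · ω)) P := by
    refine hW.indep.comp (fun _ x (i : Bool) r => if i then x (min r a) else x (a + r) - x a) fun j => ?_
    refine measurable_pi_lambda _ fun i => measurable_pi_lambda _ fun r => ?_
    cases i
    · exact (measurable_pi_apply (a + r)).sub (measurable_pi_apply a)
    · exact measurable_pi_apply (min r a)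
  have h3 := iIndepFun_uncurry' mX h1 h2
  have h4 := indep_iSup_of_disjoint (fun p : Fin N × Bool => (mX p.1 p.2).comap_le) h3.iIndep
    (S := {p : Fin N × Bool | p.2 = true}) (T := {p : Fin N × Bool | p.2 = false})
    (Set.disjoint_left.2 fun p (h : p.2 = true) (h' : p.2 = false) => by simp [h] at h')
  refine indep_of_indep_of_le_left (indep_of_indep_of_le_right h4 ?_) ?_
  · rw [← measurable_iff_comap_le]
    refine @measurable_pi_lambda _ _ _ (_) _ _ fun j => ?_
    have : (fun ω => (W b ω - W a ω) j) = fun ω => X j false ω (b - a) := by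
      ext ω; simp [hX, add_tsub_cancel_of_le hab]
    rw [this]
    have hle : MeasurableSpace.comap (X j false) inferInstance ≤
        ⨆ p ∈ {p : Fin N × Bool | p.2 = false}, MeasurableSpace.comap (X p.1 p.2) inferInstance :=
      le_iSup₂_of_le (f := fun (p : Fin N × Bool) (_ : p ∈ {p : Fin N × Bool | p.2 = false}) =>
        MeasurableSpace.comap (X p.1 p.2) inferInstance) (j, false) rfl le_rfl
    exact (measurable_pi_apply (b - a)).comp (Measurable.of_comap_le hle)
  · refine iSup₂_le fun r hr => ?_
    rw [← measurable_iff_comap_le]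
    refine @measurable_pi_lambda _ _ _ (_) _ _ fun j => ?_
    have : (fun ω => W r ω j) = fun ω => X j true ω r := by
      ext ω; simp [hX, min_eq_left hr]
    rw [this]
    have hle : MeasurableSpace.comap (X j true) inferInstance ≤
        ⨆ p ∈ {p : Fin N × Bool | p.2 = true}, MeasurableSpace.comap (X p.1 p.2) inferInstance :=
      le_iSup₂_of_le (f := fun (p : Fin N × Bool) (_ : p ∈ {p : Fin N × Bool | p.2 = true}) =>
        MeasurableSpace.comap (X p.1 p.2) inferInstance) (j, true) rfl le_rfl
    exact (measurable_pi_apply r).comp (Measurable.of_comap_le hle)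

theorem indepFun_incr (hW : IsStandardBrownian W P) {a b : ℝ≥0} (hab : a ≤ b) {f : Ω → ℝ}
    (hf : Measurable[pastSigma W a] f) {g : (Fin N → ℝ) → ℝ} (hg : Measurable g) :
    IndepFun f (fun ω => g (W b ω - W a ω)) P := by
  rw [IndepFun_iff_Indep]
  refine indep_of_indep_of_le_left (indep_of_indep_of_le_right (indepFun_past_incr hW hab) ?_) ?_
  · rw [← measurable_iff_comap_le]
    exact hg.comp (comap_measurable _)
  · exact hf.comap_le

theorem integrable_mul_incr (hW : IsStandardBrownian W P) {a b : ℝ≥0} (hab : a ≤ b) {f : Ω → ℝ}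
    (hf : Measurable[pastSigma W a] f) {g : (Fin N → ℝ) → ℝ} (hg : Measurable g)
    (hfi : Integrable f P) (hgi : Integrable (fun ω => g (W b ω - W a ω)) P) :
    Integrable (fun ω => f ω * g (W b ω - W a ω)) P :=
  (indepFun_incr hW hab hf hg).integrable_mul hfi hgi

theorem integral_mul_incr (hW : IsStandardBrownian W P) {a b : ℝ≥0} (hab : a ≤ b) {f : Ω → ℝ}
    (hf : Measurable[pastSigma W a] f) {g : (Fin N → ℝ) → ℝ} (hg : Measurable g) :
    ∫ ω, f ω * g (W b ω - W a ω) ∂P = (∫ ω, f ω ∂P) * ∫ ω, g (W b ω - W a ω) ∂P :=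
  (indepFun_incr hW hab hf hg).integral_fun_mul_eq_mul_integral
    (hf.mono (pastSigma_le hW a) le_rfl).aestronglyMeasurable
    (hg.comp ((hW.measurable b).sub (hW.measurable a))).aestronglyMeasurable

theorem hasLaw_incr_apply (hW : IsStandardBrownian W P) {a b : ℝ≥0} (hab : a ≤ b) (j : Fin N) :
    HasLaw (fun ω => (W b ω - W a ω) j) (gaussianReal 0 (b - a)) P := by
  have h := (hW.isBrownian j).toIsPreBrownianReal.hasLaw_sub b a
  have e : nndist (b : ℝ) (a : ℝ) = b - a := by
    ext
    rw [coe_nndist, Real.dist_eq, NNReal.coe_sub hab, abs_of_nonneg (by simpa using hab)]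
  rw [show nndist b.1 a.1 = b - a from e] at h
  exact h

theorem iIndepFun_incr (hW : IsStandardBrownian W P) (a b : ℝ≥0) :
    iIndepFun (fun j ω => (W b ω - W a ω) j) P :=
  hW.indep.comp (fun _ x => x b - x a) fun _ =>
    (measurable_pi_apply b).sub (measurable_pi_apply a)

theorem hasLaw_dotProduct_incr (hW : IsStandardBrownian W P) {a b : ℝ≥0} (hab : a ≤ b)
    (c : Fin N → ℝ) :
    HasLaw (fun ω => c ⬝ᵥ (W b ω - W a ω)) (gaussianReal 0 ((normSq c).toNNReal * (b - a))) P := by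
  have hlaw := fun j => gaussianReal_const_mul (hasLaw_incr_apply hW hab j) (c j)
  have hind : iIndepFun (fun j ω => c j * (W b ω - W a ω) j) P :=
    (iIndepFun_incr hW a b).comp (fun j x => c j * x) fun j => measurable_id.const_mul _
  refine ⟨?_, ?_⟩
  · have := Finset.aemeasurable_fun_sum Finset.univ fun j (_ : j ∈ Finset.univ) =>
      (hlaw j).aemeasurable
    exact this
  have : IsProbabilityMeasure (P.map fun ω => c ⬝ᵥ (W b ω - W a ω)) :=
    Measure.isProbabilityMeasure_map (Finset.aemeasurable_fun_sum Finset.univ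
      fun j (_ : j ∈ Finset.univ) => (hlaw j).aemeasurable)
  refine Measure.ext_of_charFun ?_
  have h1 := hind.charFun_map_fun_sum_eq_prod fun j => (hlaw j).aemeasurable
  change charFun (P.map fun ω => ∑ j, c j * (W b ω - W a ω) j) = _
  rw [h1]
  ext s
  simp only [Finset.prod_apply, (hlaw _).map_eq, charFun_gaussianReal, ← Complex.exp_sum]
  congr 1
  simp only [mul_zero, Complex.ofReal_zero, zero_mul, zero_sub]
  have h2 : ((((normSq c).toNNReal * (b - a) : ℝ≥0) : ℝ) : ℂ)
      = ∑ j, ((c j ^ 2 * (b - a) : ℝ) : ℂ) := by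
    rw [NNReal.coe_mul, Real.coe_toNNReal _ (normSq_nonneg c), NNReal.coe_sub hab, normSq,
      dotProduct, Finset.sum_mul]
    push_cast
    exact Finset.sum_congr rfl fun j _ => by ring
  rw [h2, Finset.sum_mul, Finset.sum_div, ← Finset.sum_neg_distrib]
  refine Finset.sum_congr rfl fun j _ => ?_
  rw [NNReal.coe_mul, NNReal.coe_sub hab]
  push_cast
  rfl

/-- The density `exp (-c ⬝ ΔW - |c|² Δt / 2)` of the change of measure over a time interval of
length `δ`, as a function of the increment. -/
noncomputable def girsanov (c : Fin N → ℝ) (δ : ℝ) (x : Fin N → ℝ) : ℝ :=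
  Real.exp (-(c ⬝ᵥ x) - normSq c * δ / 2)

theorem girsanov_add (c : Fin N → ℝ) (δ δ' : ℝ) (x y : Fin N → ℝ) :
    girsanov c (δ + δ') (x + y) = girsanov c δ x * girsanov c δ' y := by
  rw [girsanov, girsanov, girsanov, ← Real.exp_add, dotProduct_add]
  congr 1; ring

theorem measurable_dotProduct (c : Fin N → ℝ) : Measurable (fun x : Fin N → ℝ => c ⬝ᵥ x) :=
  Finset.measurable_fun_sum _ fun j _ => (measurable_pi_apply j).const_mul _

theorem measurable_girsanov (c : Fin N → ℝ) (δ : ℝ) : Measurable (girsanov c δ) :=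
  ((measurable_dotProduct c).neg.sub_const _).exp

theorem memLp_girsanov (hW : IsStandardBrownian W P) {a b : ℝ≥0} (hab : a ≤ b)
    (c : Fin N → ℝ) (δ : ℝ) : MemLp (fun ω => girsanov c δ (W b ω - W a ω)) 2 P := by
  have h1 : ExpBdd (fun z => Real.exp (-(normSq c * δ / 2)) * Real.exp (-1 * z)) :=
    (expBdd_exp (-1)).const_mul _
  refine (h1.memLp_comp (hasLaw_dotProduct_incr hW hab c) (by fun_prop)).ae_eq
    (ae_of_all _ fun ω => ?_)
  dsimp only
  rw [girsanov, ← Real.exp_add]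
  congr 1; ring

theorem memLp_incr_apply (hW : IsStandardBrownian W P) {a b : ℝ≥0} (hab : a ≤ b) (j : Fin N)
    (k : ℝ) : MemLp (fun ω => (W b ω - W a ω) j + k) 2 P :=
  (expBdd_id.memLp_comp (hasLaw_incr_apply hW hab j) measurable_id).add (memLp_const k)

/-- The density factorises over the coordinates. In coordinate `j`, Cameron–Martin with tilt `-c j`
removes the drift `(b - a) * c j` and leaves the mean of a centered Gaussian variable. -/
theorem integral_girsanov_mul_incr (hW : IsStandardBrownian W P) {a b : ℝ≥0} (hab : a ≤ b)
    (c : Fin N → ℝ) (j : Fin N) :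
    ∫ ω, girsanov c (b - a) (W b ω - W a ω) * ((W b ω - W a ω) j + (b - a) * c j) ∂P = 0 := by
  set g : Fin N → ℝ → ℝ := fun i x =>
    Real.exp (-c i * x - (-c i) ^ 2 * ((b - a : ℝ≥0) : ℝ) / 2) *
      if i = j then x + (b - a) * c j else 1 with hg
  have hgm : ∀ i, Measurable (g i) := fun i => by
    simp only [hg]
    split_ifs <;> fun_prop
  have h1 : ∀ ω, girsanov c (b - a) (W b ω - W a ω) * ((W b ω - W a ω) j + (b - a) * c j)
      = ∏ i, g i ((W b ω - W a ω) i) := by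
    intro ω
    simp only [hg]
    rw [Finset.prod_mul_distrib, Finset.prod_ite_eq' Finset.univ j, if_pos (Finset.mem_univ _),
      ← Real.exp_sum, girsanov]
    congr 2
    rw [Finset.sum_sub_distrib, dotProduct, normSq, dotProduct, Finset.sum_mul, Finset.sum_div,
      ← Finset.sum_neg_distrib]
    congr 1
    · exact Finset.sum_congr rfl fun i _ => by ring
    · exact Finset.sum_congr rfl fun i _ => by rw [NNReal.coe_sub hab]; ring
  simp only [h1]
  rw [(iIndepFun_incr hW a b).integral_fun_prod_comp
    (fun i => (hasLaw_incr_apply hW hab i).aemeasurable) fun i => (hgm i).aestronglyMeasurable]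
  refine Finset.prod_eq_zero (Finset.mem_univ j) ?_
  have h2 := (hasLaw_incr_apply hW hab j).integral_comp (f := g j) (hgm j).aestronglyMeasurable
  simp only [Function.comp_def] at h2
  rw [h2]
  simp only [hg, if_true]
  rw [integral_exp_mul_gaussianReal (fun x => x + (b - a) * c j)]
  have : ∀ w : ℝ, w + -c j * ((b - a : ℝ≥0) : ℝ) + (b - a) * c j = w := fun w => by
    rw [NNReal.coe_sub hab]; ring
  simp only [this, integral_id_gaussianReal]

/-- The elementary gains of a simple integrand have mean zero under the changed measure. -/
theorem integral_girsanov_mul_gain (hW : IsStandardBrownian W P) {t a b T : ℝ≥0} (hta : t ≤ a)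
    (hab : a ≤ b) (hbT : b ≤ T) (c : Fin N → ℝ) {ξ : Ω → Fin N → ℝ}
    (hξ : Measurable[pastSigma W a] ξ) (hξ2 : MemLp ξ 2 P) :
    Integrable (fun ω => girsanov c (T - t) (W T ω - W t ω) *
        (ξ ω ⬝ᵥ (W b ω - W a ω + ((b : ℝ) - a) • c))) P ∧
      ∫ ω, girsanov c (T - t) (W T ω - W t ω) *
        (ξ ω ⬝ᵥ (W b ω - W a ω + ((b : ℝ) - a) • c)) ∂P = 0 := by
  have hpast : ∀ {r s : ℝ≥0}, r ≤ s → Measurable[pastSigma W s] (W r) := measurable_pastSigma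
  -- The density over `[t, T]` splits at `a` and `b`. The first factor joins `ξ`, known at time `a`;
  -- the second joins the increment and gives mean zero; the third is independent of everything up
  -- to `b`.
  set f : Fin N → Ω → ℝ := fun j ω => girsanov c (a - t) (W a ω - W t ω) * ξ ω j
  set g : Fin N → (Fin N → ℝ) → ℝ := fun j x => girsanov c (b - a) x * (x j + (b - a) * c j)
  have hgm : ∀ j, Measurable (g j) := fun j =>
    (measurable_girsanov _ _).mul ((measurable_pi_apply j).add_const _)
  have hfm : ∀ j, Measurable[pastSigma W a] (f j) := fun j =>
    ((measurable_girsanov c _).comp ((hpast le_rfl).sub (hpast hta))).mul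
      ((measurable_pi_apply j).comp hξ)
  have hξj : ∀ j, MemLp (fun ω => ξ ω j) 2 P := fun j => hξ2.eval j
  have hfi : ∀ j, Integrable (f j) P := fun j => (memLp_girsanov hW hta c _).integrable_mul (hξj j)
  have hgi : ∀ j, Integrable (fun ω => g j (W b ω - W a ω)) P := fun j =>
    (memLp_girsanov hW hab c _).integrable_mul (memLp_incr_apply hW hab j _)
  have h1i := fun j => integrable_mul_incr hW hab (hfm j) (hgm j) (hfi j) (hgi j)
  have h1 := fun j => integral_mul_incr hW hab (hfm j) (hgm j)
  have h1m : ∀ j, Measurable[pastSigma W b] (fun ω => f j ω * g j (W b ω - W a ω)) := fun j =>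
    ((hfm j).mono (pastSigma_mono hab) le_rfl).mul
      ((hgm j).comp ((hpast le_rfl).sub (hpast hab)))
  have h2i := fun j => integrable_mul_incr hW hbT (h1m j) (measurable_girsanov c (T - b)) (h1i j)
    ((memLp_girsanov hW hbT c _).integrable (by norm_num))
  have h2 := fun j => integral_mul_incr hW hbT (h1m j) (measurable_girsanov c (T - b))
  have e : ∀ ω, girsanov c (T - t) (W T ω - W t ω) *
      (ξ ω ⬝ᵥ (W b ω - W a ω + ((b : ℝ) - a) • c))
      = ∑ j, f j ω * g j (W b ω - W a ω) * girsanov c (T - b) (W T ω - W b ω) := by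
    intro ω
    have e1 : (T : ℝ) - t = ((a - t) + (b - a)) + (T - b) := by ring
    have e2 : W T ω - W t ω = ((W a ω - W t ω) + (W b ω - W a ω)) + (W T ω - W b ω) := by abel
    rw [e1, e2, girsanov_add, girsanov_add, dotProduct, Finset.mul_sum]
    refine Finset.sum_congr rfl fun j _ => ?_
    simp only [f, g, Pi.add_apply, Pi.smul_apply, smul_eq_mul]
    ring
  simp only [e]
  refine ⟨integrable_finsetSum _ fun j _ => h2i j, ?_⟩
  rw [integral_finsetSum _ fun j _ => h2i j]
  refine Finset.sum_eq_zero fun j _ => ?_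
  rw [h2, h1, integral_girsanov_mul_incr hW hab c j, mul_zero, zero_mul]

end Increments

end Merton

namespace Merton

/-! ### Square integrable functions -/

theorem sq_integral_mul_le {α : Type*} [MeasurableSpace α] {μ : Measure α} {f g : α → ℝ}
    (hf : MemLp f 2 μ) (hg : MemLp g 2 μ) :
    (∫ x, f x * g x ∂μ) ^ 2 ≤ (∫ x, f x ^ 2 ∂μ) * ∫ x, g x ^ 2 ∂μ := by
  have hfg : Integrable (fun x => f x * g x) μ := hf.integrable_mul hg
  -- The integral of `(f + s g)²` is a nonnegative quadratic polynomial in `s`, so its discriminant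
  -- is not positive.
  have h1 : ∀ s : ℝ, 0 ≤ (∫ x, g x ^ 2 ∂μ) * (s * s) + (2 * ∫ x, f x * g x ∂μ) * s
      + ∫ x, f x ^ 2 ∂μ := by
    intro s
    have : ∫ x, (f x + s * g x) ^ 2 ∂μ = (∫ x, g x ^ 2 ∂μ) * (s * s)
        + (2 * ∫ x, f x * g x ∂μ) * s + ∫ x, f x ^ 2 ∂μ := by
      have e : ∀ x, (f x + s * g x) ^ 2 = (s * s * g x ^ 2 + 2 * s * (f x * g x)) + f x ^ 2 :=
        fun x => by ring
      simp only [e]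
      have h0 : Integrable (fun x => s * s * g x ^ 2 + 2 * s * (f x * g x)) μ :=
        (hg.integrable_sq.const_mul _).add (hfg.const_mul _)
      rw [integral_add h0 hf.integrable_sq, integral_add (hg.integrable_sq.const_mul _)
        (hfg.const_mul _), integral_const_mul, integral_const_mul]
      ring
    rw [← this]
    exact integral_nonneg fun x => sq_nonneg _
  have h2 := discrim_le_zero h1
  rw [discrim] at h2
  nlinarith

theorem sq_dotProduct_le {N : ℕ} (v c : Fin N → ℝ) : (v ⬝ᵥ c) ^ 2 ≤ normSq v * normSq c := by
  have := Finset.sum_mul_sq_le_sq_mul_sq Finset.univ v c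
  simpa only [normSq, dotProduct, sq] using this

theorem measurable_normSq {N : ℕ} : Measurable (normSq : (Fin N → ℝ) → ℝ) :=
  Finset.measurable_fun_sum Finset.univ fun j _ =>
    (measurable_pi_apply j).mul (measurable_pi_apply j)

theorem integrableOn_normSq_of_lintegral_ne_top {N : ℕ} {s : Set ℝ} {ψ : ℝ → Fin N → ℝ}
    (hψ : Measurable ψ) (hfin : ∫⁻ v in s, ENNReal.ofReal (normSq (ψ v)) ≠ ⊤) :
    IntegrableOn (fun v => normSq (ψ v)) s := by
  refine ⟨(measurable_normSq.comp hψ).aestronglyMeasurable, ?_⟩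
  rw [hasFiniteIntegral_iff_ofReal (ae_of_all _ fun v => normSq_nonneg _)]
  exact lt_of_le_of_ne le_top hfin

theorem memLp_dotProduct_of_integrableOn_normSq {N : ℕ} {s : Set ℝ} {ψ : ℝ → Fin N → ℝ}
    (hψ : Measurable ψ) (hi : IntegrableOn (fun v => normSq (ψ v)) s) (c : Fin N → ℝ) :
    MemLp (fun v => ψ v ⬝ᵥ c) 2 (volume.restrict s) := by
  have hd : Measurable (fun v => ψ v ⬝ᵥ c) := by
    simp only [dotProduct_comm _ c]
    exact (measurable_dotProduct c).comp hψ
  rw [memLp_two_iff_integrable_sq hd.aestronglyMeasurable]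
  refine (hi.mul_const (normSq c)).mono' (hd.pow_const 2).aestronglyMeasurable
    (ae_of_all _ fun v => ?_)
  rw [Real.norm_of_nonneg (sq_nonneg _)]
  exact sq_dotProduct_le _ _

theorem intervalIntegrable_dotProduct {N : ℕ} {t T : ℝ} (htT : t ≤ T) {ψ : ℝ → Fin N → ℝ}
    (hψ : Measurable ψ) (hfin : ∫⁻ v in Icc t T, ENNReal.ofReal (normSq (ψ v)) ≠ ⊤)
    (c : Fin N → ℝ) : IntervalIntegrable (fun v => ψ v ⬝ᵥ c) volume t T := by
  rw [intervalIntegrable_iff_integrableOn_Icc_of_le htT]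
  have : IsFiniteMeasure (volume.restrict (Icc t T)) := inferInstance
  exact (memLp_dotProduct_of_integrableOn_normSq hψ
    (integrableOn_normSq_of_lintegral_ne_top hψ hfin) c).integrable (by norm_num)

/-- The Cauchy–Schwarz bound for the integral of a component of a vector function. -/
theorem sq_intervalIntegral_dotProduct_le {N : ℕ} {t s T : ℝ} (hts : t ≤ s) (hsT : s ≤ T)
    (c : Fin N → ℝ) {ψ : ℝ → Fin N → ℝ} (hψ : Measurable ψ) :
    ENNReal.ofReal ((∫ v in t..s, ψ v ⬝ᵥ c) ^ 2) ≤ ENNReal.ofReal ((T - t) * normSq c + 1) *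
      ∫⁻ v in Icc t T, ENNReal.ofReal (normSq (ψ v)) := by
  have hK : 0 ≤ (T - t) * normSq c := mul_nonneg (by linarith) (normSq_nonneg c)
  -- The `+ 1` in the constant keeps the factor positive, so the right-hand side is `⊤` when the
  -- integral diverges, even if `c = 0` or `t = T`.
  by_cases hfin : ∫⁻ v in Icc t T, ENNReal.ofReal (normSq (ψ v)) = ⊤
  · rw [hfin, ENNReal.mul_top (by simpa using by linarith)]
    exact le_top
  have hi := integrableOn_normSq_of_lintegral_ne_top hψ hfin
  have hsub : Ioc t s ⊆ Icc t T := fun v hv => ⟨hv.1.le, hv.2.trans hsT⟩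
  have hL2 := memLp_dotProduct_of_integrableOn_normSq hψ (hi.mono_set hsub) c
  have h1 := sq_integral_mul_le hL2 (memLp_const (1 : ℝ))
  simp only [mul_one, one_pow, integral_const, smul_eq_mul, measureReal_restrict_apply_univ,
    Real.volume_real_Ioc_of_le hts] at h1
  have h2 : ∫ v in Ioc t s, (ψ v ⬝ᵥ c) ^ 2 ≤ (∫ v in Icc t T, normSq (ψ v)) * normSq c := by
    rw [← integral_mul_const]
    calc ∫ v in Ioc t s, (ψ v ⬝ᵥ c) ^ 2 ≤ ∫ v in Ioc t s, normSq (ψ v) * normSq c :=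
          integral_mono hL2.integrable_sq ((hi.mono_set hsub).mul_const _)
            fun v => sq_dotProduct_le _ _
      _ ≤ _ := setIntegral_mono_set (hi.mul_const _)
          (ae_of_all _ fun v => mul_nonneg (normSq_nonneg _) (normSq_nonneg _))
          (ae_of_all _ hsub)
  have h3 : 0 ≤ ∫ v in Icc t T, normSq (ψ v) := integral_nonneg fun v => normSq_nonneg _
  rw [intervalIntegral.integral_of_le hts, ← ofReal_integral_eq_lintegral_ofReal hi
    (ae_of_all _ fun v => normSq_nonneg _), ← ENNReal.ofReal_mul (by linarith)]
  refine ENNReal.ofReal_le_ofReal (h1.trans ?_)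
  have h4 : (∫ v in Ioc t s, (ψ v ⬝ᵥ c) ^ 2) * (s - t)
      ≤ ((∫ v in Icc t T, normSq (ψ v)) * normSq c) * (T - t) :=
    mul_le_mul h2 (by linarith) (by linarith) (mul_nonneg h3 (normSq_nonneg c))
  nlinarith

/-! ### Gains of simple integrands -/

namespace SimpleIntegrand

variable {N : ℕ} {Ω : Type*} [mΩ : MeasurableSpace Ω] {P : Measure Ω}
  {W : ℝ≥0 → Ω → Fin N → ℝ}

theorem measurable_ξ (hW : IsStandardBrownian W P) (Φ : SimpleIntegrand W P) (k : ℕ) :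
    Measurable (Φ.ξ k) := (Φ.adapted k).mono (pastSigma_le hW _) le_rfl

theorem measurable_eval (hW : IsStandardBrownian W P) (Φ : SimpleIntegrand W P) :
    Measurable (fun p : ℝ × Ω => Φ.eval p.1 p.2) := by
  refine Finset.measurable_fun_sum _ fun k _ => ?_
  have : (fun p : ℝ × Ω => (Ioc (Φ.time k : ℝ) (Φ.time (k + 1) : ℝ)).indicator
      (fun _ => Φ.ξ k p.2) p.1)
      = (Prod.fst ⁻¹' Ioc (Φ.time k : ℝ) (Φ.time (k + 1) : ℝ)).indicator
        (fun p : ℝ × Ω => Φ.ξ k p.2) := by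
    ext p; simp only [indicator, mem_preimage]
  rw [this]
  exact ((Φ.measurable_ξ hW k).comp measurable_snd).indicator (measurable_fst measurableSet_Ioc)

theorem measurable_integral (hW : IsStandardBrownian W P) (Φ : SimpleIntegrand W P) (a b : ℝ≥0) :
    Measurable (Φ.integral a b) := by
  refine Finset.measurable_fun_sum _ fun k _ => Finset.measurable_fun_sum _ fun j _ => ?_
  have h1 := (measurable_pi_apply j).comp (Φ.measurable_ξ hW k)
  have h2 := fun r => (measurable_pi_apply j).comp (hW.measurable r)
  exact h1.mul ((h2 _).sub (h2 _))

end SimpleIntegrand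

theorem intervalIntegral_indicator_Ioc {t T τ τ' : ℝ} (htT : t ≤ T) (hτ : τ ≤ τ') (c : ℝ) :
    ∫ v in t..T, (Ioc τ τ').indicator (fun _ => c) v
      = (max t (min τ' T) - max t (min τ T)) * c := by
  rw [intervalIntegral.integral_of_le htT, setIntegral_indicator measurableSet_Ioc,
    Ioc_inter_Ioc, setIntegral_const, smul_eq_mul, Real.volume_real_Ioc]
  congr 1
  rcases le_total τ T with h1 | h1 <;> rcases le_total τ' T with h2 | h2 <;>
    rcases le_total t τ with h3 | h3 <;> rcases le_total t τ' with h4 | h4 <;>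
    simp [*] <;> linarith

namespace SimpleIntegrand

variable {N : ℕ} {Ω : Type*} [mΩ : MeasurableSpace Ω] {P : Measure Ω}
  {W : ℝ≥0 → Ω → Fin N → ℝ}

theorem eval_dotProduct (Φ : SimpleIntegrand W P) (c : Fin N → ℝ) (v : ℝ) (ω : Ω) :
    Φ.eval v ω ⬝ᵥ c = ∑ k ∈ Finset.range Φ.n,
      (Ioc (Φ.time k : ℝ) (Φ.time (k + 1) : ℝ)).indicator (fun _ => Φ.ξ k ω ⬝ᵥ c) v := by
  rw [eval, sum_dotProduct]
  refine Finset.sum_congr rfl fun k _ => ?_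
  by_cases h : v ∈ Ioc (Φ.time k : ℝ) (Φ.time (k + 1) : ℝ) <;> simp [h]

theorem intervalIntegrable_eval (Φ : SimpleIntegrand W P) (c : Fin N → ℝ) (a b : ℝ) (ω : Ω) :
    IntervalIntegrable (fun v => Φ.eval v ω ⬝ᵥ c) volume a b := by
  simp only [eval_dotProduct]
  have h := IntervalIntegrable.sum (μ := volume) (a := a) (b := b) (Finset.range Φ.n)
    (f := fun k => (Ioc (Φ.time k : ℝ) (Φ.time (k + 1) : ℝ)).indicator fun _ => Φ.ξ k ω ⬝ᵥ c)
    fun k _ => by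
      rw [intervalIntegrable_iff]
      exact (integrableOn_const (by simp)).indicator measurableSet_Ioc
  have e : (∑ k ∈ Finset.range Φ.n,
      (Ioc (Φ.time k : ℝ) (Φ.time (k + 1) : ℝ)).indicator fun _ => Φ.ξ k ω ⬝ᵥ c) = fun v =>
      ∑ k ∈ Finset.range Φ.n,
        (Ioc (Φ.time k : ℝ) (Φ.time (k + 1) : ℝ)).indicator (fun _ => Φ.ξ k ω ⬝ᵥ c) v := by
    ext v; rw [Finset.sum_apply]
  rwa [e] at h

/-- The gains of a simple strategy in a market with price of risk `c` are elementary gains. -/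
theorem intervalIntegral_eval_add_integral (Φ : SimpleIntegrand W P) (c : Fin N → ℝ) {t T : ℝ≥0}
    (htT : t ≤ T) (ω : Ω) :
    (∫ v in (t : ℝ)..T, Φ.eval v ω ⬝ᵥ c) + Φ.integral t T ω = ∑ k ∈ Finset.range Φ.n,
      Φ.ξ k ω ⬝ᵥ (W (max t (min (Φ.time (k + 1)) T)) ω - W (max t (min (Φ.time k) T)) ω +
        (((max t (min (Φ.time (k + 1)) T) : ℝ≥0) : ℝ) - (max t (min (Φ.time k) T) : ℝ≥0)) • c) := by
  simp only [eval_dotProduct]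
  rw [intervalIntegral.integral_finsetSum, SimpleIntegrand.integral, ← Finset.sum_add_distrib]
  · refine Finset.sum_congr rfl fun k _ => ?_
    rw [intervalIntegral_indicator_Ioc (by exact_mod_cast htT)
      (by exact_mod_cast Φ.time_mono (Nat.le_succ k)), dotProduct_add, dotProduct_smul]
    push_cast
    rw [smul_eq_mul]
    ring
  · intro k _
    rw [intervalIntegrable_iff]
    exact (integrableOn_const (by simp)).indicator measurableSet_Ioc

theorem integral_girsanov_mul_gain [IsProbabilityMeasure P] (hW : IsStandardBrownian W P)
    (Φ : SimpleIntegrand W P) (c : Fin N → ℝ) {t T : ℝ≥0} (htT : t ≤ T) :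
    Integrable (fun ω => girsanov c (T - t) (W T ω - W t ω) *
        ((∫ v in (t : ℝ)..T, Φ.eval v ω ⬝ᵥ c) + Φ.integral t T ω)) P ∧
      ∫ ω, girsanov c (T - t) (W T ω - W t ω) *
        ((∫ v in (t : ℝ)..T, Φ.eval v ω ⬝ᵥ c) + Φ.integral t T ω) ∂P = 0 := by
  simp only [Φ.intervalIntegral_eval_add_integral c htT, Finset.mul_sum]
  have key : ∀ k, Integrable (fun ω => girsanov c (T - t) (W T ω - W t ω) *
      (Φ.ξ k ω ⬝ᵥ (W (max t (min (Φ.time (k + 1)) T)) ω - W (max t (min (Φ.time k) T)) ω +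
        (((max t (min (Φ.time (k + 1)) T) : ℝ≥0) : ℝ) - (max t (min (Φ.time k) T) : ℝ≥0)) • c))) P ∧
      ∫ ω, girsanov c (T - t) (W T ω - W t ω) *
      (Φ.ξ k ω ⬝ᵥ (W (max t (min (Φ.time (k + 1)) T)) ω - W (max t (min (Φ.time k) T)) ω +
        (((max t (min (Φ.time (k + 1)) T) : ℝ≥0) : ℝ) - (max t (min (Φ.time k) T) : ℝ≥0)) • c)) ∂P
        = 0 := by
    intro k
    -- Clipping to `[t, T]` can only delay a starting time `≤ T`, so `ξ k` is still known there. A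
    -- step starting after `T` collapses to a point and contributes nothing.
    rcases le_total (Φ.time k) T with h | h
    · refine Merton.integral_girsanov_mul_gain hW (le_max_left _ _) ?_ (max_le htT (min_le_right _ _))
        c ?_ (Φ.memLp k)
      · exact max_le_max le_rfl (min_le_min_right _ (Φ.time_mono (Nat.le_succ k)))
      · refine (Φ.adapted k).mono (pastSigma_mono ?_) le_rfl
        rw [min_eq_left h]; exact le_max_right _ _
    · have h' := h.trans (Φ.time_mono (Nat.le_succ k))
      simp [min_eq_right h, min_eq_right h']
  refine ⟨integrable_finsetSum _ fun k _ => (key k).1, ?_⟩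
  rw [integral_finsetSum _ fun k _ => (key k).1]
  exact Finset.sum_eq_zero fun k _ => (key k).2

end SimpleIntegrand

end Merton

namespace Merton

/-! ### The budget constraint -/

theorem measurable_intervalIntegral {Ω : Type*} [MeasurableSpace Ω] {f : ℝ → Ω → ℝ}
    (hf : Measurable (Function.uncurry f)) (a b : ℝ) :
    Measurable (fun ω => ∫ v in a..b, f v ω) := by
  have h1 : Measurable (fun p : Ω × ℝ => f p.2 p.1) := hf.comp measurable_swap
  exact (h1.stronglyMeasurable.integral_prod_right' (ν := volume.restrict (Ioc a b))).measurable.sub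
    (h1.stronglyMeasurable.integral_prod_right' (ν := volume.restrict (Ioc b a))).measurable

/-- Orthogonality to a fixed square integrable `Z` is closed under `L²` convergence. Only the
differences `Y - G n` have to be square integrable, and they are for large `n`. -/
theorem integral_mul_eq_zero_of_tendsto {Ω : Type*} [MeasurableSpace Ω] {P : Measure Ω}
    {Z Y : Ω → ℝ} {G : ℕ → Ω → ℝ} (hZ : MemLp Z 2 P) (hY : AEStronglyMeasurable Y P)
    (hG : ∀ n, AEStronglyMeasurable (G n) P) (hGi : ∀ n, Integrable (fun ω => Z ω * G n ω) P)
    (hG0 : ∀ n, ∫ ω, Z ω * G n ω ∂P = 0)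
    (hlim : Tendsto (fun n => ∫⁻ ω, ENNReal.ofReal ((Y ω - G n ω) ^ 2) ∂P) atTop (𝓝 0)) :
    Integrable (fun ω => Z ω * Y ω) P ∧ ∫ ω, Z ω * Y ω ∂P = 0 := by
  have hL2 : ∀ᶠ n in atTop, MemLp (fun ω => Y ω - G n ω) 2 P := by
    filter_upwards [hlim.eventually (gt_mem_nhds ENNReal.zero_lt_top)] with n hn
    have hm := hY.sub (hG n)
    rw [memLp_two_iff_integrable_sq (f := fun ω => Y ω - G n ω) hm]
    refine ⟨(hm.pow 2), ?_⟩
    rw [hasFiniteIntegral_iff_ofReal (ae_of_all _ fun ω => sq_nonneg _)]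
    exact hn
  have hint : ∀ n, MemLp (fun ω => Y ω - G n ω) 2 P → Integrable (fun ω => Z ω * Y ω) P := by
    intro n hn
    have h1 : Integrable (fun ω => Z ω * (Y ω - G n ω)) P := hZ.integrable_mul hn
    refine (h1.add (hGi n)).congr (ae_of_all _ fun ω => ?_)
    simp only [Pi.add_apply]; ring
  obtain ⟨n₀, hn₀⟩ := hL2.exists
  have hi := hint n₀ hn₀
  refine ⟨hi, ?_⟩
  have hbound : ∀ᶠ n in atTop, (∫ ω, Z ω * Y ω ∂P) ^ 2 ≤
      (∫ ω, Z ω ^ 2 ∂P) * (∫⁻ ω, ENNReal.ofReal ((Y ω - G n ω) ^ 2) ∂P).toReal := by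
    filter_upwards [hL2] with n hn
    have h1 : ∫ ω, Z ω * Y ω ∂P = ∫ ω, Z ω * (Y ω - G n ω) ∂P := by
      have : ∀ ω, Z ω * (Y ω - G n ω) = Z ω * Y ω - Z ω * G n ω := fun ω => by ring
      simp only [this]
      rw [integral_sub hi (hGi n), hG0, sub_zero]
    rw [h1, ← integral_eq_lintegral_of_nonneg_ae (ae_of_all _ fun ω => sq_nonneg _)
      hn.integrable_sq.aestronglyMeasurable]
    exact sq_integral_mul_le hZ hn
  have hlim' : Tendsto (fun n => (∫ ω, Z ω ^ 2 ∂P) *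
      (∫⁻ ω, ENNReal.ofReal ((Y ω - G n ω) ^ 2) ∂P).toReal) atTop (𝓝 0) := by
    have := ((ENNReal.tendsto_toReal ENNReal.zero_ne_top).comp hlim).const_mul (∫ ω, Z ω ^ 2 ∂P)
    simpa using this
  have := ge_of_tendsto hlim' hbound
  exact pow_eq_zero_iff (two_ne_zero) |>.1 (le_antisymm this (sq_nonneg _))

section Budget

variable {N : ℕ} {Ω : Type*} [mΩ : MeasurableSpace Ω] {P : Measure Ω} [IsProbabilityMeasure P]
  {W : ℝ≥0 → Ω → Fin N → ℝ}

theorem measurable_mulVec (A : Matrix (Fin N) (Fin N) ℝ) :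
    Measurable (fun v : Fin N → ℝ => A *ᵥ v) :=
  measurable_pi_lambda _ fun i => measurable_dotProduct (A i)

/-- The mean-zero property of simple gains survives the limit: the stochastic part converges in `L²`
by the definition of the Ito integral, and the drift part by Cauchy–Schwarz in time. -/
theorem integral_girsanov_mul_of_isItoIntegral (hW : IsStandardBrownian W P) (c : Fin N → ℝ)
    {t T : ℝ≥0} (htT : t ≤ T) {φ : ℝ → Ω → Fin N → ℝ} (hφ : Measurable (Function.uncurry φ))
    {M : ℝ → Ω → ℝ} (hM : IsItoIntegral W P t T φ M) :
    Integrable (fun ω => girsanov c (T - t) (W T ω - W t ω) *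
        ((∫ v in (t : ℝ)..T, φ v ω ⬝ᵥ c) + M T ω)) P ∧
      ∫ ω, girsanov c (T - t) (W T ω - W t ω) *
        ((∫ v in (t : ℝ)..T, φ v ω ⬝ᵥ c) + M T ω) ∂P = 0 := by
  have htT' : (t : ℝ) ≤ T := by exact_mod_cast htT
  obtain ⟨hMm, Φ, h1, h2⟩ := hM
  have h2 := h2 T ⟨htT', le_rfl⟩
  simp only [Real.toNNReal_coe] at h2
  have hφc : Measurable (Function.uncurry fun v ω => φ v ω ⬝ᵥ c) := by
    simp only [dotProduct_comm _ c]
    exact (measurable_dotProduct c).comp hφ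
  have hΦm : ∀ n, Measurable (Function.uncurry fun v ω => (Φ n).eval v ω ⬝ᵥ c) := fun n => by
    simp only [dotProduct_comm _ c]
    exact (measurable_dotProduct c).comp ((Φ n).measurable_eval hW)
  have hdm : ∀ n, Measurable (fun p : ℝ × Ω => (Φ n).eval p.1 p.2 - φ p.1 p.2) := fun n =>
    ((Φ n).measurable_eval hW).sub hφ
  have hin : ∀ n, Measurable (fun ω => ∫⁻ s in Icc (t : ℝ) T,
      ENNReal.ofReal (normSq ((Φ n).eval s ω - φ s ω))) := fun n =>
    Measurable.lintegral_prod_right' (ν := volume.restrict (Icc (t : ℝ) T))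
      (f := fun p : Ω × ℝ => ENNReal.ofReal (normSq ((Φ n).eval p.2 p.1 - φ p.2 p.1)))
      ((measurable_normSq.comp ((hdm n).comp measurable_swap)).ennreal_ofReal)
  have hMT : AEMeasurable (M T) P := hMm T ⟨htT', le_rfl⟩
  refine integral_mul_eq_zero_of_tendsto
    (G := fun n ω => (∫ v in (t : ℝ)..T, (Φ n).eval v ω ⬝ᵥ c) + (Φ n).integral t T ω)
    (memLp_girsanov hW htT c _) ((measurable_intervalIntegral hφc _ _).aemeasurable.add
      hMT).aestronglyMeasurable (fun n => ((measurable_intervalIntegral (hΦm n) _ _).add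
      ((Φ n).measurable_integral hW t T)).aestronglyMeasurable)
    (fun n => ((Φ n).integral_girsanov_mul_gain hW c htT).1)
    (fun n => ((Φ n).integral_girsanov_mul_gain hW c htT).2) ?_
  set K := ENNReal.ofReal (((T : ℝ) - t) * normSq c + 1)
  have hlim : Tendsto (fun n => 2 * (K * ∫⁻ ω, (∫⁻ s in Icc (t : ℝ) T,
      ENNReal.ofReal (normSq ((Φ n).eval s ω - φ s ω))) ∂P) +
      2 * ∫⁻ ω, ENNReal.ofReal ((M T ω - (Φ n).integral t T ω) ^ 2) ∂P) atTop (𝓝 0) := by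
    have e1 := ENNReal.Tendsto.const_mul (a := 2)
      (ENNReal.Tendsto.const_mul (a := K) h1 (Or.inr ENNReal.ofReal_ne_top))
      (Or.inr (by simp))
    have e2 := ENNReal.Tendsto.const_mul (a := 2) h2 (Or.inr (by simp))
    simpa using e1.add e2
  refine tendsto_of_tendsto_of_tendsto_of_le_of_le' tendsto_const_nhds hlim
    (Eventually.of_forall fun _ => zero_le) ?_
  filter_upwards [h1.eventually (gt_mem_nhds ENNReal.zero_lt_top)] with n hn
  rw [← lintegral_const_mul _ (hin n), ← lintegral_const_mul _ ((hin n).const_mul K),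
    ← lintegral_const_mul' _ _ (by simp), ← lintegral_add_left (((hin n).const_mul K).const_mul 2)]
  refine lintegral_mono_ae ?_
  -- For almost every path the difference of integrands is square integrable in time, so the drift
  -- integral of `φ` can be split; the rest is `(x + y)² ≤ 2 x² + 2 y²`.
  filter_upwards [ae_lt_top (hin n) hn.ne] with ω hω
  have hψ : Measurable (fun v => (Φ n).eval v ω - φ v ω) := (hdm n).comp measurable_prodMk_right
  have hi := intervalIntegrable_dotProduct htT' hψ hω.ne c
  have e1 : ∫ v in (t : ℝ)..T, φ v ω ⬝ᵥ c = (∫ v in (t : ℝ)..T, (Φ n).eval v ω ⬝ᵥ c)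
      - ∫ v in (t : ℝ)..T, ((Φ n).eval v ω - φ v ω) ⬝ᵥ c := by
    rw [← intervalIntegral.integral_sub ((Φ n).intervalIntegrable_eval c _ _ ω) hi]
    congr 1; ext v
    rw [sub_dotProduct]; ring
  have e2 := sq_intervalIntegral_dotProduct_le htT' le_rfl c hψ
  refine le_trans ?_ (add_le_add (mul_le_mul_right e2 2) le_rfl)
  rw [e1, show (2 : ℝ≥0∞) = ENNReal.ofReal 2 by simp, ← ENNReal.ofReal_mul (by norm_num),
    ← ENNReal.ofReal_mul (by norm_num), ← ENNReal.ofReal_add (by positivity) (by positivity)]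
  refine ENNReal.ofReal_le_ofReal ?_
  set a := ∫ v in (t : ℝ)..T, ((Φ n).eval v ω - φ v ω) ⬝ᵥ c
  nlinarith [sq_nonneg (a + (M T ω - (Φ n).integral t T ω))]

/-- The expectation of a function of the log-state-price `ζ - λ ⬝ ΔW - θ`. -/
theorem hasLaw_logPrice (hW : IsStandardBrownian W P) (c : Fin N → ℝ) {t T : ℝ≥0} (htT : t ≤ T)
    (ζ : ℝ) : HasLaw (fun ω => ζ - c ⬝ᵥ (W T ω - W t ω))
      (gaussianReal ζ ((normSq c).toNNReal * (T - t))) P := by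
  have h := gaussianReal_const_sub (hasLaw_dotProduct_incr hW htT c) ζ
  simpa using h

theorem integral_comp_logPrice (hW : IsStandardBrownian W P) (c : Fin N → ℝ) {t T : ℝ≥0}
    (htT : t ≤ T) (ζ : ℝ) {F : ℝ → ℝ} (hF : Measurable F) :
    ∫ ω, F (ζ - c ⬝ᵥ (W T ω - W t ω)) ∂P = gconv ((normSq c).toNNReal * (T - t)) F ζ := by
  rw [gconv_eq_integral]
  exact (hasLaw_logPrice hW c htT ζ).integral_comp (f := F) hF.aestronglyMeasurable

theorem coe_variance (c : Fin N → ℝ) {t T : ℝ≥0} (htT : t ≤ T) :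
    (((normSq c).toNNReal * (T - t) : ℝ≥0) : ℝ) = normSq c * (T - t) := by
  rw [NNReal.coe_mul, NNReal.coe_sub htT, Real.coe_toNNReal _ (normSq_nonneg c)]

/-- The density depends only on the Gaussian variable `-c ⬝ ΔW` and tilts it with parameter `1`.
Girsanov's theorem thus reduces to the one-dimensional Cameron–Martin formula, whose shift `θ`
cancels the drift. -/
theorem integral_girsanov_mul_comp_logPrice (hW : IsStandardBrownian W P) (c : Fin N → ℝ)
    {t T : ℝ≥0} (htT : t ≤ T) (ζ : ℝ) {F : ℝ → ℝ} (hF : Measurable F) :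
    ∫ ω, girsanov c (T - t) (W T ω - W t ω) *
      F (ζ - (normSq c).toNNReal * (T - t) - c ⬝ᵥ (W T ω - W t ω)) ∂P
      = gconv ((normSq c).toNNReal * (T - t)) F ζ := by
  set θ := (normSq c).toNNReal * (T - t) with hθ
  have hθ' : (θ : ℝ) = normSq c * (T - t) := coe_variance c htT
  have h0 : (((normSq c).toNNReal : ℝ) * ((T : ℝ) - t)) = θ := by
    rw [hθ', Real.coe_toNNReal _ (normSq_nonneg c)]
  have h1 : ∀ ω, girsanov c (T - t) (W T ω - W t ω) = Real.exp (1 * ((0 : ℝ) - c ⬝ᵥ (W T ω - W t ω))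
      - 1 ^ 2 * θ / 2) := fun ω => by
    rw [girsanov, hθ']; congr 1; ring
  have h2 := integral_comp_logPrice hW c htT 0
    (F := fun w => Real.exp (1 * w - 1 ^ 2 * θ / 2) * F (ζ - θ + w)) (by fun_prop)
  rw [gconv, ← hθ] at h2
  simp only [zero_add] at h2
  rw [integral_exp_mul_gaussianReal (fun w => F (ζ - θ + w))] at h2
  have e : ∀ w : ℝ, ζ - θ + (w + 1 * θ) = ζ + w := fun w => by ring
  simp only [e] at h2
  rw [gconv, ← h2]
  refine integral_congr_ae (ae_of_all _ fun ω => ?_)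
  dsimp only
  rw [h1, h0]
  congr 2; ring

theorem integral_girsanov (hW : IsStandardBrownian W P) (c : Fin N → ℝ) {t T : ℝ≥0}
    (htT : t ≤ T) : ∫ ω, girsanov c (T - t) (W T ω - W t ω) ∂P = 1 := by
  have := integral_girsanov_mul_comp_logPrice hW c htT 0 (F := fun _ => (1 : ℝ)) measurable_const
  simpa [gconv] using this

/-- Terminal wealth is the initial capital plus gains that have mean zero under the density. -/
theorem IsAdmissible.budget (hW : IsStandardBrownian W P) {m : Market N} {t T : ℝ≥0} (htT : t ≤ T)
    {x : ℝ} {π : ℝ → Ω → Fin N → ℝ} {X : ℝ → Ω → ℝ} (hA : IsAdmissible W P m T x t π X) :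
    Integrable (fun ω => girsanov m.priceOfRisk (T - t) (W T ω - W t ω) * X T ω) P ∧
      ∫ ω, girsanov m.priceOfRisk (T - t) (W T ω - W t ω) * X T ω ∂P = x := by
  obtain ⟨-, M, hM, hX⟩ := hA.wealth
  have hφ : Measurable (Function.uncurry fun s ω => m.σ *ᵥ π s ω) :=
    (measurable_mulVec m.σ).comp hA.measurable
  obtain ⟨h1, h2⟩ := integral_girsanov_mul_of_isItoIntegral hW m.priceOfRisk htT hφ hM
  have hZi := ((memLp_girsanov hW htT m.priceOfRisk (T - t)).integrable (by norm_num)).const_mul x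
  have hae : (fun ω => girsanov m.priceOfRisk (T - t) (W T ω - W t ω) * X T ω) =ᵐ[P]
      fun ω => x * girsanov m.priceOfRisk (T - t) (W T ω - W t ω) +
        girsanov m.priceOfRisk (T - t) (W T ω - W t ω) *
        ((∫ v in (t : ℝ)..T, (m.σ *ᵥ π v ω) ⬝ᵥ m.priceOfRisk) + M T ω) := by
    filter_upwards [hX T ⟨by exact_mod_cast htT, le_rfl⟩] with ω hω
    rw [hω]; ring
  refine ⟨(hZi.add h1).congr hae.symm, ?_⟩
  rw [integral_congr_ae hae, integral_add hZi h1, h2, integral_const_mul,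
    integral_girsanov hW _ htT]
  ring

end Budget

/-! ### Extended expectations and the upper bound -/

theorem expectation_coe {Ω : Type*} [MeasurableSpace Ω] {P : Measure Ω} {g : Ω → ℝ}
    (hg : Integrable g P) : expectation P (fun ω => (g ω : EReal)) = (∫ ω, g ω ∂P : ℝ) := by
  have e : ∀ r : ℝ, (r : EReal).toENNReal = ENNReal.ofReal r := fun r => by
    rw [EReal.toENNReal_of_ne_top (EReal.coe_ne_top r), EReal.toReal_coe]
  have h1 : ∫⁻ ω, ENNReal.ofReal (g ω) ∂P ≠ ⊤ := hg.lintegral_lt_top.ne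
  have h2 : ∫⁻ ω, ENNReal.ofReal (-g ω) ∂P ≠ ⊤ := hg.neg.lintegral_lt_top.ne
  simp only [expectation, ← EReal.coe_neg, e]
  rw [integral_eq_lintegral_pos_part_sub_lintegral_neg_part hg, EReal.coe_sub,
    EReal.coe_ennreal_toReal h1, EReal.coe_ennreal_toReal h2]

theorem expectation_mono {Ω : Type*} [MeasurableSpace Ω] {P : Measure Ω} {f g : Ω → EReal}
    (h : ∀ᵐ ω ∂P, f ω ≤ g ω) : expectation P f ≤ expectation P g := by
  refine EReal.sub_le_sub ?_ ?_
  · exact EReal.coe_ennreal_le_coe_ennreal_iff.2 (lintegral_mono_ae (h.mono fun ω hω =>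
      EReal.toENNReal_le_toENNReal hω))
  · exact EReal.coe_ennreal_le_coe_ennreal_iff.2 (lintegral_mono_ae (h.mono fun ω hω =>
      EReal.toENNReal_le_toENNReal (EReal.neg_le_neg_iff.2 hω)))

/-- At zero wealth the tangent inequality is the limit of those at small positive wealth, all of
which bound the infimum. -/
theorem DualProfile.extendedUtility_le {U h p q : ℝ → ℝ} (D : DualProfile U h p q) (z : ℝ) {x : ℝ}
    (hx : 0 ≤ x) : extendedUtility U x ≤ ((U (h z) + Real.exp z * (x - h z) : ℝ) : EReal) := by
  rcases hx.eq_or_lt with rfl | hx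
  · rw [extendedUtility, if_neg (lt_irrefl _)]
    have hlim : Tendsto (fun y : ℝ => ((U (h z) + Real.exp z * (y - h z) : ℝ) : EReal)) (𝓝[>] 0)
        (𝓝 ((U (h z) + Real.exp z * (0 - h z) : ℝ) : EReal)) := by
      refine (continuous_coe_real_ereal.tendsto _).comp (Tendsto.mono_left ?_ nhdsWithin_le_nhds)
      exact Continuous.tendsto (by fun_prop) 0
    refine ge_of_tendsto hlim ?_
    filter_upwards [self_mem_nhdsWithin] with y hy
    exact (iInf_le _ (⟨y, hy⟩ : Ioi (0 : ℝ))).trans (EReal.coe_le_coe_iff.2 (D.le_tangent z y hy))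
  · rw [extendedUtility, if_pos hx]
    exact EReal.coe_le_coe_iff.2 (D.le_tangent z x hx)

/-- Weak duality. The tangent to `U` is taken at the random point `h (b ω)`, with `b` chosen so that
the slope `exp b` is a constant multiple of the density `Z`. Since `E[Z X_T]` and `E[Z h (b)]` are
both the initial wealth, the linear term has mean zero and `E[U (h (b))]` remains. -/
theorem DualProfile.expectation_le {N : ℕ} {Ω : Type*} [MeasurableSpace Ω] {P : Measure Ω}
    [IsProbabilityMeasure P] {W : ℝ≥0 → Ω → Fin N → ℝ} {U h p q : ℝ → ℝ}
    (D : DualProfile U h p q) (hW : IsStandardBrownian W P) {m : Market N} {t T : ℝ≥0}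
    (htT : t ≤ T) {θ : ℝ≥0} (hθ : θ = (normSq m.priceOfRisk).toNNReal * (T - t)) (ζ : ℝ)
    {π : ℝ → Ω → Fin N → ℝ} {X : ℝ → Ω → ℝ}
    (hA : IsAdmissible W P m T (Merton.gconv θ h ζ) t π X) :
    expectation P (fun ω => extendedUtility U (X T ω)) ≤
      (Merton.gconv θ (fun z => U (h z)) (ζ - θ) : ℝ) := by
  set c := m.priceOfRisk with hc
  set Z := fun ω => girsanov c (T - t) (W T ω - W t ω) with hZ
  set b := fun ω => ζ - θ - c ⬝ᵥ (W T ω - W t ω) with hb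
  have hθ' : (θ : ℝ) = normSq c * (T - t) := by rw [hθ, coe_variance c htT]
  obtain ⟨h1, h2⟩ := hA.budget hW htT
  have h3 := integral_comp_logPrice hW c htT (ζ - θ) D.continuous_U_h.measurable
  have h3i := D.expBdd_U_h.integrable_comp (hasLaw_logPrice hW c htT (ζ - θ))
    D.continuous_U_h.measurable
  have h4 := integral_girsanov_mul_comp_logPrice hW c htT ζ D.continuous_h.measurable
  have h4i : Integrable (fun ω => Z ω * h (b ω)) P :=
    (memLp_girsanov hW htT c _).integrable_mul (D.expBdd_h.memLp_comp
      (hasLaw_logPrice hW c htT (ζ - θ)) D.continuous_h.measurable)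
  have h0 : (((normSq c).toNNReal : ℝ) * ((T : ℝ) - t)) = θ := by
    rw [hθ', Real.coe_toNNReal _ (normSq_nonneg c)]
  rw [h0] at h4
  have hexp : ∀ ω, Real.exp (b ω) = Real.exp (ζ - θ / 2) * Z ω := fun ω => by
    simp only [hb, hZ, girsanov]
    rw [← Real.exp_add, ← hθ']
    congr 1; ring
  have hgi : Integrable (fun ω => U (h (b ω)) + Real.exp (ζ - θ / 2) * (Z ω * X T ω - Z ω * h (b ω)))
      P := h3i.add ((h1.sub h4i).const_mul _)
  have hval : ∫ ω, (U (h (b ω)) + Real.exp (ζ - θ / 2) * (Z ω * X T ω - Z ω * h (b ω))) ∂P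
      = Merton.gconv θ (fun z => U (h z)) (ζ - θ) := by
    have h5 : Integrable (fun ω => Real.exp (ζ - θ / 2) * (Z ω * X T ω - Z ω * h (b ω))) P :=
      (h1.sub h4i).const_mul _
    rw [integral_add h3i h5, integral_const_mul, integral_sub h1 h4i, h2, h4, h3, ← hθ]
    ring
  rw [← hval, ← expectation_coe hgi]
  refine expectation_mono ?_
  filter_upwards [hA.nonneg] with ω hω
  refine (D.extendedUtility_le (b ω) (hω T ⟨by exact_mod_cast htT, le_rfl⟩)).trans_eq ?_
  rw [hexp]
  congr 1; ring

end Merton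

namespace Merton

/-! ### Taylor expansions and the heat flow -/

/-- The mean value inequality applied to the Taylor remainder. Sharp constants are not needed, here
or at the next order. -/
theorem abs_sub_linear_le {g g₁ : ℝ → ℝ} {K : ℝ} (hd : ∀ z, HasDerivAt g (g₁ z) z)
    (hl : ∀ x y, |g₁ x - g₁ y| ≤ K * |x - y|) (b d : ℝ) :
    |g (b + d) - g b - g₁ b * d| ≤ K * d ^ 2 := by
  have hK : 0 ≤ K := by simpa using (abs_nonneg _).trans (hl 1 0)
  have h1 := (convex_closedBall (0 : ℝ) |d|).norm_image_sub_le_of_norm_hasDerivWithin_le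
    (f := fun x => g (b + x) - g₁ b * x) (f' := fun x => g₁ (b + x) - g₁ b) (C := K * |d|)
    (fun x _ => by
      have := ((hd (b + x)).comp_const_add b x).sub ((hasDerivAt_id x).const_mul (g₁ b))
      rw [mul_one] at this
      exact this.hasDerivWithinAt)
    (fun x hx => (hl _ _).trans (by
      rw [add_sub_cancel_left]
      exact mul_le_mul_of_nonneg_left (by simpa using hx) hK))
    (x := 0) (y := d) (by simp) (by simp)
  simp only [Real.norm_eq_abs, sub_zero, add_zero, mul_zero] at h1
  rw [mul_assoc, ← sq, sq_abs] at h1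
  have e : g (b + d) - g b - g₁ b * d = g (b + d) - g₁ b * d - g b := by ring
  rwa [e]

theorem abs_sub_quadratic_le {g g₁ g₂ : ℝ → ℝ} {K : ℝ} (hd : ∀ z, HasDerivAt g (g₁ z) z)
    (hd₁ : ∀ z, HasDerivAt g₁ (g₂ z) z) (hl : ∀ x y, |g₂ x - g₂ y| ≤ K * |x - y|) (b d : ℝ) :
    |g (b + d) - g b - g₁ b * d - g₂ b / 2 * d ^ 2| ≤ K * |d| ^ 3 := by
  have hK : 0 ≤ K := by simpa using (abs_nonneg _).trans (hl 1 0)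
  have h1 := (convex_closedBall (0 : ℝ) |d|).norm_image_sub_le_of_norm_hasDerivWithin_le
    (f := fun x => g (b + x) - g₁ b * x - g₂ b / 2 * x ^ 2)
    (f' := fun x => g₁ (b + x) - g₁ b - g₂ b * x) (C := K * d ^ 2)
    (fun x _ => by
      have := (((hd (b + x)).comp_const_add b x).sub ((hasDerivAt_id x).const_mul (g₁ b))).sub
        ((hasDerivAt_pow 2 x).const_mul (g₂ b / 2))
      refine (this.congr_deriv ?_).hasDerivWithinAt
      norm_num; ring)
    (fun x hx => (abs_sub_linear_le hd₁ hl b x).trans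
      (mul_le_mul_of_nonneg_left (sq_le_sq.2 (by simpa using hx)) hK))
    (x := 0) (y := d) (by simp) (by simp)
  simp only [Real.norm_eq_abs, sub_zero, add_zero, mul_zero] at h1
  have e : g (b + d) - g b - g₁ b * d - g₂ b / 2 * d ^ 2
      = g (b + d) - g₁ b * d - g₂ b / 2 * d ^ 2 - (g b - g₂ b / 2 * 0 ^ 2) := by ring
  rw [e]
  refine h1.trans_eq ?_
  rw [← sq_abs d]; ring

theorem integral_gaussianReal_scale (F : ℝ → ℝ) (η : ℝ≥0) :
    ∫ w, F w ∂gaussianReal 0 η = ∫ n, F (√(η : ℝ) * n) ∂gaussianReal 0 1 := by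
  by_cases hη : η = 0
  · subst hη; simp [gaussianReal_zero_var]
  have h := gaussianReal_map_const_mul (μ := 0) (v := 1) (√(η : ℝ))
  have e : (⟨√(η : ℝ) ^ 2, sq_nonneg _⟩ : ℝ≥0) * 1 = η := by
    ext; simp
  rw [mul_zero] at h
  rw [show (gaussianReal 0 η) = (gaussianReal 0 1).map (fun n => √(η : ℝ) * n) by
    rw [h]; congr 1; exact e.symm]
  have hne : √(η : ℝ) ≠ 0 := (Real.sqrt_pos.2 (by exact_mod_cast pos_iff_ne_zero.2 hη)).ne'
  exact (measurableEmbedding_mulLeft₀ hne).integral_map _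

theorem integral_sq_gaussianReal (η : ℝ≥0) : ∫ w, w ^ 2 ∂gaussianReal 0 η = η := by
  have h := variance_fun_id_gaussianReal (μ := 0) (v := η)
  rw [variance_eq_integral measurable_id'.aemeasurable] at h
  simpa using h

/-- The third absolute moment of the standard Gaussian law. -/
noncomputable def thirdMoment : ℝ := ∫ n, |n| ^ 3 ∂gaussianReal 0 1

theorem expBdd_abs : ExpBdd (fun z => |z|) := expBdd_id.mono zero_le_one fun z => by simp

theorem ExpBdd.pow {F : ℝ → ℝ} (hF : ExpBdd F) (k : ℕ) : ExpBdd (fun z => F z ^ k) := by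
  induction k with
  | zero => exact ExpBdd.of_bounded (K := 1) (by simp)
  | succ k ih => simpa only [pow_succ] using ih.mul hF

theorem integral_abs_pow_three_gaussianReal (η : ℝ≥0) :
    ∫ w, |w| ^ 3 ∂gaussianReal 0 η = √(η : ℝ) ^ 3 * thirdMoment := by
  rw [integral_gaussianReal_scale, thirdMoment, ← integral_const_mul]
  refine integral_congr_ae (ae_of_all _ fun n => ?_)
  dsimp only
  rw [abs_mul, mul_pow, abs_of_nonneg (Real.sqrt_nonneg _)]

/-- The linear Taylor term averages to zero, so the error is governed by the second moment `η`. -/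
theorem abs_gconv_sub_le {g g₁ : ℝ → ℝ} {K : ℝ} (hg : ExpBdd g)
    (hd : ∀ z, HasDerivAt g (g₁ z) z) (hl : ∀ x y, |g₁ x - g₁ y| ≤ K * |x - y|) (η : ℝ≥0)
    (b : ℝ) : |gconv η g b - g b| ≤ K * η := by
  have hc : Continuous g := continuous_iff_continuousAt.2 fun z => (hd z).continuousAt
  have i1 := hg.integrable_add hc.measurable b 0 η
  have i2 : Integrable (fun w => g₁ b * w) (gaussianReal 0 η) :=
    (expBdd_id.integrable measurable_id 0 η).const_mul _
  have i3 : Integrable (fun w => g (b + w) - g b) (gaussianReal 0 η) := i1.sub (integrable_const _)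
  have e : gconv η g b - g b = ∫ w, (g (b + w) - g b - g₁ b * w) ∂gaussianReal 0 η := by
    rw [integral_sub i3 i2, integral_sub i1 (integrable_const _), integral_const_mul,
      integral_id_gaussianReal]
    simp [gconv]
  rw [e, ← Real.norm_eq_abs, ← integral_sq_gaussianReal η, ← integral_const_mul]
  exact norm_integral_le_of_norm_le
    (((expBdd_id.pow 2).integrable (by fun_prop) 0 η).const_mul K)
    (ae_of_all _ fun w => abs_sub_linear_le hd hl b w)

theorem abs_gconv_sub_gconv_le {g g₁ : ℝ → ℝ} {K : ℝ} (hg : ExpBdd g)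
    (hd : ∀ z, HasDerivAt g (g₁ z) z) (hl : ∀ x y, |g₁ x - g₁ y| ≤ K * |x - y|) (θ θ' : ℝ≥0)
    (b : ℝ) : |gconv θ g b - gconv θ' g b| ≤ K * |(θ : ℝ) - θ'| := by
  have hc : Continuous g := continuous_iff_continuousAt.2 fun z => (hd z).continuousAt
  wlog h : θ' ≤ θ generalizing θ θ'
  · rw [abs_sub_comm, abs_sub_comm (θ : ℝ)]
    exact this θ' θ (le_of_not_ge h)
  have hsm : ∀ z, |gconv (θ - θ') g z - g z| ≤ K * (θ - θ' : ℝ≥0) := fun z =>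
    abs_gconv_sub_le hg hd hl _ z
  rw [← add_tsub_cancel_of_le h, ← gconv_gconv hg hc.measurable]
  have i1 := (hg.gconv (θ - θ')).integrable_add
    (continuous_gconv hg hc (θ - θ')).measurable b 0 θ'
  have i2 := hg.integrable_add hc.measurable b 0 θ'
  rw [gconv, gconv, ← integral_sub i1 i2, ← Real.norm_eq_abs]
  have := norm_integral_le_of_norm_le_const (μ := gaussianReal 0 θ')
    (f := fun w => gconv (θ - θ') g (b + w) - g (b + w)) (C := K * (θ - θ' : ℝ≥0))
    (ae_of_all _ fun w => hsm (b + w))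
  rw [probReal_univ, mul_one] at this
  refine this.trans_eq ?_
  push_cast
  rw [NNReal.coe_sub h, add_sub_cancel_left, abs_of_nonneg (by simpa using h)]

/-- Bounded functions with two bounded derivatives, the second being Lipschitz. -/
structure SmoothBdd (f f₁ f₂ : ℝ → ℝ) (K : ℝ) : Prop where
  hasDerivAt : ∀ z, HasDerivAt f (f₁ z) z
  hasDerivAt₁ : ∀ z, HasDerivAt f₁ (f₂ z) z
  bdd : ∀ z, |f z| ≤ K
  bdd₁ : ∀ z, |f₁ z| ≤ K
  bdd₂ : ∀ z, |f₂ z| ≤ K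
  lip : ∀ x y, |f₂ x - f₂ y| ≤ K * |x - y|

namespace SmoothBdd

variable {f f₁ f₂ : ℝ → ℝ} {K : ℝ}

theorem nonneg (S : SmoothBdd f f₁ f₂ K) : 0 ≤ K := (abs_nonneg _).trans (S.bdd 0)

theorem continuous (S : SmoothBdd f f₁ f₂ K) : Continuous f :=
  continuous_iff_continuousAt.2 fun z => (S.hasDerivAt z).continuousAt

theorem continuous₁ (S : SmoothBdd f f₁ f₂ K) : Continuous f₁ :=
  continuous_iff_continuousAt.2 fun z => (S.hasDerivAt₁ z).continuousAt

theorem continuous₂ (S : SmoothBdd f f₁ f₂ K) : Continuous f₂ :=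
  (LipschitzWith.of_dist_le_mul (K := ⟨K, S.nonneg⟩) fun x y => S.lip x y).continuous

theorem lip_of_bdd {g g₁ : ℝ → ℝ} (hd : ∀ z, HasDerivAt g (g₁ z) z) (hb : ∀ z, |g₁ z| ≤ K)
    (x y : ℝ) : |g x - g y| ≤ K * |x - y| :=
  convex_univ.norm_image_sub_le_of_norm_hasDerivWithin_le
    (fun z _ => (hd z).hasDerivWithinAt) (fun z _ => hb z) (mem_univ y) (mem_univ x)

theorem lip₀ (S : SmoothBdd f f₁ f₂ K) (x y : ℝ) : |f x - f y| ≤ K * |x - y| :=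
  lip_of_bdd S.hasDerivAt S.bdd₁ x y

theorem lip₁ (S : SmoothBdd f f₁ f₂ K) (x y : ℝ) : |f₁ x - f₁ y| ≤ K * |x - y| :=
  lip_of_bdd S.hasDerivAt₁ S.bdd₂ x y

theorem abs_gconv_le_of_bdd {g : ℝ → ℝ} (hb : ∀ z, |g z| ≤ K) (θ : ℝ≥0) (z : ℝ) :
    |Merton.gconv θ g z| ≤ K := by
  have := norm_integral_le_of_norm_le_const (μ := gaussianReal 0 θ) (f := fun w => g (z + w))
    (ae_of_all _ fun w => hb (z + w))
  simpa [Merton.gconv] using this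

protected theorem gconv (S : SmoothBdd f f₁ f₂ K) (θ : ℝ≥0) :
    SmoothBdd (gconv θ f) (gconv θ f₁) (gconv θ f₂) K where
  hasDerivAt := hasDerivAt_gconv (ExpBdd.of_bounded S.bdd) (ExpBdd.of_bounded S.bdd₁)
    S.hasDerivAt S.continuous₁.measurable θ
  hasDerivAt₁ := hasDerivAt_gconv (ExpBdd.of_bounded S.bdd₁) (ExpBdd.of_bounded S.bdd₂)
    S.hasDerivAt₁ S.continuous₂.measurable θ
  bdd := abs_gconv_le_of_bdd S.bdd θ
  bdd₁ := abs_gconv_le_of_bdd S.bdd₁ θ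
  bdd₂ := abs_gconv_le_of_bdd S.bdd₂ θ
  lip x y := by
    have hi := fun z => (ExpBdd.of_bounded S.bdd₂).integrable_add S.continuous₂.measurable z 0 θ
    rw [Merton.gconv, Merton.gconv, ← integral_sub (hi x) (hi y)]
    have := norm_integral_le_of_norm_le_const (μ := gaussianReal 0 θ)
      (f := fun w => f₂ (x + w) - f₂ (y + w)) (C := K * |x - y|)
      (ae_of_all _ fun w => by simpa using S.lip (x + w) (y + w))
    simpa using this

/-- The values of a smooth payoff depend continuously on variance and state. -/
theorem abs_gconv_sub_le (S : SmoothBdd f f₁ f₂ K) (θ θ' : ℝ≥0) (b b' : ℝ) :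
    |Merton.gconv θ f b - Merton.gconv θ' f b'| ≤ K * |(θ : ℝ) - θ'| + K * |b - b'| := by
  have h1 := abs_gconv_sub_gconv_le (ExpBdd.of_bounded S.bdd) S.hasDerivAt S.lip₁ θ θ' b
  have h2 := (S.gconv θ').lip₀ b b'
  exact (abs_sub_le _ (Merton.gconv θ' f b) _).trans (add_le_add h1 h2)

theorem abs_gconv_sub_le₁ (S : SmoothBdd f f₁ f₂ K) (θ θ' : ℝ≥0) (b b' : ℝ) :
    |Merton.gconv θ f₁ b - Merton.gconv θ' f₁ b'| ≤ K * |(θ : ℝ) - θ'| + K * |b - b'| := by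
  have h1 := abs_gconv_sub_gconv_le (ExpBdd.of_bounded S.bdd₁) S.hasDerivAt₁ S.lip θ θ' b
  have h2 := (S.gconv θ').lip₁ b b'
  exact (abs_sub_le _ (Merton.gconv θ' f₁ b) _).trans (add_le_add h1 h2)

theorem continuous_of_abs_sub_le {F : ℝ≥0 → ℝ → ℝ} (hK : 0 ≤ K)
    (h : ∀ θ θ' b b', |F θ b - F θ' b'| ≤ K * |((θ : ℝ≥0) : ℝ) - θ'| + K * |b - b'|) :
    Continuous (fun x : ℝ≥0 × ℝ => F x.1 x.2) := by
  refine (LipschitzWith.of_dist_le_mul (K := ⟨K + K, by positivity⟩) fun x y => ?_).continuous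
  refine (h _ _ _ _).trans ?_
  have h1 : |(x.1 : ℝ) - y.1| ≤ dist x y := le_max_left _ _
  have h2 : |x.2 - y.2| ≤ dist x y := le_max_right _ _
  change _ ≤ (K + K) * dist x y
  nlinarith

theorem continuous_gconv (S : SmoothBdd f f₁ f₂ K) :
    Continuous (fun x : ℝ≥0 × ℝ => Merton.gconv x.1 f x.2) :=
  continuous_of_abs_sub_le S.nonneg S.abs_gconv_sub_le

theorem continuous_gconv₁ (S : SmoothBdd f f₁ f₂ K) :
    Continuous (fun x : ℝ≥0 × ℝ => Merton.gconv x.1 f₁ x.2) :=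
  continuous_of_abs_sub_le S.nonneg S.abs_gconv_sub_le₁

theorem abs_gconv_sub_quadratic_le (S : SmoothBdd f f₁ f₂ K) (η : ℝ≥0) (b : ℝ) :
    |Merton.gconv η f b - f b - f₂ b / 2 * η| ≤ K * (√(η : ℝ) ^ 3 * thirdMoment) := by
  have i1 := (ExpBdd.of_bounded S.bdd).integrable_add S.continuous.measurable b 0 η
  have i2 : Integrable (fun w => f₁ b * w) (gaussianReal 0 η) :=
    (expBdd_id.integrable measurable_id 0 η).const_mul _
  have i4 : Integrable (fun w => f₂ b / 2 * w ^ 2) (gaussianReal 0 η) :=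
    ((expBdd_id.pow 2).integrable (by fun_prop) 0 η).const_mul _
  have i3 : Integrable (fun w => f (b + w) - f b) (gaussianReal 0 η) := i1.sub (integrable_const _)
  have e : Merton.gconv η f b - f b - f₂ b / 2 * η
      = ∫ w, (f (b + w) - f b - f₁ b * w - f₂ b / 2 * w ^ 2) ∂gaussianReal 0 η := by
    have i5 : Integrable (fun w => f (b + w) - f b - f₁ b * w) (gaussianReal 0 η) := i3.sub i2
    rw [integral_sub i5 i4, integral_sub i3 i2, integral_sub i1 (integrable_const _),
      integral_const_mul, integral_const_mul, integral_id_gaussianReal, integral_sq_gaussianReal]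
    simp [Merton.gconv]
  rw [e, ← Real.norm_eq_abs, ← integral_abs_pow_three_gaussianReal η, ← integral_const_mul]
  exact norm_integral_le_of_norm_le
    (((expBdd_abs.pow 3).integrable (by fun_prop) 0 η).const_mul K)
    (ae_of_all _ fun w => abs_sub_quadratic_le S.hasDerivAt S.hasDerivAt₁ S.lip b w)

/-- One step of the Ito formula, for a step of variance `η` and drift `η`. -/
theorem abs_ito_step_le (S : SmoothBdd f f₁ f₂ K) {η : ℝ≥0} {L : ℝ} (hL : √(η : ℝ) ≤ L)
    (b n : ℝ) :
    |f (b - (√(η : ℝ) * n + η)) - Merton.gconv η f b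
        - Merton.gconv η f₁ b * -(√(η : ℝ) * n + η) - f₂ b / 2 * ((√(η : ℝ) * n) ^ 2 - η)|
      ≤ K * √(η : ℝ) ^ 3 * ((|n| + L) ^ 3 + thirdMoment + 2 * (|n| + L)) := by
  set s := √(η : ℝ) with hs
  have hs0 : 0 ≤ s := Real.sqrt_nonneg _
  have hη : (η : ℝ) = s ^ 2 := (Real.sq_sqrt η.2).symm
  have hK := S.nonneg
  set d := -(s * n + η) with hd
  have h1 := abs_sub_quadratic_le S.hasDerivAt S.hasDerivAt₁ S.lip b d
  have h2 := S.abs_gconv_sub_quadratic_le η b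
  have h3 := Merton.abs_gconv_sub_le (ExpBdd.of_bounded S.bdd₁) S.hasDerivAt₁ S.lip η b
  have hdabs : |d| ≤ s * (|n| + L) := by
    rw [hd, abs_neg]
    refine (abs_add_le _ _).trans ?_
    rw [abs_mul, abs_of_nonneg hs0, abs_of_nonneg η.coe_nonneg, hη]
    nlinarith
  have hn0 : 0 ≤ |n| + L := add_nonneg (abs_nonneg n) (hs0.trans hL)
  -- Four errors, each of order `s³ = η ^ (3 / 2)`: the Taylor remainder in `d`, the second order
  -- expansion of the heat flow, the replacement of `f₁` by its convolution, and the part of `d²`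
  -- that involves the drift.
  have e : f (b - (s * n + η)) - Merton.gconv η f b - Merton.gconv η f₁ b * d
      - f₂ b / 2 * ((s * n) ^ 2 - η)
      = (f (b + d) - f b - f₁ b * d - f₂ b / 2 * d ^ 2)
        - (Merton.gconv η f b - f b - f₂ b / 2 * η) - (Merton.gconv η f₁ b - f₁ b) * d
        + f₂ b / 2 * (2 * (s * n) * η + η ^ 2) := by
    rw [hd, sub_eq_add_neg b]; ring
  rw [e]
  have h4 : |(Merton.gconv η f₁ b - f₁ b) * d| ≤ K * s ^ 3 * (|n| + L) := by
    rw [abs_mul]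
    calc |Merton.gconv η f₁ b - f₁ b| * |d| ≤ (K * η) * (s * (|n| + L)) :=
          mul_le_mul h3 hdabs (abs_nonneg _) (by positivity)
      _ = _ := by rw [hη]; ring
  have h5 : |f₂ b / 2 * (2 * (s * n) * η + η ^ 2)| ≤ K * s ^ 3 * (|n| + L) := by
    rw [abs_mul, abs_div, abs_two]
    have h6 : |2 * (s * n) * η + (η : ℝ) ^ 2| ≤ 2 * (s ^ 3 * (|n| + L)) := by
      refine (abs_add_le _ _).trans ?_
      rw [abs_mul, abs_mul, abs_mul, abs_two, abs_of_nonneg hs0, abs_of_nonneg η.coe_nonneg,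
        abs_of_nonneg (sq_nonneg (η : ℝ)), hη]
      have : s ^ 3 * s ≤ s ^ 3 * L := mul_le_mul_of_nonneg_left hL (by positivity)
      have : 0 ≤ s ^ 3 * L := this.trans' (by positivity)
      nlinarith
    calc |f₂ b| / 2 * |2 * (s * n) * η + (η : ℝ) ^ 2| ≤ K / 2 * (2 * (s ^ 3 * (|n| + L))) :=
          mul_le_mul (by linarith [S.bdd₂ b]) h6 (abs_nonneg _) (by positivity)
      _ = _ := by ring
  have h7 : |f (b + d) - f b - f₁ b * d - f₂ b / 2 * d ^ 2| ≤ K * s ^ 3 * (|n| + L) ^ 3 := by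
    refine h1.trans ?_
    rw [mul_assoc, ← mul_pow]
    exact mul_le_mul_of_nonneg_left (pow_le_pow_left₀ (abs_nonneg _) hdabs 3) hK
  refine (abs_add_le _ _).trans ((add_le_add ((abs_sub _ _).trans (add_le_add ((abs_sub _ _).trans
    (add_le_add h7 h2)) h4)) h5).trans_eq ?_)
  ring

end SmoothBdd

end Merton

namespace Merton

/-! ### The log-state-price and the value of a payoff -/

section ItoFormula

variable {N : ℕ} {Ω : Type*}

/-- The logarithm `ζ - λ ⬝ (W u - W t) - |λ|² (u - t)` of the state price, up to the factor which
makes the price `E[f]` of a payoff a function of it. -/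
noncomputable def logState (W : ℝ≥0 → Ω → Fin N → ℝ) (c : Fin N → ℝ) (t : ℝ≥0) (ζ : ℝ) (u : ℝ≥0)
    (ω : Ω) : ℝ :=
  ζ - c ⬝ᵥ (W u ω - W t ω) - (normSq c).toNNReal * ((u : ℝ) - t)

/-- The value at time `u` of the payoff `g (logState T)`. -/
noncomputable def payoffValue (W : ℝ≥0 → Ω → Fin N → ℝ) (c : Fin N → ℝ) (t T : ℝ≥0) (ζ : ℝ)
    (g : ℝ → ℝ) (u : ℝ≥0) (ω : Ω) : ℝ :=
  gconv ((normSq c).toNNReal * (T - u)) g (logState W c t ζ u ω)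

variable {W : ℝ≥0 → Ω → Fin N → ℝ} {c : Fin N → ℝ} {t T : ℝ≥0} {ζ : ℝ}

theorem logState_sub (a b : ℝ≥0) (ω : Ω) :
    logState W c t ζ b ω - logState W c t ζ a ω
      = -(c ⬝ᵥ (W b ω - W a ω) + (normSq c).toNNReal * ((b : ℝ) - a)) := by
  have e : W b ω - W t ω = (W b ω - W a ω) + (W a ω - W t ω) := by abel
  rw [logState, logState, e, dotProduct_add]
  ring

theorem logState_self (ω : Ω) : logState W c t ζ t ω = ζ := by simp [logState]

theorem measurable_logState {a : ℝ≥0} (hta : t ≤ a) :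
    Measurable[pastSigma W a] (logState W c t ζ a) :=
  (((measurable_dotProduct c).comp
    ((measurable_pastSigma le_rfl).sub (measurable_pastSigma hta))).const_sub ζ).sub_const _

theorem measurable_payoffValue {g : ℝ → ℝ} (hg : ExpBdd g) (hc : Continuous g) {a : ℝ≥0}
    (hta : t ≤ a) : Measurable[pastSigma W a] (payoffValue W c t T ζ g a) :=
  (Merton.continuous_gconv hg hc _).measurable.comp (measurable_logState hta)

/-- The error of the Ito formula for the value of a payoff over the time step from `a` to `b`. -/
noncomputable def itoError (W : ℝ≥0 → Ω → Fin N → ℝ) (c : Fin N → ℝ) (t T : ℝ≥0) (ζ : ℝ)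
    (f f₁ : ℝ → ℝ) (a b : ℝ≥0) (ω : Ω) : ℝ :=
  payoffValue W c t T ζ f b ω - payoffValue W c t T ζ f a ω
    - payoffValue W c t T ζ f₁ a ω * (logState W c t ζ b ω - logState W c t ζ a ω)

/-- The martingale part of the error of the Ito formula. -/
noncomputable def itoMain (W : ℝ≥0 → Ω → Fin N → ℝ) (c : Fin N → ℝ) (t T : ℝ≥0) (ζ : ℝ)
    (f₂ : ℝ → ℝ) (a b : ℝ≥0) (ω : Ω) : ℝ :=
  gconv ((normSq c).toNNReal * (T - b)) f₂ (logState W c t ζ a ω) / 2 *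
    ((c ⬝ᵥ (W b ω - W a ω)) ^ 2 - ((normSq c).toNNReal * (b - a) : ℝ≥0))

/-- The constant in the remainder of the Ito formula. -/
noncomputable def remainderPoly (L n : ℝ) : ℝ := (|n| + L) ^ 3 + thirdMoment + 2 * (|n| + L)

theorem expBdd_remainderPoly (L : ℝ) : ExpBdd (fun n => remainderPoly L n ^ 2) := by
  have h1 : ExpBdd (fun n : ℝ => |n| + L) :=
    expBdd_abs.add (ExpBdd.of_bounded (F := fun _ => L) (K := |L|) fun _ => le_rfl)
  exact (((h1.pow 3).add (ExpBdd.of_bounded (F := fun _ => thirdMoment) (K := |thirdMoment|)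
    fun _ => le_rfl)).add (h1.const_mul 2)).pow 2

theorem measurable_remainderPoly (L : ℝ) : Measurable (remainderPoly L) := by
  unfold remainderPoly; fun_prop

variable {f f₁ f₂ : ℝ → ℝ} {K : ℝ}

/-- The one-step estimate is applied to the value function at time `b`. By the semigroup law,
convolving it with the variance of the step gives the value function at time `a`. The variable `n`
is the increment in standard units. -/
theorem SmoothBdd.abs_itoError_sub_le (S : SmoothBdd f f₁ f₂ K) {a b : ℝ≥0}
    (hab : a ≤ b) (hbT : b ≤ T) {L : ℝ} (hL : √(((normSq c).toNNReal * (b - a) : ℝ≥0) : ℝ) ≤ L)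
    {n : ℝ} {ω : Ω}
    (hn : c ⬝ᵥ (W b ω - W a ω) = √(((normSq c).toNNReal * (b - a) : ℝ≥0) : ℝ) * n) :
    |itoError W c t T ζ f f₁ a b ω - itoMain W c t T ζ f₂ a b ω|
      ≤ K * √(((normSq c).toNNReal * (b - a) : ℝ≥0) : ℝ) ^ 3 * remainderPoly L n := by
  have h := (S.gconv ((normSq c).toNNReal * (T - b))).abs_ito_step_le hL (logState W c t ζ a ω) n
  have e : (normSq c).toNNReal * (b - a) + (normSq c).toNNReal * (T - b)
      = (normSq c).toNNReal * (T - a) := by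
    rw [← mul_add, add_comm, tsub_add_tsub_cancel hbT hab]
  rw [gconv_gconv (ExpBdd.of_bounded S.bdd) S.continuous.measurable,
    gconv_gconv (ExpBdd.of_bounded S.bdd₁) S.continuous₁.measurable, e, ← hn] at h
  have e2 : (((normSq c).toNNReal * (b - a) : ℝ≥0) : ℝ) = (normSq c).toNNReal * ((b : ℝ) - a) := by
    rw [NNReal.coe_mul, NNReal.coe_sub hab]
  have e3 : logState W c t ζ a ω - (c ⬝ᵥ (W b ω - W a ω) + ((normSq c).toNNReal * (b - a) : ℝ≥0))
      = logState W c t ζ b ω := by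
    rw [e2]; linarith [logState_sub (W := W) (c := c) (t := t) (ζ := ζ) a b ω]
  rw [e3] at h
  rw [itoError, itoMain, logState_sub, payoffValue, payoffValue, payoffValue, ← e2]
  exact h

theorem measurable_itoMain (S : SmoothBdd f f₁ f₂ K) {a b : ℝ≥0} (hta : t ≤ a) (hab : a ≤ b) :
    Measurable[pastSigma W b] (itoMain W c t T ζ f₂ a b) := by
  have h1 := (Merton.continuous_gconv (ExpBdd.of_bounded S.bdd₂) S.continuous₂
    ((normSq c).toNNReal * (T - b))).measurable.comp
      ((measurable_logState (W := W) (c := c) (ζ := ζ) hta).mono (pastSigma_mono hab) le_rfl)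
  have h2 := (measurable_dotProduct c).comp
    ((measurable_pastSigma (W := W) le_rfl).sub (measurable_pastSigma hab))
  exact (h1.div_const 2).mul ((h2.pow_const 2).sub_const _)

variable [mΩ : MeasurableSpace Ω] {P : Measure Ω} [IsProbabilityMeasure P]

theorem memLp_mul_incr (hW : IsStandardBrownian W P) {a b : ℝ≥0} (hab : a ≤ b) {Y : Ω → ℝ}
    (hY : Measurable Y) (hK : ∀ ω, |Y ω| ≤ K) {g : ℝ → ℝ} (hg : ExpBdd g) (hgm : Measurable g)
    (c : Fin N → ℝ) : MemLp (fun ω => Y ω * g (c ⬝ᵥ (W b ω - W a ω))) 2 P := by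
  have h1 := hg.memLp_comp (hasLaw_dotProduct_incr hW hab c) hgm
  refine h1.of_le_mul (c := K) (hY.aestronglyMeasurable.mul h1.aestronglyMeasurable)
    (ae_of_all _ fun ω => ?_)
  rw [norm_mul]
  exact mul_le_mul_of_nonneg_right (hK ω) (norm_nonneg _)

theorem memLp_itoError (hW : IsStandardBrownian W P) (S : SmoothBdd f f₁ f₂ K) {a b : ℝ≥0}
    (hta : t ≤ a) (hab : a ≤ b) : MemLp (itoError W c t T ζ f f₁ a b) 2 P := by
  have hm : ∀ {u g}, t ≤ u → ExpBdd g → Continuous g → Measurable (payoffValue W c t T ζ g u) :=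
    fun hu hg hc => (measurable_payoffValue hg hc hu).mono (pastSigma_le hW _) le_rfl
  have hf := ExpBdd.of_bounded S.bdd
  have hf₁ := ExpBdd.of_bounded S.bdd₁
  have h0 : ∀ u, t ≤ u → MemLp (payoffValue W c t T ζ f u) 2 P := fun u hu =>
    MemLp.of_bound (hm hu hf S.continuous).aestronglyMeasurable K
      (ae_of_all _ fun ω => (S.gconv _).bdd _)
  have h1 := memLp_mul_incr hW hab (hm hta hf₁ S.continuous₁) (fun ω => (S.gconv _).bdd₁ _)
    (g := fun y => -(y + (normSq c).toNNReal * ((b : ℝ) - a)))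
    (expBdd_id.add (ExpBdd.of_bounded (F := fun _ => _) fun _ => le_rfl)).neg (by fun_prop) c
  refine (((h0 b (hta.trans hab)).sub (h0 a hta)).sub h1).ae_eq (ae_of_all _ fun ω => ?_)
  simp only [Pi.sub_apply]
  rw [itoError, logState_sub]

theorem memLp_itoMain (hW : IsStandardBrownian W P) (S : SmoothBdd f f₁ f₂ K) {a b : ℝ≥0}
    (hta : t ≤ a) (hab : a ≤ b) : MemLp (itoMain W c t T ζ f₂ a b) 2 P := by
  have hm : Measurable (fun ω => gconv ((normSq c).toNNReal * (T - b)) f₂ (logState W c t ζ a ω) / 2) :=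
    (((Merton.continuous_gconv (ExpBdd.of_bounded S.bdd₂) S.continuous₂ _).measurable.comp
      (measurable_logState hta)).mono (pastSigma_le hW a) le_rfl).div_const 2
  refine memLp_mul_incr (K := K / 2) hW hab hm (fun ω => ?_)
    (g := fun y => y ^ 2 - ((normSq c).toNNReal * (b - a) : ℝ≥0)) ?_ (by fun_prop) c
  · rw [abs_div, abs_two]
    exact div_le_div_of_nonneg_right ((S.gconv _).bdd₂ _) zero_le_two
  · exact (expBdd_id.pow 2).add (ExpBdd.of_bounded (F := fun _ => _) fun _ => le_rfl)

/-- Pathwise the remainder is `K η ^ (3 / 2)` times a polynomial in `|n|`, where `n` is a standard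
normal variable, hence of order `δ³` in mean square. The bound `L` depends on `δ` only, so the
moment is the same for all steps. -/
theorem integral_itoError_sub_sq_le (hW : IsStandardBrownian W P) (S : SmoothBdd f f₁ f₂ K)
    {a b : ℝ≥0} (hta : t ≤ a) (hab : a ≤ b) (hbT : b ≤ T) {δ : ℝ}
    (hδ : (((normSq c).toNNReal * (b - a) : ℝ≥0) : ℝ) ≤ δ) {L : ℝ} (hL : √δ ≤ L) :
    ∫ ω, (itoError W c t T ζ f f₁ a b ω - itoMain W c t T ζ f₂ a b ω) ^ 2 ∂P
      ≤ K ^ 2 * δ ^ 3 * ∫ n, remainderPoly L n ^ 2 ∂gaussianReal 0 1 := by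
  set η := (normSq c).toNNReal * (b - a) with hη
  have hlaw := hasLaw_dotProduct_incr hW hab c
  rw [← hη] at hlaw
  have hLη : √(η : ℝ) ≤ L := (Real.sqrt_le_sqrt hδ).trans hL
  have hQ0 : 0 ≤ ∫ n, remainderPoly L n ^ 2 ∂gaussianReal 0 1 := integral_nonneg fun _ => sq_nonneg _
  have hδ0 : 0 ≤ δ := η.coe_nonneg.trans hδ
  have hη3 : K ^ 2 * (η : ℝ) ^ 3 ≤ K ^ 2 * δ ^ 3 :=
    mul_le_mul_of_nonneg_left (pow_le_pow_left₀ η.coe_nonneg hδ 3) (sq_nonneg K)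
  have hs2 : (√(η : ℝ) ^ 3) ^ 2 = (η : ℝ) ^ 3 := by
    rw [← pow_mul, mul_comm, pow_mul, Real.sq_sqrt η.coe_nonneg]
  -- With zero variance the increment cannot be normalised, but it vanishes almost surely and the
  -- remainder with it.
  by_cases h0 : η = 0
  · have hae : ∀ᵐ ω ∂P, c ⬝ᵥ (W b ω - W a ω) = 0 := by
      have h1 : ∀ᵐ y ∂(P.map fun ω => c ⬝ᵥ (W b ω - W a ω)), y = 0 := by
        rw [hlaw.map_eq, h0, gaussianReal_zero_var]
        exact (ae_dirac_iff (measurableSet_singleton (0 : ℝ))).2 rfl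
      exact ae_of_ae_map hlaw.aemeasurable h1
    have hz : ∫ ω, (itoError W c t T ζ f f₁ a b ω - itoMain W c t T ζ f₂ a b ω) ^ 2 ∂P = 0 := by
      rw [integral_congr_ae (g := fun _ => (0 : ℝ)), integral_zero]
      filter_upwards [hae] with ω hω
      have := S.abs_itoError_sub_le (t := t) (ζ := ζ) hab hbT (n := 0) hLη
        (hω.trans (mul_zero _).symm)
      rw [← hη, h0, NNReal.coe_zero, Real.sqrt_zero] at this
      have h2 : itoError W c t T ζ f f₁ a b ω - itoMain W c t T ζ f₂ a b ω = 0 := by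
        simpa using this
      rw [h2]; simp
    rw [hz]
    exact mul_nonneg (mul_nonneg (sq_nonneg _) (pow_nonneg hδ0 3)) hQ0
  · have hs : 0 < √(η : ℝ) := Real.sqrt_pos.2 (by exact_mod_cast pos_iff_ne_zero.2 h0)
    set g : ℝ → ℝ := fun y => K ^ 2 * (η : ℝ) ^ 3 * remainderPoly L (y / √(η : ℝ)) ^ 2
    have hgm : Measurable g :=
      (((measurable_remainderPoly L).comp (measurable_id.div_const _)).pow_const 2).const_mul _
    have hint : ∫ y, g y ∂gaussianReal 0 η
        = K ^ 2 * (η : ℝ) ^ 3 * ∫ n, remainderPoly L n ^ 2 ∂gaussianReal 0 1 := by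
      rw [integral_gaussianReal_scale, ← integral_const_mul]
      simp only [g, mul_div_cancel_left₀ _ hs.ne']
    have hgi : Integrable (fun ω => g (c ⬝ᵥ (W b ω - W a ω))) P := by
      have h1 := (expBdd_remainderPoly L).integrable ((measurable_remainderPoly L).pow_const 2) 0 1
      have h2 : Integrable g (gaussianReal 0 η) := by
        have h := gaussianReal_map_const_mul (μ := 0) (v := 1) (√(η : ℝ))
        have e : (⟨√(η : ℝ) ^ 2, sq_nonneg _⟩ : ℝ≥0) * 1 = η := by ext; simp
        rw [mul_zero] at h
        rw [show (gaussianReal 0 η) = (gaussianReal 0 1).map (fun n => √(η : ℝ) * n) by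
          rw [h]; congr 1; exact e.symm, (measurableEmbedding_mulLeft₀ hs.ne').integrable_map_iff]
        refine (h1.const_mul (K ^ 2 * (η : ℝ) ^ 3)).congr (ae_of_all _ fun n => ?_)
        simp only [g, Function.comp_def, mul_div_cancel_left₀ _ hs.ne']
      rw [← hlaw.map_eq] at h2
      exact h2.comp_aemeasurable hlaw.aemeasurable
    have hle : ∀ ω, (itoError W c t T ζ f f₁ a b ω - itoMain W c t T ζ f₂ a b ω) ^ 2
        ≤ g (c ⬝ᵥ (W b ω - W a ω)) := fun ω => by
      have h1 := S.abs_itoError_sub_le (t := t) (ζ := ζ) (W := W) (ω := ω) hab hbT hLη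
        (n := c ⬝ᵥ (W b ω - W a ω) / √(η : ℝ)) (by rw [mul_div_cancel₀ _ hs.ne'])
      have h2 := pow_le_pow_left₀ (abs_nonneg _) h1 2
      rw [sq_abs, mul_pow, mul_pow, hs2] at h2
      exact h2
    calc _ ≤ ∫ ω, g (c ⬝ᵥ (W b ω - W a ω)) ∂P :=
          integral_mono ((memLp_itoError hW S hta hab).sub (memLp_itoMain hW S hta hab)).integrable_sq
            hgi hle
      _ = ∫ y, g y ∂gaussianReal 0 η := hlaw.integral_comp (f := g) hgm.aestronglyMeasurable
      _ ≤ _ := by rw [hint]; exact mul_le_mul_of_nonneg_right hη3 hQ0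

end ItoFormula

end Merton

namespace Merton

/-! ### Summing the Ito errors over a grid -/

section ItoSum

variable {N : ℕ} {Ω : Type*} [mΩ : MeasurableSpace Ω] {P : Measure Ω} [IsProbabilityMeasure P]
  {W : ℝ≥0 → Ω → Fin N → ℝ} {c : Fin N → ℝ} {t T : ℝ≥0} {ζ : ℝ} {f f₁ f₂ : ℝ → ℝ} {K : ℝ}

/-- The variance of the square of a standard Gaussian variable. -/
noncomputable def squareVariance : ℝ := ∫ n, (n ^ 2 - 1) ^ 2 ∂gaussianReal 0 1

theorem squareVariance_nonneg : 0 ≤ squareVariance := integral_nonneg fun _ => sq_nonneg _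

theorem integral_sq_sub_sq_gaussianReal (η : ℝ≥0) :
    ∫ w, (w ^ 2 - (η : ℝ)) ^ 2 ∂gaussianReal 0 η = (η : ℝ) ^ 2 * squareVariance := by
  rw [integral_gaussianReal_scale, squareVariance, ← integral_const_mul]
  refine integral_congr_ae (ae_of_all _ fun n => ?_)
  dsimp only
  rw [mul_pow, Real.sq_sqrt η.coe_nonneg]
  ring

/-- The martingale part of the error is orthogonal to the past. -/
theorem integral_mul_itoMain (hW : IsStandardBrownian W P) (S : SmoothBdd f f₁ f₂ K)
    {a b : ℝ≥0} (hta : t ≤ a) (hab : a ≤ b) {Y : Ω → ℝ} (hY : Measurable[pastSigma W a] Y) :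
    ∫ ω, Y ω * itoMain W c t T ζ f₂ a b ω ∂P = 0 := by
  have hlaw := hasLaw_dotProduct_incr hW hab c
  set η := (normSq c).toNNReal * (b - a) with hη
  have h1 := (((Merton.continuous_gconv (ExpBdd.of_bounded S.bdd₂) S.continuous₂
    ((normSq c).toNNReal * (T - b))).measurable.comp
      (measurable_logState (W := W) (c := c) (ζ := ζ) hta)).div_const 2)
  have h2 := integral_mul_incr hW hab (hY.mul h1)
    (g := fun x => (c ⬝ᵥ x) ^ 2 - (η : ℝ)) (((measurable_dotProduct c).pow_const 2).sub_const _)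
  have h3 : ∫ ω, ((c ⬝ᵥ (W b ω - W a ω)) ^ 2 - (η : ℝ)) ∂P = 0 := by
    have h4 := hlaw.integral_comp (f := fun y => y ^ 2 - (η : ℝ)) (by fun_prop)
    have h5 : Integrable (fun y : ℝ => y ^ 2) (gaussianReal 0 η) :=
      (expBdd_id.pow 2).integrable (by fun_prop) 0 η
    refine h4.trans ?_
    rw [integral_sub h5 (integrable_const _), integral_sq_gaussianReal]
    simp
  rw [h3, mul_zero] at h2
  rw [← h2]
  refine integral_congr_ae (ae_of_all _ fun ω => ?_)
  simp only [itoMain, Pi.mul_apply, Function.comp_apply, ← hη]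
  ring

theorem integral_itoMain_sq_le (hW : IsStandardBrownian W P) (S : SmoothBdd f f₁ f₂ K)
    {a b : ℝ≥0} (hta : t ≤ a) (hab : a ≤ b) {δ : ℝ}
    (hδ : (((normSq c).toNNReal * (b - a) : ℝ≥0) : ℝ) ≤ δ) :
    ∫ ω, itoMain W c t T ζ f₂ a b ω ^ 2 ∂P ≤ K ^ 2 * δ ^ 2 * squareVariance := by
  have hlaw := hasLaw_dotProduct_incr hW hab c
  set η := (normSq c).toNNReal * (b - a) with hη
  have hg : ExpBdd (fun y : ℝ => (y ^ 2 - (η : ℝ)) ^ 2) :=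
    ((expBdd_id.pow 2).add (ExpBdd.of_bounded (F := fun _ => -(η : ℝ)) fun _ => le_rfl)).pow 2
  have hgi := (hg.integrable_comp hlaw (by fun_prop)).const_mul (K ^ 2)
  have h4 := hlaw.integral_comp (f := fun y => (y ^ 2 - (η : ℝ)) ^ 2) (by fun_prop)
  calc _ ≤ ∫ ω, K ^ 2 * ((c ⬝ᵥ (W b ω - W a ω)) ^ 2 - (η : ℝ)) ^ 2 ∂P := by
        refine integral_mono (memLp_itoMain hW S hta hab).integrable_sq hgi fun ω => ?_
        dsimp only
        rw [itoMain, ← hη, mul_pow]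
        refine mul_le_mul_of_nonneg_right ?_ (sq_nonneg _)
        rw [← sq_abs]
        refine pow_le_pow_left₀ (abs_nonneg _) ?_ 2
        rw [abs_div, abs_two]
        linarith [(S.gconv ((normSq c).toNNReal * (T - b))).bdd₂ (logState W c t ζ a ω), S.nonneg]
    _ = K ^ 2 * ((η : ℝ) ^ 2 * squareVariance) := by
        rw [integral_const_mul, ← integral_sq_sub_sq_gaussianReal]
        exact congrArg _ h4
    _ ≤ _ := by
        rw [mul_assoc]
        exact mul_le_mul_of_nonneg_left (mul_le_mul_of_nonneg_right
          (pow_le_pow_left₀ η.coe_nonneg hδ 2) squareVariance_nonneg) (sq_nonneg K)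

/-- Each term is orthogonal to whatever is known before its step, so the mean squares add up: the
total is of order `n δ²` instead of `n² δ²`. Measurability of the partial sums is carried along to
apply this orthogonality. -/
theorem integral_sum_itoMain_sq_le (hW : IsStandardBrownian W P) (S : SmoothBdd f f₁ f₂ K)
    {u : ℕ → ℝ≥0} (hu : Monotone u) (htu : t ≤ u 0) {δ : ℝ}
    (hδ : ∀ k, (((normSq c).toNNReal * (u (k + 1) - u k) : ℝ≥0) : ℝ) ≤ δ) (n : ℕ) :
    Measurable[pastSigma W (u n)] (fun ω => ∑ k ∈ Finset.range n,
        itoMain W c t T ζ f₂ (u k) (u (k + 1)) ω) ∧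
      MemLp (fun ω => ∑ k ∈ Finset.range n, itoMain W c t T ζ f₂ (u k) (u (k + 1)) ω) 2 P ∧
      ∫ ω, (∑ k ∈ Finset.range n, itoMain W c t T ζ f₂ (u k) (u (k + 1)) ω) ^ 2 ∂P
        ≤ n * (K ^ 2 * δ ^ 2 * squareVariance) := by
  induction n with
  | zero => simp
  | succ n ih =>
    obtain ⟨hm, hL, hI⟩ := ih
    have hta : t ≤ u n := htu.trans (hu (Nat.zero_le n))
    have hab : u n ≤ u (n + 1) := hu (Nat.le_succ n)
    have h1 := memLp_itoMain (c := c) (T := T) (ζ := ζ) hW S hta hab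
    simp only [Finset.sum_range_succ]
    refine ⟨(hm.mono (pastSigma_mono hab) le_rfl).add (measurable_itoMain S hta hab), hL.add h1, ?_⟩
    have h2 := integral_mul_itoMain (c := c) (T := T) (ζ := ζ) hW S hta hab hm
    have h3 := integral_itoMain_sq_le (T := T) (ζ := ζ) hW S hta hab (hδ n)
    have e : ∀ x y : ℝ, (x + y) ^ 2 = x ^ 2 + 2 * (x * y) + y ^ 2 := fun x y => by ring
    simp only [e]
    have i2 : Integrable (fun ω => 2 * ((∑ k ∈ Finset.range n,
        itoMain W c t T ζ f₂ (u k) (u (k + 1)) ω) * itoMain W c t T ζ f₂ (u n) (u (n + 1)) ω)) P :=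
      (hL.integrable_mul h1).const_mul 2
    have i3 : Integrable (fun ω => (∑ k ∈ Finset.range n,
        itoMain W c t T ζ f₂ (u k) (u (k + 1)) ω) ^ 2 + 2 * ((∑ k ∈ Finset.range n,
        itoMain W c t T ζ f₂ (u k) (u (k + 1)) ω) * itoMain W c t T ζ f₂ (u n) (u (n + 1)) ω)) P :=
      hL.integrable_sq.add i2
    rw [integral_add i3 h1.integrable_sq, integral_add hL.integrable_sq i2, integral_const_mul]
    rw [h2]
    push_cast
    linarith

/-- The errors of the Ito formula over the steps of a fine grid are small in mean square. -/
theorem integral_sum_itoError_sq_le (hW : IsStandardBrownian W P) (S : SmoothBdd f f₁ f₂ K)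
    {u : ℕ → ℝ≥0} (hu : Monotone u) (htu : t ≤ u 0) {n : ℕ} (huT : ∀ k, u k ≤ T) {δ L : ℝ}
    (hδ : ∀ k, (((normSq c).toNNReal * (u (k + 1) - u k) : ℝ≥0) : ℝ) ≤ δ) (hL : √δ ≤ L) :
    ∫ ω, (∑ k ∈ Finset.range n, itoError W c t T ζ f f₁ (u k) (u (k + 1)) ω) ^ 2 ∂P
      ≤ 2 * (n * (K ^ 2 * δ ^ 2 * squareVariance)) +
        2 * (n * (n * (K ^ 2 * δ ^ 3 * ∫ n, remainderPoly L n ^ 2 ∂gaussianReal 0 1))) := by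
  obtain ⟨-, hM, hI⟩ := integral_sum_itoMain_sq_le (c := c) (T := T) (ζ := ζ) hW S hu htu hδ n
  have hta : ∀ k, t ≤ u k := fun k => htu.trans (hu (Nat.zero_le k))
  have hab : ∀ k, u k ≤ u (k + 1) := fun k => hu (Nat.le_succ k)
  set ρ : ℕ → Ω → ℝ := fun k ω =>
    itoError W c t T ζ f f₁ (u k) (u (k + 1)) ω - itoMain W c t T ζ f₂ (u k) (u (k + 1)) ω with hρ
  have hρL : ∀ k, MemLp (ρ k) 2 P := fun k =>
    (memLp_itoError hW S (hta k) (hab k)).sub (memLp_itoMain hW S (hta k) (hab k))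
  have hρi : ∀ k, ∫ ω, ρ k ω ^ 2 ∂P
      ≤ K ^ 2 * δ ^ 3 * ∫ n, remainderPoly L n ^ 2 ∂gaussianReal 0 1 := fun k =>
    integral_itoError_sub_sq_le hW S (hta k) (hab k) (huT _) (hδ k) hL
  have i1 : Integrable (fun ω => ∑ k ∈ Finset.range n, ρ k ω ^ 2) P :=
    integrable_finsetSum _ fun k _ => (hρL k).integrable_sq
  have i2 : Integrable (fun ω => 2 * (∑ k ∈ Finset.range n,
      itoMain W c t T ζ f₂ (u k) (u (k + 1)) ω) ^ 2) P := hM.integrable_sq.const_mul 2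
  have i3 : Integrable (fun ω => 2 * (n * ∑ k ∈ Finset.range n, ρ k ω ^ 2)) P :=
    (i1.const_mul (n : ℝ)).const_mul 2
  have hE : MemLp (fun ω => ∑ k ∈ Finset.range n,
      itoError W c t T ζ f f₁ (u k) (u (k + 1)) ω) 2 P :=
    memLp_finsetSum _ fun k _ => memLp_itoError hW S (hta k) (hab k)
  calc _ ≤ ∫ ω, (2 * (∑ k ∈ Finset.range n, itoMain W c t T ζ f₂ (u k) (u (k + 1)) ω) ^ 2
        + 2 * (n * ∑ k ∈ Finset.range n, ρ k ω ^ 2)) ∂P := by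
        refine integral_mono hE.integrable_sq (i2.add i3) fun ω => ?_
        have h1 : ∑ k ∈ Finset.range n, itoError W c t T ζ f f₁ (u k) (u (k + 1)) ω
            = ∑ k ∈ Finset.range n, itoMain W c t T ζ f₂ (u k) (u (k + 1)) ω
              + ∑ k ∈ Finset.range n, ρ k ω := by
          rw [← Finset.sum_add_distrib]
          exact Finset.sum_congr rfl fun k _ => by simp only [hρ]; ring
        -- The remainders have no orthogonality; the crude factor `n` is affordable because each
        -- mean square is of order `δ³`.
        have h2 := sq_sum_le_card_mul_sum_sq (s := Finset.range n) (f := fun k => ρ k ω)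
        rw [Finset.card_range] at h2
        dsimp only
        rw [h1]
        set x := ∑ k ∈ Finset.range n, itoMain W c t T ζ f₂ (u k) (u (k + 1)) ω
        set y := ∑ k ∈ Finset.range n, ρ k ω
        nlinarith [sq_nonneg (x - y)]
    _ ≤ _ := by
        rw [integral_add i2 i3, integral_const_mul, integral_const_mul, integral_const_mul,
          integral_finsetSum _ fun k _ => (hρL k).integrable_sq]
        have h3 : ∑ k ∈ Finset.range n, ∫ ω, ρ k ω ^ 2 ∂P
            ≤ n * (K ^ 2 * δ ^ 3 * ∫ n, remainderPoly L n ^ 2 ∂gaussianReal 0 1) := by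
          refine (Finset.sum_le_sum fun k _ => hρi k).trans_eq ?_
          rw [Finset.sum_const, Finset.card_range, nsmul_eq_mul]
        have h4 := mul_le_mul_of_nonneg_left h3 (Nat.cast_nonneg (α := ℝ) n)
        linarith

end ItoSum

end Merton

namespace Merton

/-! ### Delta hedging on a regular grid -/

section Hedge

variable {N : ℕ} {Ω : Type*}

/-- The points of the regular grid with `n + 1` steps between `t` and `T`. -/
noncomputable def gridTime (t T : ℝ≥0) (n k : ℕ) : ℝ≥0 := t + k * ((T - t) / (n + 1))

theorem gridTime_zero (t T : ℝ≥0) (n : ℕ) : gridTime t T n 0 = t := by simp [gridTime]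

theorem gridTime_last {t T : ℝ≥0} (h : t ≤ T) (n : ℕ) : gridTime t T n (n + 1) = T := by
  have : ((n : ℝ≥0) + 1) ≠ 0 := by positivity
  rw [gridTime, Nat.cast_add_one, mul_div_cancel₀ _ this, add_tsub_cancel_of_le h]

theorem gridTime_succ (t T : ℝ≥0) (n k : ℕ) :
    gridTime t T n (k + 1) = gridTime t T n k + (T - t) / (n + 1) := by
  rw [gridTime, gridTime, Nat.cast_add_one, add_one_mul, add_assoc]

theorem monotone_gridTime (t T : ℝ≥0) (n : ℕ) : Monotone (gridTime t T n) :=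
  monotone_nat_of_le_succ fun k => by rw [gridTime_succ]; exact le_self_add

theorem le_gridTime (t T : ℝ≥0) (n k : ℕ) : t ≤ gridTime t T n k := le_self_add

theorem exists_gridTime_lt_le {t T s : ℝ≥0} (hts : t < s) (hsT : s ≤ T) (n : ℕ) :
    ∃ k < n + 1, gridTime t T n k < s ∧ s ≤ gridTime t T n (k + 1) := by
  by_contra! H
  have : ∀ k ≤ n + 1, gridTime t T n k < s := by
    intro k
    induction k with
    | zero => intro _; rwa [gridTime_zero]
    | succ k ih => intro hk; exact H k (by omega) (ih (by omega))
  have h := this (n + 1) le_rfl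
  rw [gridTime_last (hts.le.trans hsT)] at h
  exact absurd h (not_lt.2 hsT)

variable {W : ℝ≥0 → Ω → Fin N → ℝ} {c : Fin N → ℝ} {t T : ℝ≥0} {ζ : ℝ}
  {f f₁ f₂ : ℝ → ℝ} {K : ℝ}

theorem measurable_smul_const {m : MeasurableSpace Ω} {Y : Ω → ℝ} (hY : Measurable Y)
    (c : Fin N → ℝ) : Measurable (fun ω => Y ω • c) :=
  measurable_pi_lambda _ fun j => hY.mul_const (c j)

variable [mΩ : MeasurableSpace Ω] {P : Measure Ω} [IsProbabilityMeasure P]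

/-- The hedging strategy of a payoff, discretized on a regular grid. -/
noncomputable def gridHedge (hW : IsStandardBrownian W P) (S : SmoothBdd f f₁ f₂ K)
    (c : Fin N → ℝ) (t T : ℝ≥0) (ζ : ℝ) (n : ℕ) : SimpleIntegrand W P where
  n := n + 1
  time := gridTime t T n
  time_mono := monotone_gridTime t T n
  ξ k ω := (-payoffValue W c t T ζ f₁ (gridTime t T n k) ω) • c
  adapted k := measurable_smul_const (measurable_payoffValue (ExpBdd.of_bounded S.bdd₁)
    S.continuous₁ (le_gridTime t T n k)).neg c
  memLp k := by
    have hm := measurable_payoffValue (W := W) (c := c) (T := T) (ζ := ζ)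
      (ExpBdd.of_bounded S.bdd₁) S.continuous₁ (le_gridTime t T n k)
    refine MemLp.of_bound ((measurable_smul_const hm.neg c).mono (pastSigma_le hW _)
      le_rfl).aestronglyMeasurable (K * ‖c‖) (ae_of_all _ fun ω => ?_)
    rw [norm_smul, norm_neg]
    exact mul_le_mul_of_nonneg_right ((S.gconv _).bdd₁ _) (norm_nonneg c)

/-- The hedging error of the discretized strategy is the sum of the errors of the Ito formula. -/
theorem payoffValue_sub_gain (hW : IsStandardBrownian W P) (S : SmoothBdd f f₁ f₂ K)
    {s : ℝ≥0} (hts : t ≤ s) (hsT : s ≤ T) (n : ℕ) (ω : Ω) :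
    payoffValue W c t T ζ f s ω - payoffValue W c t T ζ f t ω -
      ((∫ v in (t : ℝ)..s, (gridHedge hW S c t T ζ n).eval v ω ⬝ᵥ c) +
        (gridHedge hW S c t T ζ n).integral t s ω)
      = ∑ k ∈ Finset.range (n + 1), itoError W c t T ζ f f₁ (max t (min (gridTime t T n k) s))
          (max t (min (gridTime t T n (k + 1)) s)) ω := by
  set u : ℕ → ℝ≥0 := fun k => max t (min (gridTime t T n k) s) with hu
  rw [SimpleIntegrand.intervalIntegral_eval_add_integral _ c hts]
  change _ - _ - ∑ k ∈ Finset.range (n + 1),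
    ((-payoffValue W c t T ζ f₁ (gridTime t T n k) ω) • c) ⬝ᵥ
      (W (u (k + 1)) ω - W (u k) ω + (((u (k + 1) : ℝ≥0) : ℝ) - (u k : ℝ≥0)) • c)
    = ∑ k ∈ Finset.range (n + 1), itoError W c t T ζ f f₁ (u k) (u (k + 1)) ω
  have h1 : ∀ k, ((-payoffValue W c t T ζ f₁ (gridTime t T n k) ω) • c) ⬝ᵥ
      (W (u (k + 1)) ω - W (u k) ω + (((u (k + 1) : ℝ≥0) : ℝ) - (u k : ℝ≥0)) • c)
      = payoffValue W c t T ζ f₁ (u k) ω *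
        (logState W c t ζ (u (k + 1)) ω - logState W c t ζ (u k) ω) := by
    intro k
    have e1 : ((-payoffValue W c t T ζ f₁ (gridTime t T n k) ω) • c) ⬝ᵥ
        (W (u (k + 1)) ω - W (u k) ω + (((u (k + 1) : ℝ≥0) : ℝ) - (u k : ℝ≥0)) • c)
        = payoffValue W c t T ζ f₁ (gridTime t T n k) ω *
          (logState W c t ζ (u (k + 1)) ω - logState W c t ζ (u k) ω) := by
      rw [logState_sub, smul_dotProduct, dotProduct_add, dotProduct_smul,
        Real.coe_toNNReal _ (normSq_nonneg c), normSq, smul_eq_mul, smul_eq_mul]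
      ring
    rw [e1]
    -- The strategy is evaluated at the grid point, the Ito error at the clipped point. They agree
    -- before `s`; after `s` the step is empty.
    rcases le_total (gridTime t T n k) s with h | h
    · have : u k = gridTime t T n k := by
        simp only [hu, min_eq_left h, max_eq_right (le_gridTime t T n k)]
      rw [this]
    · have h' := h.trans (monotone_gridTime t T n (Nat.le_succ k))
      have : u (k + 1) = u k := by simp only [hu, min_eq_right h, min_eq_right h']
      rw [this]; simp
  have h2 := Finset.sum_range_sub (fun k => payoffValue W c t T ζ f (u k) ω) (n + 1)
  have h3 : u (n + 1) = s := by
    simp only [hu, gridTime_last (hts.trans hsT), min_eq_right hsT, max_eq_right hts]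
  have h4 : u 0 = t := by simp only [hu, gridTime_zero, min_eq_left hts, max_self]
  rw [h3, h4] at h2
  rw [← h2, Finset.sum_congr rfl fun k _ => h1 k, ← Finset.sum_sub_distrib]
  rfl

/-- With `n + 1` steps of variance at most `D / (n + 1)`, both bounds, of orders `n δ²` and `n² δ³`,
decay like `1 / (n + 1)`. -/
theorem tendsto_integral_hedgingError (hW : IsStandardBrownian W P) (S : SmoothBdd f f₁ f₂ K)
    {s : ℝ≥0} (hts : t ≤ s) (hsT : s ≤ T) :
    Tendsto (fun n => ∫⁻ ω, ENNReal.ofReal ((payoffValue W c t T ζ f s ω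
      - payoffValue W c t T ζ f t ω -
      ((∫ v in (t : ℝ)..s, (gridHedge hW S c t T ζ n).eval v ω ⬝ᵥ c) +
        (gridHedge hW S c t T ζ n).integral t s ω)) ^ 2) ∂P) atTop (𝓝 0) := by
  set D : ℝ := (normSq c).toNNReal * ((T : ℝ) - t) with hD
  have hD0 : 0 ≤ D := mul_nonneg NNReal.zero_le_coe (by simpa using hts.trans hsT)
  set Q := ∫ n, remainderPoly (√D) n ^ 2 ∂gaussianReal 0 1
  set C : ℝ := 2 * (K ^ 2 * D ^ 2 * squareVariance) + 2 * (K ^ 2 * D ^ 3 * Q)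
  have hlim : Tendsto (fun n : ℕ => ENNReal.ofReal (C * (1 / ((n : ℝ) + 1)))) atTop (𝓝 0) := by
    have := ENNReal.tendsto_ofReal ((tendsto_one_div_add_atTop_nhds_zero_nat (𝕜 := ℝ)).const_mul C)
    simpa using this
  refine tendsto_of_tendsto_of_tendsto_of_le_of_le tendsto_const_nhds hlim
    (fun _ => zero_le) fun n => ?_
  simp only [payoffValue_sub_gain hW S hts hsT]
  set u : ℕ → ℝ≥0 := fun k => max t (min (gridTime t T n k) s) with hu
  have hum : Monotone u := fun i j hij =>
    max_le_max le_rfl (min_le_min_right _ (monotone_gridTime t T n hij))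
  have htu : t ≤ u 0 := le_max_left _ _
  have huT : ∀ k, u k ≤ T := fun k => max_le (hts.trans hsT) ((min_le_right _ _).trans hsT)
  have hn : (0 : ℝ) < n + 1 := by positivity
  have hδ : ∀ k, (((normSq c).toNNReal * (u (k + 1) - u k) : ℝ≥0) : ℝ) ≤ D / (n + 1) := by
    intro k
    have h1 : u (k + 1) - u k ≤ (T - t) / (n + 1) := by
      rw [tsub_le_iff_left]
      simp only [hu]
      refine max_le ((le_max_left _ _).trans le_self_add) ?_
      rw [gridTime_succ]
      rcases le_total (gridTime t T n k) s with h | h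
      · rw [min_eq_left h]
        exact (min_le_left _ _).trans (add_le_add_left (le_max_right _ _) _)
      · rw [min_eq_right h]
        exact (min_le_right _ _).trans ((le_max_right _ _).trans le_self_add)
    have h2 : (((normSq c).toNNReal * ((T - t) / (n + 1)) : ℝ≥0) : ℝ) = D / (n + 1) := by
      rw [hD, NNReal.coe_mul, NNReal.coe_div, NNReal.coe_sub (hts.trans hsT)]
      push_cast; ring
    rw [← h2]
    exact_mod_cast mul_le_mul_right h1 _
  have hL : √(D / (n + 1)) ≤ √D := Real.sqrt_le_sqrt (div_le_self hD0 (by linarith))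
  have h := integral_sum_itoError_sq_le (ζ := ζ) hW S hum htu (n := n + 1) huT hδ hL
  have hE : MemLp (fun ω => ∑ k ∈ Finset.range (n + 1),
      itoError W c t T ζ f f₁ (u k) (u (k + 1)) ω) 2 P :=
    memLp_finsetSum _ fun k _ => memLp_itoError hW S (htu.trans (hum (Nat.zero_le k)))
      (hum (Nat.le_succ k))
  rw [← ofReal_integral_eq_lintegral_ofReal hE.integrable_sq (ae_of_all _ fun _ => sq_nonneg _)]
  refine ENNReal.ofReal_le_ofReal (h.trans_eq ?_)
  push_cast
  simp only [C, Q]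
  field_simp

/-- The discretized hedging strategies converge in `L²` to the hedging strategy. -/
theorem tendsto_gridHedge_eval (hW : IsStandardBrownian W P) (S : SmoothBdd f f₁ f₂ K)
    (htT : t ≤ T) {φ : ℝ → Ω → Fin N → ℝ} (hφ : Measurable (Function.uncurry φ))
    (hφe : ∀ s : ℝ≥0, t ≤ s → s ≤ T → ∀ᵐ ω ∂P, φ s ω = (-payoffValue W c t T ζ f₁ s ω) • c) :
    Tendsto (fun n => ∫⁻ ω, (∫⁻ s in Icc (t : ℝ) T,
      ENNReal.ofReal (normSq ((gridHedge hW S c t T ζ n).eval s ω - φ s ω))) ∂P) atTop (𝓝 0) := by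
  set A := (normSq c).toNNReal
  have hA : (A : ℝ) = normSq c := Real.coe_toNNReal _ (normSq_nonneg c)
  set D : ℝ := A * ((T : ℝ) - t) with hD
  have hK := S.nonneg
  set C : ℕ → ℝ := fun n => normSq c * (2 * K ^ 2 * (D * (1 / ((n : ℝ) + 1))) ^ 2
    + 2 * K ^ 2 * (D * (1 / ((n : ℝ) + 1)) + (D * (1 / ((n : ℝ) + 1))) ^ 2)) with hC
  have hlim : Tendsto (fun n : ℕ => ENNReal.ofReal (C n) * volume (Icc (t : ℝ) T)) atTop (𝓝 0) := by
    have h0 := (tendsto_one_div_add_atTop_nhds_zero_nat (𝕜 := ℝ)).const_mul D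
    have h1 := ((((h0.pow 2).const_mul (2 * K ^ 2)).add ((h0.add (h0.pow 2)).const_mul
      (2 * K ^ 2)))).const_mul (normSq c)
    have h2 := ENNReal.Tendsto.mul_const (b := volume (Icc (t : ℝ) T)) (ENNReal.tendsto_ofReal h1)
      (Or.inr (by simp))
    simpa [hC] using h2
  refine tendsto_of_tendsto_of_tendsto_of_le_of_le tendsto_const_nhds hlim
    (fun _ => zero_le) fun n => ?_
  set Φ := gridHedge hW S c t T ζ n with hΦ
  have hm : Measurable (fun p : ℝ × Ω => ENNReal.ofReal (normSq (Φ.eval p.1 p.2 - φ p.1 p.2))) :=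
    (measurable_normSq.comp ((Φ.measurable_eval hW).sub hφ)).ennreal_ofReal
  -- Fubini reduces the claim to a bound at each fixed time, where only one Gaussian increment
  -- enters. The endpoint `t`, at which the left-open steps vanish, is a null set.
  rw [lintegral_lintegral_swap (f := fun ω s => ENNReal.ofReal (normSq (Φ.eval s ω - φ s ω)))
    (hm.comp measurable_swap).aemeasurable,
    setLIntegral_congr Ioc_ae_eq_Icc.symm, ← measure_congr Ioc_ae_eq_Icc,
    ← setLIntegral_const]
  refine setLIntegral_mono measurable_const fun s hs => ?_
  lift s to ℝ≥0 using t.coe_nonneg.trans hs.1.le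
  have hts : t < s := by exact_mod_cast hs.1
  have hsT : s ≤ T := by exact_mod_cast hs.2
  obtain ⟨k, hk, hks, hsk⟩ := exists_gridTime_lt_le hts hsT n
  set r := gridTime t T n k with hr
  have heval : ∀ ω, Φ.eval s ω = (-payoffValue W c t T ζ f₁ r ω) • c := by
    intro ω
    rw [SimpleIntegrand.eval]
    refine (Finset.sum_eq_single_of_mem k (Finset.mem_range.2 hk) ?_).trans ?_
    rotate_left
    · rw [indicator_of_mem]
      · rfl
      · exact ⟨by exact_mod_cast hks, by exact_mod_cast hsk⟩
    · intro j _ hjk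
      rw [indicator_of_notMem]
      rintro ⟨h1, h2⟩
      have h1' : gridTime t T n j < s := by exact_mod_cast h1
      have h2' : s ≤ gridTime t T n (j + 1) := by exact_mod_cast h2
      rcases lt_or_gt_of_ne hjk with h | h
      · exact absurd (h2'.trans (monotone_gridTime t T n h)) (not_le.2 hks)
      · exact absurd (hsk.trans (monotone_gridTime t T n h)) (not_le.2 h1')
  have hlaw := hasLaw_dotProduct_incr hW hks.le c
  set η := A * (s - r) with hη
  have hη' : (η : ℝ) = A * ((s : ℝ) - r) := by rw [hη, NNReal.coe_mul, NNReal.coe_sub hks.le]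
  have hηδ : (η : ℝ) ≤ D * (1 / ((n : ℝ) + 1)) := by
    have h1 : s - r ≤ (T - t) / (n + 1) := by
      rw [tsub_le_iff_left, hr, ← gridTime_succ]; exact hsk
    have h2 : ((A * ((T - t) / (n + 1)) : ℝ≥0) : ℝ) = D * (1 / ((n : ℝ) + 1)) := by
      rw [hD, NNReal.coe_mul, NNReal.coe_div, NNReal.coe_sub htT]
      push_cast; ring
    rw [← h2]
    exact_mod_cast mul_le_mul_right h1 _
  set g : ℝ → ℝ := fun y => normSq c * (2 * K ^ 2 * (η : ℝ) ^ 2 + 2 * K ^ 2 * (y + η) ^ 2) with hg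
  have hgE : ExpBdd (fun y : ℝ => (y + η) ^ 2) :=
    (expBdd_id.add (ExpBdd.of_bounded (F := fun _ => (η : ℝ)) fun _ => le_rfl)).pow 2
  have hgi1 : Integrable (fun y : ℝ => 2 * K ^ 2 * (y + η) ^ 2) (gaussianReal 0 η) :=
    (hgE.integrable (by fun_prop) 0 η).const_mul _
  have hgi : Integrable g (gaussianReal 0 η) :=
    ((integrable_const (2 * K ^ 2 * (η : ℝ) ^ 2)).add hgi1).const_mul _
  have hgint : ∫ y, g y ∂gaussianReal 0 η
      = normSq c * (2 * K ^ 2 * (η : ℝ) ^ 2 + 2 * K ^ 2 * (η + (η : ℝ) ^ 2)) := by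
    have i1 : Integrable (fun y : ℝ => y ^ 2) (gaussianReal 0 η) :=
      (expBdd_id.pow 2).integrable (by fun_prop) 0 η
    have i2 : Integrable (fun y : ℝ => y * (2 * η)) (gaussianReal 0 η) :=
      (expBdd_id.integrable (by fun_prop) 0 η).mul_const _
    have i3 : Integrable (fun y : ℝ => y ^ 2 + y * (2 * η)) (gaussianReal 0 η) := i1.add i2
    have e : ∀ y : ℝ, (y + η) ^ 2 = y ^ 2 + y * (2 * η) + (η : ℝ) ^ 2 := fun y => by ring
    have h5 : ∫ y : ℝ, (y + η) ^ 2 ∂gaussianReal 0 η = η + (η : ℝ) ^ 2 := by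
      simp only [e]
      rw [integral_add i3 (integrable_const _), integral_add i1 i2, integral_mul_const,
        integral_id_gaussianReal, integral_sq_gaussianReal]
      simp
    rw [hg, integral_const_mul, integral_add (integrable_const _) hgi1,
      integral_const_mul (2 * K ^ 2) fun y : ℝ => (y + η) ^ 2, h5]
    simp
  have hle : ∀ᵐ ω ∂P, normSq (Φ.eval s ω - φ s ω) ≤ g (c ⬝ᵥ (W s ω - W r ω)) := by
    filter_upwards [hφe s hts.le hsT] with ω hω
    rw [heval, hω, ← sub_smul, normSq, smul_dotProduct, dotProduct_smul, smul_eq_mul, smul_eq_mul]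
    change _ ≤ normSq c * (2 * K ^ 2 * (η : ℝ) ^ 2 + 2 * K ^ 2 * (c ⬝ᵥ (W s ω - W r ω) + η) ^ 2)
    -- The hedge is Lipschitz in remaining variance and in state; between `r` and `s` these move by
    -- `η` and by the increment plus `η`.
    have h1 := S.abs_gconv_sub_le₁ (A * (T - r)) (A * (T - s)) (logState W c t ζ r ω)
      (logState W c t ζ s ω)
    rw [abs_sub_comm (logState W c t ζ r ω), logState_sub, abs_neg, ← hη', NNReal.coe_mul,
      NNReal.coe_mul, NNReal.coe_sub hsT, NNReal.coe_sub (hks.le.trans hsT),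
      show (A : ℝ) * ((T : ℝ) - r) - A * ((T : ℝ) - s) = η by rw [hη']; ring,
      abs_of_nonneg η.coe_nonneg] at h1
    set x := payoffValue W c t T ζ f₁ r ω
    set x' := payoffValue W c t T ζ f₁ s ω
    set y := c ⬝ᵥ (W s ω - W r ω) + (η : ℝ)
    change |x - x'| ≤ K * η + K * |y| at h1
    have h2 : (x - x') ^ 2 ≤ (K * η + K * |y|) ^ 2 := by
      rw [← sq_abs]; exact pow_le_pow_left₀ (abs_nonneg _) h1 2
    have h3 : (K * η + K * |y|) ^ 2 ≤ 2 * K ^ 2 * (η : ℝ) ^ 2 + 2 * K ^ 2 * y ^ 2 := by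
      have := sq_abs y
      nlinarith [sq_nonneg (K * η - K * |y|)]
    have h4 : (-x - -x') * ((-x - -x') * (c ⬝ᵥ c)) = normSq c * (x - x') ^ 2 := by
      rw [normSq]; ring
    rw [h4]
    exact mul_le_mul_of_nonneg_left (h2.trans h3) (normSq_nonneg c)
  have hgc := hgi
  rw [← hlaw.map_eq] at hgc
  have hgc' : Integrable (fun ω => g (c ⬝ᵥ (W s ω - W r ω))) P :=
    hgc.comp_aemeasurable hlaw.aemeasurable
  have hg0 : ∀ y, 0 ≤ g y := fun y => mul_nonneg (normSq_nonneg c) (by positivity)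
  calc _ ≤ ∫⁻ ω, ENNReal.ofReal (g (c ⬝ᵥ (W s ω - W r ω))) ∂P :=
        lintegral_mono_ae (hle.mono fun ω hω => ENNReal.ofReal_le_ofReal hω)
    _ = ENNReal.ofReal (∫ ω, g (c ⬝ᵥ (W s ω - W r ω)) ∂P) :=
        (ofReal_integral_eq_lintegral_ofReal hgc' (ae_of_all _ fun _ => hg0 _)).symm
    _ ≤ ENNReal.ofReal (C n) := by
        have h6 : ∫ ω, g (c ⬝ᵥ (W s ω - W r ω)) ∂P = ∫ y, g y ∂gaussianReal 0 η :=
          hlaw.integral_comp (f := g) (by simp only [hg]; fun_prop)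
        rw [h6, hgint]
        refine ENNReal.ofReal_le_ofReal (mul_le_mul_of_nonneg_left ?_ (normSq_nonneg c))
        have h7 := pow_le_pow_left₀ η.coe_nonneg hηδ 2
        have h8 : 0 ≤ 2 * K ^ 2 := by positivity
        exact add_le_add (mul_le_mul_of_nonneg_left h7 h8)
          (mul_le_mul_of_nonneg_left (add_le_add hηδ h7) h8)

end Hedge

end Merton

namespace Merton

/-! ### Exact replication of smooth payoffs -/

section Replication

variable {N : ℕ} {Ω : Type*}

/-- The grid point `k / (n + 1)`. -/
noncomputable def ratPoint (n k : ℕ) : ℝ≥0 := (k : ℝ≥0) / ((n : ℝ≥0) + 1)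

/-- The index of the last grid point `k / (n + 1)` before `s`. -/
noncomputable def ratIndex (n : ℕ) (s : ℝ) : ℕ := ⌊s * ((n : ℝ) + 1)⌋₊

theorem measurable_ratIndex (n : ℕ) : Measurable (ratIndex n) := by
  have h : Measurable (fun s : ℝ => s * ((n : ℝ) + 1)) := measurable_id.mul_const _
  exact h.nat_floor

/-- A progressively measurable version of `c ⬝ W`. -/
noncomputable def progVersion (W : ℝ≥0 → Ω → Fin N → ℝ) (c : Fin N → ℝ) (s : ℝ) (ω : Ω) : ℝ :=
  limsup (fun n : ℕ => c ⬝ᵥ W (ratPoint n (ratIndex n s)) ω) atTop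

variable {W : ℝ≥0 → Ω → Fin N → ℝ} {c : Fin N → ℝ} {t T : ℝ≥0} {ζ : ℝ}
  {f f₁ f₂ : ℝ → ℝ} {K : ℝ}

/-- Paths are continuous only almost surely, so `W` need not be jointly measurable in time and
state. The upper limit along grid points up to `s` is jointly measurable and adapted, and equals `c
⬝ W` on continuous paths. -/
theorem measurable_progVersion_past (s : ℝ≥0) :
    Measurable[pastSigma W s] (progVersion W c s) := by
  refine @Measurable.limsup _ _ _ _ _ (pastSigma W s) _ _ _ _ fun n => ?_
  refine (measurable_dotProduct c).comp (measurable_pastSigma ?_)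
  rw [ratPoint, ratIndex]
  refine div_le_of_le_mul₀ zero_le zero_le ?_
  rw [← NNReal.coe_le_coe]
  push_cast
  exact Nat.floor_le (by positivity)

theorem progVersion_eq {ω : Ω} (h : Continuous fun s => c ⬝ᵥ W s ω) (s : ℝ≥0) :
    progVersion W c s ω = c ⬝ᵥ W s ω := by
  refine Tendsto.limsup_eq ((h.tendsto s).comp ?_)
  have h1 := (tendsto_nat_floor_mul_div_atTop (R := ℝ) s.coe_nonneg).comp
    ((tendsto_natCast_atTop_atTop (R := ℝ)).comp (tendsto_add_atTop_nat 1))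
  rw [← NNReal.tendsto_coe]
  refine h1.congr fun n => ?_
  simp [ratPoint, ratIndex]

/-- The value of the derivative of the payoff along a progressively measurable version of the
log-state-price. -/
noncomputable def hedgeDelta (W : ℝ≥0 → Ω → Fin N → ℝ) (c : Fin N → ℝ) (t T : ℝ≥0) (ζ : ℝ)
    (f₁ : ℝ → ℝ) (s : ℝ) (ω : Ω) : ℝ :=
  gconv ((normSq c).toNNReal * (T - s.toNNReal)) f₁
    (ζ - (progVersion W c s ω - c ⬝ᵥ W t ω) - (normSq c).toNNReal * (s - t))

theorem hedgeDelta_eq {ω : Ω} (h : Continuous fun s => c ⬝ᵥ W s ω) (s : ℝ≥0) :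
    hedgeDelta W c t T ζ f₁ s ω = payoffValue W c t T ζ f₁ s ω := by
  rw [hedgeDelta, payoffValue, logState, progVersion_eq h, Real.toNNReal_coe, dotProduct_sub]

theorem measurable_hedgeDelta_past (S : SmoothBdd f f₁ f₂ K) {s : ℝ≥0} (hts : t ≤ s) :
    Measurable[pastSigma W s] (hedgeDelta W c t T ζ f₁ s) := by
  have h1 : Measurable[pastSigma W s] (fun ω => c ⬝ᵥ W t ω) :=
    (measurable_dotProduct c).comp (measurable_pastSigma hts)
  have h3 : Measurable[pastSigma W s] (fun ω => ζ - (progVersion W c s ω - c ⬝ᵥ W t ω)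
      - (normSq c).toNNReal * ((s : ℝ) - t)) :=
    (((measurable_progVersion_past s).sub h1).const_sub ζ).sub_const _
  exact (Merton.continuous_gconv (ExpBdd.of_bounded S.bdd₁) S.continuous₁ _).measurable.comp h3

theorem abs_hedgeDelta_le (S : SmoothBdd f f₁ f₂ K) (s : ℝ) (ω : Ω) :
    |hedgeDelta W c t T ζ f₁ s ω| ≤ K := (S.gconv _).bdd₁ _

variable [mΩ : MeasurableSpace Ω] {P : Measure Ω}

theorem measurable_uncurry_comp_nat {α : Type*} [MeasurableSpace α] {F : ℕ → Ω → ℝ}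
    (hF : ∀ k, Measurable (F k)) {ν : α → ℕ} (hν : Measurable ν) :
    Measurable (fun p : α × Ω => F (ν p.1) p.2) := by
  have h1 : Measurable (fun p : ℕ × Ω => F p.1 p.2) := measurable_from_prod_countable_right hF
  exact h1.comp ((hν.comp measurable_fst).prodMk measurable_snd)

theorem measurable_progVersion (hW : IsStandardBrownian W P) :
    Measurable (fun p : ℝ × Ω => progVersion W c p.1 p.2) :=
  Measurable.limsup fun n => measurable_uncurry_comp_nat
    (F := fun k ω => c ⬝ᵥ W (ratPoint n k) ω)
    (fun k => (measurable_dotProduct c).comp (hW.measurable (ratPoint n k)))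
    (ν := ratIndex n) (measurable_ratIndex n)

theorem ae_continuous_dotProduct (hW : IsStandardBrownian W P) (c : Fin N → ℝ) :
    ∀ᵐ ω ∂P, Continuous fun s => c ⬝ᵥ W s ω := by
  have h : ∀ᵐ ω ∂P, ∀ j, Continuous fun s => W s ω j := ae_all_iff.2 fun j => (hW.isBrownian j).cont
  filter_upwards [h] with ω hω
  exact continuous_finsetSum _ fun j _ => (hω j).const_mul _

theorem measurable_hedgeDelta (hW : IsStandardBrownian W P) (S : SmoothBdd f f₁ f₂ K) :
    Measurable (fun p : ℝ × Ω => hedgeDelta W c t T ζ f₁ p.1 p.2) := by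
  have h1 : Measurable (fun p : ℝ × Ω => c ⬝ᵥ W t p.2) :=
    (measurable_dotProduct c).comp ((hW.measurable t).comp measurable_snd)
  have h2 : Measurable (fun p : ℝ × Ω => (normSq c).toNNReal * (T - p.1.toNNReal)) := by fun_prop
  have h3 : Measurable (fun p : ℝ × Ω => ζ - (progVersion W c p.1 p.2 - c ⬝ᵥ W t p.2)
      - (normSq c).toNNReal * (p.1 - t)) :=
    (((measurable_progVersion hW).sub h1).const_sub ζ).sub (by fun_prop)
  exact S.continuous_gconv₁.measurable.comp (h2.prodMk h3)

theorem intervalIntegrable_hedge (hW : IsStandardBrownian W P) (S : SmoothBdd f f₁ f₂ K)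
    (a b : ℝ) (ω : Ω) : IntervalIntegrable
      (fun v => ((-hedgeDelta W c t T ζ f₁ v ω) • c) ⬝ᵥ c) volume a b := by
  have hm : Measurable (fun v => hedgeDelta W c t T ζ f₁ v ω) :=
    (measurable_hedgeDelta hW S).comp (measurable_prodMk_right (y := ω))
  refine (intervalIntegrable_const (c := K * normSq c)).mono_fun ?_ (ae_of_all _ fun v => ?_)
  · simp only [smul_dotProduct, smul_eq_mul]
    exact (hm.neg.mul_const _).aestronglyMeasurable
  · dsimp only
    rw [smul_dotProduct, smul_eq_mul, norm_mul, norm_neg, Real.norm_eq_abs, Real.norm_eq_abs,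
      Real.norm_eq_abs, abs_mul, abs_of_nonneg S.nonneg]
    exact mul_le_mul_of_nonneg_right (abs_hedgeDelta_le S v ω) (abs_nonneg _)

variable [IsProbabilityMeasure P]

/-- The candidate integral is what the Ito formula predicts: the change of value minus the drift.
Its distance from the integrals of the grid strategies is the hedging error plus a difference of
drift integrals, and both tend to zero. -/
theorem isItoIntegral_of_ae_eq (hW : IsStandardBrownian W P) (S : SmoothBdd f f₁ f₂ K)
    (htT : t ≤ T) {φ : ℝ → Ω → Fin N → ℝ} (hφm : Measurable (Function.uncurry φ))
    (hφe : ∀ s : ℝ≥0, t ≤ s → s ≤ T → ∀ᵐ ω ∂P, φ s ω = (-payoffValue W c t T ζ f₁ s ω) • c)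
    (hint : ∀ (a b : ℝ) (ω : Ω), IntervalIntegrable (fun v => φ v ω ⬝ᵥ c) volume a b) :
    IsItoIntegral W P t T φ (fun s ω => payoffValue W c t T ζ f s.toNNReal ω
      - gconv ((normSq c).toNNReal * (T - t)) f ζ - ∫ v in (t : ℝ)..s, φ v ω ⬝ᵥ c) := by
  have hφc : Measurable (Function.uncurry fun v ω => φ v ω ⬝ᵥ c) := by
    simp only [dotProduct_comm _ c]
    exact (measurable_dotProduct c).comp hφm
  have hXm : ∀ s : ℝ≥0, t ≤ s → Measurable (payoffValue W c t T ζ f s) := fun s hs =>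
    (measurable_payoffValue (ExpBdd.of_bounded S.bdd) S.continuous hs).mono (pastSigma_le hW _) le_rfl
  have hlim := tendsto_gridHedge_eval (ζ := ζ) hW S htT hφm hφe
  refine ⟨fun s hs => ?_, gridHedge hW S c t T ζ, hlim, fun s hs => ?_⟩
  · exact (((hXm _ (NNReal.le_toNNReal_of_coe_le hs.1)).sub_const _).sub
      (measurable_intervalIntegral hφc _ _)).aemeasurable
  · lift s to ℝ≥0 using t.coe_nonneg.trans hs.1
    have hts : t ≤ s := by exact_mod_cast hs.1
    have hsT : s ≤ T := by exact_mod_cast hs.2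
    simp only [Real.toNNReal_coe]
    set Kc := ENNReal.ofReal (((T : ℝ) - t) * normSq c + 1)
    have h0 := tendsto_integral_hedgingError (c := c) (ζ := ζ) hW S hts hsT
    have hlim2 := (ENNReal.Tendsto.const_mul (a := 2) h0 (Or.inr (by simp))).add
      (ENNReal.Tendsto.const_mul (a := 2) (ENNReal.Tendsto.const_mul (a := Kc) hlim
        (Or.inr ENNReal.ofReal_ne_top)) (Or.inr (by simp)))
    simp only [mul_zero, add_zero] at hlim2
    refine tendsto_of_tendsto_of_tendsto_of_le_of_le tendsto_const_nhds hlim2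
      (fun _ => zero_le) fun n => ?_
    generalize gridHedge hW S c t T ζ n = Φ
    have hdm : Measurable (fun p : ℝ × Ω => Φ.eval p.1 p.2 - φ p.1 p.2) :=
      (Φ.measurable_eval hW).sub hφm
    have hΦm : Measurable (Function.uncurry fun v ω => Φ.eval v ω ⬝ᵥ c) := by
      simp only [dotProduct_comm _ c]
      exact (measurable_dotProduct c).comp (Φ.measurable_eval hW)
    have hin : Measurable (fun ω => ∫⁻ s in Icc (t : ℝ) T,
        ENNReal.ofReal (normSq (Φ.eval s ω - φ s ω))) :=
      Measurable.lintegral_prod_right' (ν := volume.restrict (Icc (t : ℝ) T))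
        (f := fun p : Ω × ℝ => ENNReal.ofReal (normSq (Φ.eval p.2 p.1 - φ p.2 p.1)))
        ((measurable_normSq.comp (hdm.comp measurable_swap)).ennreal_ofReal)
    have hE : Measurable (fun ω => ENNReal.ofReal ((payoffValue W c t T ζ f s ω
        - payoffValue W c t T ζ f t ω - ((∫ v in (t : ℝ)..s, Φ.eval v ω ⬝ᵥ c) +
          Φ.integral t s ω)) ^ 2)) :=
      ((((hXm s hts).sub (hXm t le_rfl)).sub ((measurable_intervalIntegral hΦm _ _).add
        (Φ.measurable_integral hW t s))).pow_const 2).ennreal_ofReal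
    rw [← lintegral_const_mul _ hE, ← lintegral_const_mul _ hin,
      ← lintegral_const_mul _ (hin.const_mul Kc), ← lintegral_add_left (hE.const_mul 2)]
    refine lintegral_mono fun ω => ?_
    have hψ : Measurable (fun v => Φ.eval v ω - φ v ω) :=
      hdm.comp (measurable_prodMk_right (y := ω))
    have e2 := sq_intervalIntegral_dotProduct_le (by exact_mod_cast hts : (t : ℝ) ≤ s)
      (by exact_mod_cast hsT : (s : ℝ) ≤ T) c hψ
    refine le_trans ?_ (add_le_add le_rfl (mul_le_mul_right e2 2))
    rw [show (2 : ℝ≥0∞) = ENNReal.ofReal 2 by simp, ← ENNReal.ofReal_mul (by norm_num),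
      ← ENNReal.ofReal_mul (by norm_num), ← ENNReal.ofReal_add (by positivity) (by positivity)]
    refine ENNReal.ofReal_le_ofReal ?_
    have e3 : ∫ v in (t : ℝ)..s, (Φ.eval v ω - φ v ω) ⬝ᵥ c
        = (∫ v in (t : ℝ)..s, Φ.eval v ω ⬝ᵥ c) - ∫ v in (t : ℝ)..s, φ v ω ⬝ᵥ c := by
      rw [← intervalIntegral.integral_sub (Φ.intervalIntegrable_eval c _ _ ω) (hint _ _ ω)]
      simp only [sub_dotProduct]
    have e4 : payoffValue W c t T ζ f t ω = gconv ((normSq c).toNNReal * (T - t)) f ζ := by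
      rw [payoffValue, logState_self]
    rw [e3, e4]
    set x := payoffValue W c t T ζ f s ω
    set y := gconv ((normSq c).toNNReal * (T - t)) f ζ
    set i := Φ.integral t s ω
    set a := ∫ v in (t : ℝ)..s, Φ.eval v ω ⬝ᵥ c
    set b := ∫ v in (t : ℝ)..s, φ v ω ⬝ᵥ c
    -- `x - y - b - i` is the hedging error `x - y - (a + i)` plus the drift difference `a - b`.
    nlinarith [sq_nonneg ((x - y - (a + i)) - (a - b))]

theorem isItoIntegral_hedge (hW : IsStandardBrownian W P) (S : SmoothBdd f f₁ f₂ K)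
    (htT : t ≤ T) : IsItoIntegral W P t T (fun s ω => (-hedgeDelta W c t T ζ f₁ s ω) • c)
      (fun s ω => payoffValue W c t T ζ f s.toNNReal ω - gconv ((normSq c).toNNReal * (T - t)) f ζ
        - ∫ v in (t : ℝ)..s, ((-hedgeDelta W c t T ζ f₁ v ω) • c) ⬝ᵥ c) := by
  refine isItoIntegral_of_ae_eq hW S htT (measurable_smul_const (measurable_hedgeDelta hW S).neg c)
    (fun s _ _ => ?_) (intervalIntegrable_hedge hW S)
  filter_upwards [ae_continuous_dotProduct hW c] with ω hω
  rw [hedgeDelta_eq hω]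

/-- Nonnegative smooth payoffs are replicated by admissible investment processes. -/
theorem SmoothBdd.exists_isAdmissible (hW : IsStandardBrownian W P) (S : SmoothBdd f f₁ f₂ K)
    (hf : ∀ z, 0 ≤ f z) (m : Market N) {t T : ℝ≥0} (htT : t ≤ T) (ζ : ℝ) :
    ∃ π X, IsAdmissible W P m T (Merton.gconv ((normSq m.priceOfRisk).toNNReal * (T - t)) f ζ) t π X ∧
      ∀ ω, X T ω = f (ζ - ((normSq m.priceOfRisk).toNNReal * (T - t) : ℝ≥0)
        - m.priceOfRisk ⬝ᵥ (W T ω - W t ω)) := by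
  set c := m.priceOfRisk with hc
  -- The state moves only along `c`, so the portfolio must satisfy `σ π = -delta • c`; it is a
  -- random multiple of one fixed vector.
  set k := m.σ⁻¹ *ᵥ c with hk
  have hσk : m.σ *ᵥ k = c := by
    rw [hk, Matrix.mulVec_mulVec, Matrix.mul_nonsing_inv _ ((Matrix.isUnit_iff_isUnit_det _).1
      m.isUnit_σ), Matrix.one_mulVec]
  set π : ℝ → Ω → Fin N → ℝ := fun s ω => (-hedgeDelta W c t T ζ f₁ s ω) • k with hπ
  set X : ℝ → Ω → ℝ := fun s ω => payoffValue W c t T ζ f s.toNNReal ω with hX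
  have hσπ : (fun s ω => m.σ *ᵥ π s ω) = fun s ω => (-hedgeDelta W c t T ζ f₁ s ω) • c := by
    ext s ω : 2
    rw [hπ, Matrix.mulVec_smul, hσk]
  refine ⟨π, X, ?_, fun ω => ?_⟩
  · refine ⟨measurable_smul_const (measurable_hedgeDelta hW S).neg k, fun s hs => ?_, ?_, ?_, ?_⟩
    · lift s to ℝ≥0 using t.coe_nonneg.trans hs.1
      rw [Real.toNNReal_coe]
      exact measurable_smul_const (measurable_hedgeDelta_past S (by exact_mod_cast hs.1)).neg k
    · have hle : ∀ s ω, ENNReal.ofReal (normSq (π s ω)) ≤ ENNReal.ofReal (K ^ 2 * normSq k) := by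
        intro s ω
        refine ENNReal.ofReal_le_ofReal ?_
        have h1 : normSq (π s ω) = hedgeDelta W c t T ζ f₁ s ω ^ 2 * normSq k := by
          simp only [hπ]
          rw [normSq, smul_dotProduct, dotProduct_smul, normSq, smul_eq_mul, smul_eq_mul]
          ring
        rw [h1, ← sq_abs]
        exact mul_le_mul_of_nonneg_right (pow_le_pow_left₀ (abs_nonneg _)
          (abs_hedgeDelta_le S s ω) 2) (normSq_nonneg k)
      refine (lintegral_mono fun ω => lintegral_mono fun s => hle s ω).trans_lt ?_
      simp only [lintegral_const, measure_univ, mul_one]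
      exact ENNReal.mul_lt_top ENNReal.ofReal_lt_top (by simp)
    · refine ⟨?_, _, by rw [hσπ]; exact isItoIntegral_hedge hW S htT, fun s _ => ae_of_all _ fun ω => ?_⟩
      · filter_upwards [ae_continuous_dotProduct hW c] with ω hω
        refine Continuous.continuousOn ?_
        have h1 : Continuous (fun s : ℝ => (normSq c).toNNReal * (T - s.toNNReal)) := by fun_prop
        have h2 : Continuous (fun s : ℝ => logState W c t ζ s.toNNReal ω) := by
          simp only [logState, dotProduct_sub]
          have := hω.comp continuous_real_toNNReal
          simp only [Function.comp_def] at this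
          fun_prop
        exact S.continuous_gconv.comp (h1.prodMk h2)
      · have h1 : ∀ v, m.σ *ᵥ π v ω = (-hedgeDelta W c t T ζ f₁ v ω) • c := fun v =>
          congrFun (congrFun hσπ v) ω
        simp only [h1, hX]
        ring
    · refine ae_of_all _ fun ω s _ => ?_
      exact integral_nonneg fun w => hf _
  · simp only [hX, payoffValue, Real.toNNReal_coe, tsub_self, mul_zero, gconv_zero, logState]
    rw [NNReal.coe_mul, NNReal.coe_sub htT]
    congr 1; ring

end Replication

end Merton

namespace Merton

/-! ### Truncation of payoffs and the lower bound -/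

theorem exists_smoothBdd_of_hasCompactSupport {g : ℝ → ℝ} (hg : ContDiff ℝ 3 g)
    (hs : HasCompactSupport g) (a : ℝ) :
    ∃ f₁ f₂ K, SmoothBdd (fun z => a + g z) f₁ f₂ K := by
  have e3 : (3 : WithTop ℕ∞) = 2 + 1 := by norm_num
  have e2 : (2 : WithTop ℕ∞) = 1 + 1 := by norm_num
  have e1 : (1 : WithTop ℕ∞) = 0 + 1 := by norm_num
  obtain ⟨d0, -, c1⟩ := contDiff_succ_iff_deriv.1 (e3 ▸ hg)
  obtain ⟨d1, -, c2⟩ := contDiff_succ_iff_deriv.1 (e2 ▸ c1)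
  obtain ⟨d2, -, c3⟩ := contDiff_succ_iff_deriv.1 (e1 ▸ c2)
  obtain ⟨K₀, h0⟩ := hg.continuous.bounded_above_of_compact_support hs
  obtain ⟨K₁, h1⟩ := c1.continuous.bounded_above_of_compact_support hs.deriv
  obtain ⟨K₂, h2⟩ := c2.continuous.bounded_above_of_compact_support hs.deriv.deriv
  obtain ⟨K₃, h3⟩ := c3.continuous.bounded_above_of_compact_support hs.deriv.deriv.deriv
  simp only [Real.norm_eq_abs] at h0 h1 h2 h3
  have p0 := (abs_nonneg _).trans (h0 0)
  have p1 := (abs_nonneg _).trans (h1 0)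
  have p2 := (abs_nonneg _).trans (h2 0)
  have p3 := (abs_nonneg _).trans (h3 0)
  have pa := abs_nonneg a
  refine ⟨deriv g, deriv (deriv g), |a| + K₀ + K₁ + K₂ + K₃,
    fun z => (d0 z).hasDerivAt.const_add a, fun z => (d1 z).hasDerivAt, fun z => ?_, fun z => ?_,
    fun z => ?_, fun x y => ?_⟩
  · linarith [abs_add_le a (g z), h0 z]
  · linarith [h1 z]
  · linarith [h2 z]
  · exact SmoothBdd.lip_of_bdd (fun z => (d2 z).hasDerivAt) (fun z => by linarith [h3 z]) x y

/-- A bump function interpolates between `h` and the constant `h 0`, so the payoff is constant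
outside a compact set and can be hedged. Staying between `h z` and `h 0` keeps it positive and
dominates both the payoff and its utility. -/
theorem exists_truncation {h : ℝ → ℝ} (hh : ContDiff ℝ 3 h) :
    ∃ F : ℕ → ℝ → ℝ, (∀ n a, ∃ f₁ f₂ K, SmoothBdd (fun z => a + F n z) f₁ f₂ K) ∧
      (∀ n z, min (h z) (h 0) ≤ F n z ∧ F n z ≤ max (h z) (h 0)) ∧
      ∀ z, ∀ᶠ n in atTop, F n z = h z := by
  set χ : ∀ n : ℕ, ContDiffBump (0 : ℝ) := fun n => ⟨n + 1, n + 2, by positivity, by linarith⟩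
    with hχ
  refine ⟨fun n z => h 0 + χ n z * (h z - h 0), fun n a => ?_, fun n z => ?_, fun z => ?_⟩
  · have h1 : ContDiff ℝ 3 (fun z => χ n z * (h z - h 0)) :=
      ((χ n).contDiff (n := 3)).mul (hh.sub contDiff_const)
    have h2 : HasCompactSupport (fun z => χ n z * (h z - h 0)) :=
      (χ n).hasCompactSupport.mul_right
    simpa only [add_assoc] using exists_smoothBdd_of_hasCompactSupport h1 h2 (a + h 0)
  · have h1 := (χ n).nonneg' z
    have h2 := (χ n).le_one (x := z)
    rcases le_total (h z) (h 0) with h3 | h3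
    · rw [min_eq_left h3, max_eq_right h3]
      constructor <;> nlinarith
    · rw [min_eq_right h3, max_eq_left h3]
      constructor <;> nlinarith
  · filter_upwards [eventually_ge_atTop ⌈|z|⌉₊] with n hn
    have h1 : |z| ≤ n := (Nat.le_ceil _).trans (by exact_mod_cast hn)
    rw [(χ n).one_of_mem_closedBall]
    · ring
    · rw [mem_closedBall_zero_iff, Real.norm_eq_abs]
      simp only [hχ]; linarith

namespace DualProfile

variable {U h p q : ℝ → ℝ}

theorem continuousOn_U (D : DualProfile U h p q) : ContinuousOn U (Ioi 0) := fun x hx => by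
  obtain ⟨z, rfl⟩ := D.exists_eq hx
  exact (D.hasDerivAt_U z).continuousAt.continuousWithinAt

theorem abs_U_le (D : DualProfile U h p q) {x : ℝ} (z : ℝ)
    (hx : min (h z) (h 0) ≤ x) (hx' : x ≤ max (h z) (h 0)) :
    |U x| ≤ |U (h z)| + |U (h 0)| := by
  have hm : 0 < min (h z) (h 0) := lt_min (D.h_pos z) (D.h_pos 0)
  have h1 : U (min (h z) (h 0)) ≤ U x :=
    D.strictMono.monotoneOn hm (hm.trans_le hx) hx
  have h2 : U x ≤ U (max (h z) (h 0)) :=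
    D.strictMono.monotoneOn (hm.trans_le hx) (hm.trans_le (hx.trans hx')) hx'
  have h3 := abs_nonneg (U (h z))
  have h4 := abs_nonneg (U (h 0))
  have h5 := abs_le.1 (le_refl |U (h z)|)
  have h6 := abs_le.1 (le_refl |U (h 0)|)
  rw [abs_le]
  rcases le_total (h z) (h 0) with h7 | h7
  · rw [min_eq_left h7] at h1
    rw [max_eq_right h7] at h2
    constructor <;> linarith
  · rw [min_eq_right h7] at h1
    rw [max_eq_left h7] at h2
    constructor <;> linarith

theorem tendsto_gconv_of_dominated {G : ℕ → ℝ → ℝ} {g B : ℝ → ℝ} (hG : ∀ n, Measurable (G n))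
    (hB : ExpBdd B) (hBm : Measurable B) (hle : ∀ n z, |G n z| ≤ B z)
    (hlim : ∀ z, ∀ᶠ n in atTop, G n z = g z) (θ : ℝ≥0) (z : ℝ) :
    Tendsto (fun n => Merton.gconv θ (G n) z) atTop (𝓝 (Merton.gconv θ g z)) := by
  refine tendsto_integral_of_dominated_convergence (fun w => B (z + w))
    (fun n => ((hG n).comp (measurable_const_add z)).aestronglyMeasurable)
    (hB.integrable_add hBm z 0 θ) (fun n => ae_of_all _ fun w => hle n _)
    (ae_of_all _ fun w => tendsto_const_nhds.congr' ?_)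
  filter_upwards [hlim (z + w)] with n hn using hn.symm

variable {N : ℕ} {Ω : Type*} [MeasurableSpace Ω] {P : Measure Ω} [IsProbabilityMeasure P]
  {W : ℝ≥0 → Ω → Fin N → ℝ} {m : Market N} {t T θ : ℝ≥0}

/-- Truncation may raise the cost of the payoff. Aiming at the cheaper wealth for `ζ' > ζ` leaves
strict slack, because `gconv θ h` strictly decreases, so the truncated payoff is affordable for all
large `n`. -/
theorem le_valueFunction_of_lt (D : DualProfile U h p q) (hW : IsStandardBrownian W P)
    (htT : t ≤ T) (hθ : θ = (normSq m.priceOfRisk).toNNReal * (T - t)) {ζ ζ' : ℝ} (hζ : ζ < ζ') :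
    ((Merton.gconv θ (fun z => U (h z)) (ζ' - θ) : ℝ) : EReal)
      ≤ valueFunction W P m T U (Merton.gconv θ h ζ) t := by
  obtain ⟨F, hF, hFh, hlim⟩ := exists_truncation D.contDiff_h
  have hFpos : ∀ n z, 0 < F n z := fun n z =>
    (lt_min (D.h_pos z) (D.h_pos 0)).trans_le (hFh n z).1
  have hFc : ∀ n, Continuous (F n) := fun n => by
    obtain ⟨f₁, f₂, K, S⟩ := hF n 0
    simpa using S.continuous
  have hFle : ∀ n z, |F n z| ≤ h z + h 0 := fun n z => by
    rw [abs_of_pos (hFpos n z)]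
    exact (hFh n z).2.trans (max_le (by linarith [D.h_pos 0]) (by linarith [D.h_pos z]))
  have hUFc : ∀ n, Continuous (fun z => U (F n z)) := fun n =>
    continuous_iff_continuousAt.2 fun z => ContinuousAt.comp (f := F n)
      (D.continuousOn_U.continuousAt (Ioi_mem_nhds (hFpos n z))) (hFc n).continuousAt
  have hconst : ∀ a : ℝ, ExpBdd (fun _ => a) := fun a =>
    ExpBdd.of_bounded (K := |a|) fun _ => le_rfl
  have habs : ExpBdd (fun z => |U (h z)|) := D.expBdd_U_h.mono zero_le_one fun z => by simp
  have hB : ExpBdd (fun z => |U (h z)| + |U (h 0)|) := habs.add (hconst _)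
  have hBm : Measurable (fun z => |U (h z)| + |U (h 0)|) :=
    (D.continuous_U_h.abs.add continuous_const).measurable
  have hUFle : ∀ n z, |U (F n z)| ≤ |U (h z)| + |U (h 0)| := fun n z =>
    D.abs_U_le z (hFh n z).1 (hFh n z).2
  have hlim1 := tendsto_gconv_of_dominated (fun n => (hFc n).measurable)
    (D.expBdd_h.add (hconst (h 0))) (D.continuous_h.add continuous_const).measurable hFle hlim θ ζ'
  have hlim2 := tendsto_gconv_of_dominated (fun n => (hUFc n).measurable) hB hBm hUFle
    (g := fun z => U (h z)) (fun z => (hlim z).mono fun n hn => by rw [hn]) θ (ζ' - θ)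
  have hx : Merton.gconv θ h ζ' < Merton.gconv θ h ζ := (D.toProfile.gconv θ).strictAnti hζ
  refine le_of_tendsto ((continuous_coe_real_ereal.tendsto _).comp hlim2) ?_
  filter_upwards [hlim1.eventually (gt_mem_nhds hx)] with n hn
  -- The surplus is kept as a constant. The payoff `κ + F n` then costs exactly the initial wealth,
  -- and its utility is at least that of `F n`.
  set κ := Merton.gconv θ h ζ - Merton.gconv θ (F n) ζ' with hκ
  have hκ0 : 0 < κ := sub_pos.2 hn
  obtain ⟨f₁, f₂, K, S⟩ := hF n κ
  obtain ⟨π, X, hA, hX⟩ := S.exists_isAdmissible hW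
    (fun z => (add_pos hκ0 (hFpos n z)).le) m htT ζ'
  rw [← hθ] at hA hX
  have hFi : Integrable (fun w => F n (ζ' + w)) (gaussianReal 0 θ) :=
    ExpBdd.integrable_add ((D.expBdd_h.add (hconst (h 0))).mono zero_le_one fun z => by
      rw [one_mul]; exact (hFle n z).trans (le_abs_self _)) (hFc n).measurable ζ' 0 θ
  have hcost : Merton.gconv θ (fun z => κ + F n z) ζ' = Merton.gconv θ h ζ := by
    rw [Merton.gconv, integral_add (integrable_const _) hFi]
    simp only [integral_const, probReal_univ, one_smul]
    rw [hκ, Merton.gconv, Merton.gconv]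
    ring
  rw [hcost] at hA
  have hUFE : ExpBdd (fun z => U (F n z)) := hB.mono zero_le_one fun z => by
    rw [one_mul]; exact (hUFle n z).trans (le_abs_self _)
  have hval := integral_comp_logPrice hW m.priceOfRisk htT (ζ' - θ) (hUFc n).measurable
  have hint := hUFE.integrable_comp (hasLaw_logPrice hW m.priceOfRisk htT (ζ' - θ))
    (hUFc n).measurable
  rw [← hθ] at hval
  rw [Function.comp_apply, ← hval, ← expectation_coe hint]
  refine le_trans (expectation_mono (ae_of_all _ fun ω => ?_)) (le_sSup ⟨π, X, hA, rfl⟩)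
  have hpos := hFpos n (ζ' - θ - m.priceOfRisk ⬝ᵥ (W T ω - W t ω))
  rw [hX, extendedUtility, if_pos (add_pos hκ0 hpos), EReal.coe_le_coe_iff]
  exact D.strictMono.monotoneOn hpos (add_pos hκ0 hpos) (by linarith)

/-- The dual formula for the value function. -/
theorem valueFunction_eq (D : DualProfile U h p q) (hW : IsStandardBrownian W P)
    (htT : t ≤ T) (hθ : θ = (normSq m.priceOfRisk).toNNReal * (T - t)) (ζ : ℝ) :
    valueFunction W P m T U (Merton.gconv θ h ζ) t
      = ((Merton.gconv θ (fun z => U (h z)) (ζ - θ) : ℝ) : EReal) := by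
  refine le_antisymm (sSup_le ?_) ?_
  · rintro v ⟨π, X, hA, rfl⟩
    exact D.expectation_le hW htT hθ ζ hA
  -- The slack is removed by letting `ζ'` decrease to `ζ`.
  · have h1 : Tendsto (fun ζ' => ((Merton.gconv θ (fun z => U (h z)) (ζ' - θ) : ℝ) : EReal))
        (𝓝[>] ζ) (𝓝 ((Merton.gconv θ (fun z => U (h z)) (ζ - θ) : ℝ) : EReal)) :=
      (continuous_coe_real_ereal.tendsto _).comp
        ((D.hasDerivAt_dualValue θ ζ).continuousAt.tendsto.mono_left nhdsWithin_le_nhds)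
    refine le_of_tendsto h1 ?_
    filter_upwards [self_mem_nhdsWithin] with ζ' hζ' using D.le_valueFunction_of_lt hW htT hθ hζ'

theorem riskTolerance_eq (D : DualProfile U h p q) (hW : IsStandardBrownian W P)
    (htT : t ≤ T) (hθ : θ = (normSq m.priceOfRisk).toNNReal * (T - t)) (ζ : ℝ) :
    riskTolerance W P m T U (Merton.gconv θ h ζ) t = Merton.gconv θ p ζ :=
  D.riskToleranceCoeff_value (fun ζ => by rw [D.valueFunction_eq hW htT hθ, EReal.toReal_coe]) ζ

/-- The risk tolerance depends on time through the variance of the log-state-price. -/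
theorem exists_riskTolerance_eq (D : DualProfile U h p q) (hW : IsStandardBrownian W P) :
    ∃ r : ℝ≥0 → ℝ → ℝ, (∀ θ z, r θ (Merton.gconv θ h z) = Merton.gconv θ p z) ∧
      (∀ θ, r θ 0 = 0) ∧ ∀ {t : ℝ≥0}, t ≤ T → ∀ {x : ℝ}, 0 ≤ x →
        riskTolerance W P m T U x t = r ((normSq m.priceOfRisk).toNNReal * (T - t)) x := by
  have hr : ∀ θ z, (if 0 < Merton.gconv θ h z then Merton.gconv θ p
      ((D.toProfile.gconv θ).inv (Merton.gconv θ h z)) else 0) = Merton.gconv θ p z := fun θ z => by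
    rw [if_pos ((D.toProfile.gconv θ).h_pos z), (D.toProfile.gconv θ).inv_h]
  refine ⟨fun θ x => if 0 < x then Merton.gconv θ p ((D.toProfile.gconv θ).inv x) else 0, hr,
    fun θ => if_neg (lt_irrefl 0), fun {t} htT {x} hx => ?_⟩
  rcases hx.eq_or_lt with rfl | hx
  · simp [riskTolerance, riskToleranceCoeff]
  · obtain ⟨ζ, rfl⟩ := (D.toProfile.gconv ((normSq m.priceOfRisk).toNNReal * (T - t))).exists_eq hx
    rw [D.riskTolerance_eq hW htT rfl]
    exact (hr _ ζ).symm

end DualProfile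

end Merton

/-! ### Assembly of the main theorem -/

theorem proposition8 {N : ℕ} {Ω : Type*} [MeasurableSpace Ω] (P : Measure Ω)
    [IsProbabilityMeasure P] (W : ℝ≥0 → Ω → Fin N → ℝ) (hW : Merton.IsStandardBrownian W P)
    (m : Merton.Market N) (T : ℝ) (hT : 0 < T) (U : ℝ → ℝ) (hU : Merton.IsUtility U)
    (hI : Merton.InverseMarginalBounds (Merton.inverseMarginal U))
    (hR_zero : Tendsto (Merton.riskToleranceCoeff U) (𝓝[>] 0) (𝓝 0))
    (hR_mono : StrictMonoOn (Merton.riskToleranceCoeff U) (Ici 0)) :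
    -- the risk tolerance function is well defined on `[0, ∞) × [0, T]`
    (∀ t ∈ Icc 0 T,
      (∀ x > 0, Merton.valueFunction W P m T U x t ≠ ⊤ ∧
        Merton.valueFunction W P m T U x t ≠ ⊥) ∧
      ContDiffOn ℝ 2 (fun x => (Merton.valueFunction W P m T U x t).toReal) (Ioi 0) ∧
      (∀ x > 0, iteratedDeriv 2 (fun y => (Merton.valueFunction W P m T U y t).toReal) x < 0) ∧
      Tendsto (fun x => Merton.riskTolerance W P m T U x t) (𝓝[>] 0) (𝓝 0)) ∧
    -- the concave case
    (ConcaveOn ℝ (Ici 0) (Merton.riskToleranceCoeff U) →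
      (∀ x ≥ 0, MonotoneOn (fun t => Merton.riskTolerance W P m T U x t) (Icc 0 T)) ∧
      ∀ t ∈ Ico 0 T, ConcaveOn ℝ (Ici 0) (fun x => Merton.riskTolerance W P m T U x t)) ∧
    -- the convex case
    (ConvexOn ℝ (Ici 0) (Merton.riskToleranceCoeff U) →
      (∀ x ≥ 0, AntitoneOn (fun t => Merton.riskTolerance W P m T U x t) (Icc 0 T)) ∧
      ∀ t ∈ Ico 0 T, ConvexOn ℝ (Ici 0) (fun x => Merton.riskTolerance W P m T U x t)) := by
  obtain ⟨h, p, q, D⟩ := hU.exists_dualProfile hI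
  lift T to ℝ≥0 using hT.le
  have hr0 : ∀ t, Merton.riskTolerance W P m T U 0 t = 0 := fun t => by
    simp [Merton.riskTolerance, Merton.riskToleranceCoeff]
  obtain ⟨r, hr, hrz, hrt⟩ := D.exists_riskTolerance_eq (m := m) (T := T) hW
  -- The remaining variance decreases in time, so monotonicity in `θ` is reversed when read in `t`.
  have hle : ∀ {s t : ℝ≥0}, s ≤ t → (Merton.normSq m.priceOfRisk).toNNReal * (T - t)
      ≤ (Merton.normSq m.priceOfRisk).toNNReal * (T - s) := fun hst =>
    mul_le_mul_right (tsub_le_tsub_left hst T) _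
  refine ⟨fun t ht => ?_, fun hc => ⟨fun x hx s hs t ht hst => ?_, fun t ht => ?_⟩,
    fun hc => ⟨fun x hx s hs t ht hst => ?_, fun t ht => ?_⟩⟩
  · lift t to ℝ≥0 using ht.1
    have htT : t ≤ T := by exact_mod_cast ht.2
    have hv := D.valueFunction_eq (m := m) hW htT rfl
    have hu : ∀ ζ, (Merton.valueFunction W P m T U
        (Merton.gconv ((Merton.normSq m.priceOfRisk).toNNReal * (T - t)) h ζ) t).toReal = _ :=
      fun ζ => by rw [hv, EReal.toReal_coe]
    refine ⟨fun x hx => ?_, D.contDiffOn_value hu, fun x hx => D.iteratedDeriv_two_value_neg hu hx,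
      (D.toProfile.gconv _).tendsto_risk (D.riskTolerance_eq hW htT rfl)⟩
    obtain ⟨ζ, rfl⟩ := (D.toProfile.gconv
      ((Merton.normSq m.priceOfRisk).toNNReal * (T - t))).exists_eq hx
    rw [hv]
    exact ⟨EReal.coe_ne_top _, EReal.coe_ne_bot _⟩
  · lift s to ℝ≥0 using hs.1
    lift t to ℝ≥0 using ht.1
    dsimp only
    rw [hrt (by exact_mod_cast hs.2) hx, hrt (by exact_mod_cast ht.2) hx]
    exact D.toProfile.antitone_risk hr hrz D.risk hc hx (hle (by exact_mod_cast hst))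
  · lift t to ℝ≥0 using ht.1
    exact D.toProfile.concaveOn_risk_gconv D.risk hc
      (D.riskTolerance_eq hW (by exact_mod_cast ht.2.le) rfl) (hr0 t)
  · lift s to ℝ≥0 using hs.1
    lift t to ℝ≥0 using ht.1
    dsimp only
    rw [hrt (by exact_mod_cast ht.2) hx, hrt (by exact_mod_cast hs.2) hx]
    exact D.toProfile.monotone_risk hr hrz D.risk hc hx (hle (by exact_mod_cast hst))
  · lift t to ℝ≥0 using ht.1
    exact D.toProfile.convexOn_risk_gconv D.risk hc
      (D.riskTolerance_eq hW (by exact_mod_cast ht.2.le) rfl) (hr0 t)
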